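/- Let $T>0$, $d,n\ge 1$, $p\ge 0$. Let $\mathcal P^p(\mathbb R^d)$ be the set of Borel probability measures on $\mathbb R^d$ with finite moment of order $p$, with the Wasserstein distance $\mathcal W_p(m,m')=\big(\inf_\pi\int|x-y|^p\,\pi(dx,dy)\big)^{1/(1\vee p)}$, the infimum being over couplings $\pi$ of $m,m'$ (for $p=0$ the cost $|x-y|^p$ is replaced by $1\wedge|x-y|$). Let $A$ be a compact metric space, let $\sigma,\gamma\in\mathbb R^{d\times d}$ with $\sigma$ non-singular, and let $b:[0,T]\times\mathbb R^d\times\mathcal P^p(\mathbb R^d)\times A\to\mathbb R^d$ be a function $b(t,x,m,a)$ that is measurable in $t$, continuous in $(x,m,a)$, and satisfies, for some $c_1>0$, $$|b(t,x,m,a)|\le c_1\Big(1+1_{\{p>0\}}|x|+1_{\{p>0\}}\Big(\int|z|^p\,m(dz)\Big)^{1/(1\vee p)}\Big).$$ Let $(\Omega,\mathcal F,\mathbb F=(\mathcal F_t)_{t\in[0,T]},\mathbb P)$ be a filtered probability space supporting independent $d$-dimensional $\mathbb F$-Brownian motions $B,W^1,\dots,W^n$ and $\mathcal F_0$-measurable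 $\mathbb R^d$-valued random variables $X^1_0,\dots,X^n_0$. Let $S$ be a signal process: a continuous $\mathbb F$-adapted process with values in a Polish space $\mathcal S$, independent of $(X^i_0,W^i)_{i=1}^n$, and such that $B$ is adapted to the (completed) filtration $\mathbb F^S$ generated by $S$. Let $\alpha^1,\dots,\alpha^n$ be $S$-closed-loop controls: Borel functions $\alpha^i:[0,T]\times C([0,T];\mathbb R^d)^n\times C([0,T];\mathcal S)\to A$ such that $\alpha^i(t,\boldsymbol x,s)$ depends only on $t$ and on the restrictions of the paths $\boldsymbol x,s$ to $[0,t]$. Consider the system $$dX^i_t=b\big(t,X^i_t,\mu^n_t,\alpha^i(t,\boldsymbol X,S)\big)\,dt+\sigma\,dW^i_t+\gamma\,dB_t,\qquad \mu^n_t=\frac1n\sum_{k=1}^n\delta_{X^k_t},\qquad i=1,\dots,n,\tag{1}$$ for $\boldsymbol X=(X^1,\dots,X^n)$, started from the given $X^1_0,\dots,X^n_0$. A weak solution of (1) is an extension $(\Omega',\mathcal F',\mathbb F',\mathbb P')$ of the filtered probability space $(\Omega,\mathcal F,\mathbb F,\mathbb P)$ (that is, a filtered probability space with a measurable map $\pi:\Omega'\to\Omega$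 such that $\mathbb P'\circ\pi^{-1}=\mathbb P$ and $\pi^{-1}(\mathcal F_t)\subset\mathcal F'_t$ for all $t$; random variables on $\Omega$ are regarded as random variables on $\Omega'$ by composition with $\pi$), with a process $\boldsymbol X$ on it, such that: * $B,W^1,\dots,W^n$ are independent $\mathbb F'$-Brownian motions, and $\boldsymbol X$ is a continuous $\mathbb F'$-adapted $(\mathbb R^d)^n$-valued process; * the system (1) holds, with the given initial states; * $(W^1,\dots,W^n)$ is a Brownian motion with respect to the (completed) filtration $\mathbb F^{\boldsymbol X,S}$ generated by $(\boldsymbol X,S)$ under the conditional measure $\mathbb P'(\cdot\mid S=s)$, for $\mathcal L(S)$-almost every $s\in C([0,T];\mathcal S)$. Then there exists a weak solution of (1), and it is unique in law in the sense that any two weak solutions induce the same joint law of $(\boldsymbol X,S)$. -/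

import Mathlib

open MeasureTheory ProbabilityTheory
open scoped NNReal ENNReal

universe u v w u₁ u₂

namespace NPlayer

noncomputable section

/-! ### Path spaces -/

/-- `ℝ^d` with its Euclidean norm. -/
abbrev E (d : ℕ) := EuclideanSpace ℝ (Fin d)

/-- The time interval `[0, T]`. -/
abbrev Time (T : ℝ≥0) := Set.Icc (0 : ℝ) (T : ℝ)

/-- The time `0`, as an element of `[0, T]`. -/
def zeroTime (T : ℝ≥0) : Time T := ⟨0, le_rfl, T.2⟩

/-- The space `C([0, T]; F)`, with the topology of uniform convergence. -/
abbrev PathSpace (T : ℝ≥0) (F : Type*) [TopologicalSpace F] := C(Time T, F)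

/-- `C([0, T]; F)` carries its Borel `σ`-field. -/
instance instMeasurableSpacePathSpace (T : ℝ≥0) (F : Type*) [TopologicalSpace F] :
    MeasurableSpace (PathSpace T F) := borel _

instance instBorelSpacePathSpace (T : ℝ≥0) (F : Type*) [TopologicalSpace F] :
    BorelSpace (PathSpace T F) := ⟨rfl⟩

instance instPolishSpacePathSpace (T : ℝ≥0) (F : Type*) [TopologicalSpace F] [PolishSpace F] :
    PolishSpace (PathSpace T F) := by
  let _ := TopologicalSpace.upgradeIsCompletelyMetrizable F
  infer_instance

instance instNonemptyPathSpace (T : ℝ≥0) (F : Type*) [TopologicalSpace F] [Nonempty F] :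
    Nonempty (PathSpace T F) :=
  ⟨ContinuousMap.const _ (Classical.arbitrary F)⟩

/-- `𝓕^Z_t = σ(Z_r : r ≤ t)`, for a process `Z` with continuous paths. -/
@[reducible] def generated {T : ℝ≥0} {Ω F : Type*} [TopologicalSpace F] [MeasurableSpace F]
    (Z : Ω → PathSpace T F) (t : Time T) : MeasurableSpace Ω :=
  ⨆ r : Set.Iic t, MeasurableSpace.comap (fun ω => Z ω r) inferInstance

/-! ### Brownian motions -/

/-- `(V_i)_{i ∈ ι}` are independent `d`-dimensional `𝔾`-Brownian motions (started from `0`, with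
continuous paths) under `P`, i.e. `(V_i)_{i ∈ ι}` is a `d·|ι|`-dimensional `𝔾`-Brownian motion.
Adaptedness is understood up to `P`-null sets, that is, with respect to the completion of `𝔾`. -/
structure IsBrownian {T : ℝ≥0} {d : ℕ} {ι Ω : Type*} [Fintype ι] {mΩ : MeasurableSpace Ω}
    (𝔾 : Time T → MeasurableSpace Ω) (V : Ω → ι → PathSpace T (E d)) (P : Measure Ω) : Prop where
  measurable : Measurable V
  adapted : ∀ t i, AEStronglyMeasurable[𝔾 t] (fun ω => V ω i t) P
  start : ∀ᵐ ω ∂P, ∀ i, V ω i (zeroTime T) = 0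
  indep : ∀ s t, s ≤ t →
    Indep (MeasurableSpace.comap (fun ω i => V ω i t - V ω i s) inferInstance) (𝔾 s) P
  law : ∀ s t, s ≤ t → HasLaw (fun ω i => V ω i t - V ω i s)
    (Measure.pi fun _ : ι => multivariateGaussian 0
      (((t : ℝ) - (s : ℝ)) • (1 : Matrix (Fin d) (Fin d) ℝ))) P

/-- The family `(B, W^1, …, W^n)`, with `B` at the index `none`. -/
def noises {T : ℝ≥0} {d n : ℕ} {Ω : Type*} (B : Ω → PathSpace T (E d))
    (W : Ω → Fin n → PathSpace T (E d)) : Ω → Option (Fin n) → PathSpace T (E d) :=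
  fun ω o => o.elim (B ω) (W ω)

/-! ### Wasserstein spaces -/

/-- The transport cost `|x - y|^p` if `p > 0`, and `1 ∧ |x - y|` if `p = 0`. -/
def cost (p : ℝ≥0) {d : ℕ} (x y : E d) : ℝ≥0∞ :=
  if p = 0 then min 1 (edist x y) else edist x y ^ (p : ℝ)

/-- The couplings of two probability measures on `ℝ^d`. -/
def couplings {d : ℕ} (m m' : ProbabilityMeasure (E d)) : Set (Measure (E d × E d)) :=
  {π | π.map Prod.fst = m ∧ π.map Prod.snd = m'}

/-- The Wasserstein distance `𝒲_p`, with exponent `1 / (1 ∨ p)`. -/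
def wasserstein (p : ℝ≥0) {d : ℕ} (m m' : ProbabilityMeasure (E d)) : ℝ≥0∞ :=
  (⨅ π ∈ couplings m m', ∫⁻ z, cost p z.1 z.2 ∂π) ^ (1 / max 1 (p : ℝ))

/-- The space `𝒫^p(ℝ^d)` of probability measures with finite moment of order `p`. -/
def PSpace (p : ℝ≥0) (d : ℕ) : Type :=
  {m : ProbabilityMeasure (E d) // ∃ x₀ : E d, ∫⁻ x, edist x x₀ ^ (p : ℝ) ∂(m : Measure (E d)) < ∞}

/-- The topology of the metric `𝒲_p` on `𝒫^p(ℝ^d)`: a set is open iff it contains a ball around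
each of its points. -/
instance instTopologicalSpacePSpace (p : ℝ≥0) (d : ℕ) : TopologicalSpace (PSpace p d) where
  IsOpen U := ∀ m ∈ U, ∃ ε : ℝ≥0∞, 0 < ε ∧ ∀ m' : PSpace p d, wasserstein p m.1 m'.1 < ε → m' ∈ U
  isOpen_univ := fun _ _ => ⟨1, one_pos, fun _ _ => trivial⟩
  isOpen_inter := by
    rintro U V hU hV m ⟨hmU, hmV⟩
    obtain ⟨ε, hε, h⟩ := hU m hmU
    obtain ⟨δ, hδ, h'⟩ := hV m hmV
    exact ⟨min ε δ, lt_min hε hδ, fun m' hm' =>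
      ⟨h m' (hm'.trans_le (min_le_left _ _)), h' m' (hm'.trans_le (min_le_right _ _))⟩⟩
  isOpen_sUnion := by
    rintro 𝒰 h𝒰 m ⟨U, hU, hm⟩
    obtain ⟨ε, hε, h⟩ := h𝒰 U hU m hm
    exact ⟨ε, hε, fun m' hm' => ⟨U, hU, h m' hm'⟩⟩

/-- `∫ |z|^p m(dz)`. -/
def moment (p : ℝ≥0) {d : ℕ} (m : PSpace p d) : ℝ :=
  ∫ z, ‖z‖ ^ (p : ℝ) ∂(m.1 : Measure (E d))

/-- The empirical measure `(1/n) ∑_k δ_{x_k}`. -/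
def empirical (p : ℝ≥0) {d n : ℕ} [NeZero n] (x : Fin n → E d) : PSpace p d :=
  ⟨⟨(n : ℝ≥0∞)⁻¹ • ∑ k, Measure.dirac (x k), ⟨by
      simp [ENNReal.inv_mul_cancel (Nat.cast_ne_zero.2 (NeZero.ne n)) (ENNReal.natCast_ne_top n)]⟩⟩,
    0, by
      simp only [ProbabilityMeasure.coe_mk, lintegral_smul_measure, lintegral_finsetSum_measure,
        lintegral_dirac, smul_eq_mul]
      refine ENNReal.mul_lt_top (by simp [NeZero.pos n]) ?_
      exact ENNReal.sum_lt_top.2 fun k _ =>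
        ENNReal.rpow_lt_top_of_nonneg p.2 (edist_ne_top _ _)⟩

/-! ### The drift, controls and signals -/

/-- The standing assumptions on the drift `b : [0,T] × ℝ^d × 𝒫^p(ℝ^d) × A → ℝ^d`: measurable in
`t`, continuous in `(x, m, a)`, and of linear growth (bounded if `p = 0`). -/
structure IsDrift {T : ℝ≥0} {d : ℕ} {p : ℝ≥0} {A : Type*} [TopologicalSpace A]
    (b : Time T → E d → PSpace p d → A → E d) : Prop where
  measurable : ∀ x m a, Measurable fun t => b t x m a
  continuous : ∀ t, Continuous fun q : E d × PSpace p d × A => b t q.1 q.2.1 q.2.2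
  growth : ∃ c : ℝ, 0 < c ∧ ∀ t x m a, ‖b t x m a‖ ≤
    c * (1 + (if 0 < p then ‖x‖ else 0) +
      (if 0 < p then moment p m ^ (1 / max 1 (p : ℝ)) else 0))

/-- An `S`-closed-loop control: a progressively measurable function
`α : [0,T] × C([0,T]; ℝ^d)^n × C([0,T]; 𝒮) → A`, that is, a Borel function which at time `t` only
depends on the paths up to time `t`. -/
structure IsControl {T : ℝ≥0} {d n : ℕ} {𝒮 A : Type*} [TopologicalSpace 𝒮] [MeasurableSpace A]
    (α : Time T → (Fin n → PathSpace T (E d)) → PathSpace T 𝒮 → A) : Prop where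
  measurable : Measurable fun q : Time T × (Fin n → PathSpace T (E d)) × PathSpace T 𝒮 =>
    α q.1 q.2.1 q.2.2
  nonanticipative : ∀ t x y s s', (∀ r ≤ t, (∀ i, x i r = y i r) ∧ s r = s' r) →
    α t x s = α t y s'

/-- `S` is a signal process: it is `𝔽`-adapted and independent of `(X₀^i, W^i)_{i=1}^n`, and `B` is
adapted to (the completion of) the filtration generated by `S`. -/
structure IsSignal {T : ℝ≥0} {d n : ℕ} {𝒮 Ω : Type*} [TopologicalSpace 𝒮] [MeasurableSpace 𝒮]
    {mΩ : MeasurableSpace Ω} (𝔽 : Filtration (Time T) mΩ) (P : Measure Ω)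
    (B : Ω → PathSpace T (E d)) (W : Ω → Fin n → PathSpace T (E d)) (X₀ : Ω → Fin n → E d)
    (S : Ω → PathSpace T 𝒮) : Prop where
  adapted : ∀ t, Measurable[𝔽 t] fun ω => S ω t
  indep : IndepFun S (fun ω => (X₀ ω, W ω)) P
  adapted_noise : ∀ t, AEStronglyMeasurable[generated S t] (fun ω => B ω t) P

/-! ### Weak solutions -/

/-- `(Ω', 𝔽', P')`, with the projection `π : Ω' → Ω`, is an extension of the filtered probability
space `(Ω, 𝔽, P)`. Random variables on `Ω` are transferred to `Ω'` by composition with `π`. -/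
structure IsExtension {T : ℝ≥0} {Ω Ω' : Type*} {mΩ : MeasurableSpace Ω} {mΩ' : MeasurableSpace Ω'}
    (𝔽 : Filtration (Time T) mΩ) (P : Measure Ω) (𝔽' : Filtration (Time T) mΩ') (P' : Measure Ω')
    (π : Ω' → Ω) : Prop where
  measurePreserving : MeasurePreserving π P' P
  filtration_le : ∀ t, MeasurableSpace.comap π (𝔽 t) ≤ 𝔽' t

/-- The drift `b(t, X^i_t, μ^n_t, α^i(t, X, S))` of player `i`, along paths `x` of the states and
`s` of the signal, where `μ^n_t` is the empirical measure of the states at time `t`. -/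
def playerDrift {T : ℝ≥0} {d n : ℕ} [NeZero n] {p : ℝ≥0} {𝒮 A : Type*} [TopologicalSpace 𝒮]
    (b : Time T → E d → PSpace p d → A → E d)
    (α : Fin n → Time T → (Fin n → PathSpace T (E d)) → PathSpace T 𝒮 → A)
    (i : Fin n) (x : Fin n → PathSpace T (E d)) (s : PathSpace T 𝒮) (t : Time T) : E d :=
  b t (x i t) (empirical p fun k => x k t) (α i t x s)

/-- On a probability space `(Ω', P')`, the process `W` is an `𝔽^{X,S}`-Brownian motion under the
conditional measure `P'(· | S = s)`, for `ℒ(S)`-a.e. `s`. The conditional measure is the regular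
conditional law of `(X, S, W)` given `S = s`, on the path space, where `X`, `S`, `W` are the
coordinate processes. -/
def IsConditionallyBrownian {T : ℝ≥0} {d n : ℕ} {𝒮 Ω' : Type*} [TopologicalSpace 𝒮]
    [PolishSpace 𝒮] [MeasurableSpace 𝒮] [Nonempty 𝒮] {mΩ' : MeasurableSpace Ω'}
    (P' : Measure Ω') [IsFiniteMeasure P'] (X : Ω' → Fin n → PathSpace T (E d))
    (S : Ω' → PathSpace T 𝒮) (W : Ω' → Fin n → PathSpace T (E d)) : Prop :=
  ∀ᵐ s ∂(P'.map S), IsBrownian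
    (Ω := (Fin n → PathSpace T (E d)) × PathSpace T 𝒮 × (Fin n → PathSpace T (E d)))
    (fun t => (⨆ i, generated (fun z => z.1 i) t) ⊔ generated (fun z => z.2.1) t)
    (fun z => z.2.2) (condDistrib (fun ω => (X ω, S ω, W ω)) S P' s)

/-- `(Ω', 𝔽', P')`, with the projection `π` and the process `X`, is a weak solution of the system
`dX^i_t = b(t, X^i_t, μ^n_t, α^i(t, X, S)) dt + σ dW^i_t + γ dB_t`, `X^i_0 = X₀^i`. -/
structure IsWeakSolution {T : ℝ≥0} {d n : ℕ} [NeZero n] {p : ℝ≥0} {𝒮 A Ω Ω' : Type*}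
    [TopologicalSpace 𝒮] [PolishSpace 𝒮] [MeasurableSpace 𝒮] [Nonempty 𝒮]
    {mΩ : MeasurableSpace Ω} {mΩ' : MeasurableSpace Ω'}
    (b : Time T → E d → PSpace p d → A → E d) (σ γ : Matrix (Fin d) (Fin d) ℝ)
    (α : Fin n → Time T → (Fin n → PathSpace T (E d)) → PathSpace T 𝒮 → A)
    (𝔽 : Filtration (Time T) mΩ) (P : Measure Ω)
    (B : Ω → PathSpace T (E d)) (W : Ω → Fin n → PathSpace T (E d)) (X₀ : Ω → Fin n → E d)
    (S : Ω → PathSpace T 𝒮)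
    (𝔽' : Filtration (Time T) mΩ') (P' : Measure Ω') [IsProbabilityMeasure P'] (π : Ω' → Ω)
    (X : Ω' → Fin n → PathSpace T (E d)) : Prop where
  extension : IsExtension 𝔽 P 𝔽' P' π
  brownian : IsBrownian (fun t => 𝔽' t) (noises (B ∘ π) (W ∘ π)) P'
  adapted : ∀ i t, Measurable[𝔽' t] fun ω => X ω i t
  integrable : ∀ᵐ ω ∂P', ∀ i, IntervalIntegrable
    (fun r : ℝ => playerDrift b α i (X ω) (S (π ω)) (Set.projIcc 0 (T : ℝ) T.2 r)) volume 0 T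
  sde : ∀ᵐ ω ∂P', ∀ i (t : Time T), X ω i t = X₀ (π ω) i +
    (∫ r in (0 : ℝ)..t, playerDrift b α i (X ω) (S (π ω)) (Set.projIcc 0 (T : ℝ) T.2 r)) +
    σ.toEuclideanLin (W (π ω) i t) + γ.toEuclideanLin (B (π ω) t)
  conditionally_brownian : IsConditionallyBrownian P' X (S ∘ π) (W ∘ π)

end

end NPlayer

/-!
Let `β` be a measurable function with `B = β(S)` almost surely; such a function exists because `B`
is adapted to the signal (`IsSignal.exists_eq_comp`). Since `σ` is invertible, the states are
encoded by the driving path `V = σ⁻¹ (X - X₀ - γ B)`, and the system becomes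
`V = W + ∫ f(r, Y, V) dr`, where the parameter `Y = (X₀, S, β(S))` is known at time `0`, where `W`
is a Brownian motion for the filtration which knows `Y` from the start, and where `f` is only
measurable and causal in `V`, of linear growth with a constant depending on `Y`
(`residual_costate_eq_bundle_iff`, `IsSignal.isBM`). No continuous-time stochastic integral is
needed to solve this equation in law.

The equation in which the drift only sees the path with a delay `h > 0` has an explicit adapted
solution `delaySol h Y W`, obtained by finitely many substitutions. The measurable transformation
`v ↦ v - ∫ f` recovers `W` from any solution, and a solution also solves the delayed equation
driven by `W` plus the primitive of the difference of the two drifts, whose energy tends to zero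
with `h`. The effect of a shift of a Brownian motion by an adapted drift is controlled, in total
variation, by the energy of the drift (`IsBM.measure_shift_le`): this quantitative form of
Girsanov's theorem follows from its discrete version for Gaussian increments, by refining a grid.

* Uniqueness. A weak solution satisfies the equation with respect to a Brownian motion: by the
  condition on the conditional laws given `S`, the noise remains a Brownian motion in the filtration
  generated by `X` and the whole path of `S` (`IsConditionallyBrownian.isBM`). By the comparison
  above, the law of `(X, S)` is the limit, as `h → 0`, of the laws of the solutions of the delayed
  equations, which are functions of the given data only (`IsBM.tendsto_measure_delaySol`,
  `IsWeakSolution.tendsto_measure`).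
* Existence. The same comparison shows that the laws of the delayed solutions form a Cauchy family,
  uniformly on measurable sets. Hence they converge jointly with the data, and the disintegration
  of the limit along the data is a kernel `η` for which `P ⊗ η` carries a solution
  (`IsBM.exists_kernel`, `IsSignal.exists_kernel`). Convergence is stable, i.e. it holds on every
  event of the given space, so that the independence of the increments of the noises from the past
  of the delayed solutions passes to the limit (`indep_of_tendsto`). This gives both the Brownian
  property of `(B, W)` on the extension (`isBrownian_limitFiltration`) and, after disintegration
  with respect to `S`, the Brownian property of `W` under the conditional laws
  (`isConditionallyBrownian_limitState`).
-/

set_option linter.unusedSectionVars false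

namespace NPlayer

open Filter Topology Set

noncomputable section


/-! ### Path spaces and stopped paths -/

section Paths

variable {T : ℝ≥0} {F : Type*} [TopologicalSpace F] [PolishSpace F] [MeasurableSpace F]
  [BorelSpace F]

instance instNonemptyTime (T : ℝ≥0) : Nonempty (Time T) := ⟨zeroTime T⟩

/-- The values of a path along a dense sequence of times. -/
def evalDense (T : ℝ≥0) (F : Type*) [TopologicalSpace F] (x : PathSpace T F) : ℕ → F :=
  fun k => x (TopologicalSpace.denseSeq (Time T) k)

lemma continuous_evalDense : Continuous (evalDense T F) :=
  continuous_pi fun k => by unfold evalDense; fun_prop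

lemma injective_evalDense : Function.Injective (evalDense T F) := by
  intro x y h
  have := Continuous.ext_on (TopologicalSpace.denseRange_denseSeq (Time T)) x.continuous
    y.continuous (by rintro _ ⟨k, rfl⟩; exact congrFun h k)
  exact DFunLike.coe_injective this

lemma measurableEmbedding_evalDense : MeasurableEmbedding (evalDense T F) :=
  continuous_evalDense.measurableEmbedding injective_evalDense

lemma measurable_eval (t : Time T) : Measurable fun x : PathSpace T F => x t :=
  (continuous_eval_const t).measurable

/-- The Borel `σ`-field of the path space is generated by the evaluations. -/
lemma measurable_path_iff {Ω : Type*} {m : MeasurableSpace Ω} {Z : Ω → PathSpace T F} :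
    Measurable Z ↔ ∀ t, Measurable fun ω => Z ω t := by
  refine ⟨fun h t => (measurable_eval t).comp h, fun h => ?_⟩
  rw [← measurableEmbedding_evalDense.measurable_comp_iff]
  exact measurable_pi_iff.2 fun k => h _

lemma measurable_path_eval :
    Measurable fun q : PathSpace T F × Time T => q.1 q.2 :=
  (continuous_eval (F := C(Time T, F))).measurable

/-- The path stopped at time `t`. -/
def stopAt (t : Time T) (x : PathSpace T F) : PathSpace T F :=
  x.comp ⟨fun r => min r t, by fun_prop⟩

@[simp] lemma stopAt_apply (t r : Time T) (x : PathSpace T F) : stopAt t x r = x (min r t) := rfl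

lemma stopAt_eq_iff {t : Time T} {x y : PathSpace T F} :
    stopAt t x = stopAt t y ↔ ∀ r ≤ t, x r = y r := by
  refine ⟨fun h r hr => ?_, fun h => ?_⟩
  · have := DFunLike.congr_fun h r
    simpa [min_eq_left hr] using this
  · ext r
    exact h _ (min_le_right _ _)

lemma measurable_stopAt_iff {Ω : Type*} {m : MeasurableSpace Ω} {Z : Ω → PathSpace T F}
    {t : Time T} :
    Measurable (fun ω => stopAt t (Z ω)) ↔ ∀ r ≤ t, Measurable fun ω => Z ω r := by
  rw [measurable_path_iff]
  refine ⟨fun h r hr => ?_, fun h r => h _ (min_le_right _ _)⟩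
  simpa [min_eq_left hr] using h r

lemma measurable_stopAt (t : Time T) : Measurable (stopAt t : PathSpace T F → PathSpace T F) :=
  measurable_stopAt_iff.2 fun r _ => measurable_eval r

lemma comap_stopAt {Ω : Type*} (Z : Ω → PathSpace T F) (t : Time T) :
    MeasurableSpace.comap (fun ω => stopAt t (Z ω)) inferInstance = generated Z t := by
  apply le_antisymm
  · rw [← measurable_iff_comap_le, measurable_stopAt_iff]
    intro r hr
    refine Measurable.mono (measurable_iff_comap_le.2 le_rfl) ?_ le_rfl
    exact le_iSup (fun r : Iic t =>
      MeasurableSpace.comap (fun ω => Z ω r) (inferInstance : MeasurableSpace F)) ⟨r, hr⟩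
  · refine iSup_le fun r => ?_
    rw [← measurable_iff_comap_le]
    exact (measurable_stopAt_iff
      (m := MeasurableSpace.comap (fun ω => stopAt t (Z ω)) inferInstance)).1
      (measurable_iff_comap_le.2 le_rfl) r.1 r.2

end Paths


/-! ### Gaussian increments -/

section Gaussian

open scoped RealInnerProductSpace

lemma gaussianReal_withDensity_exp (a : ℝ) :
    (gaussianReal 0 1).withDensity (fun x => ENNReal.ofReal (Real.exp (-(a * x) - a ^ 2 / 2))) =
      gaussianReal (-a) 1 := by
  rw [gaussianReal_of_var_ne_zero _ one_ne_zero, gaussianReal_of_var_ne_zero _ one_ne_zero,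
    ← withDensity_mul _ (measurable_gaussianPDF _ _) (by fun_prop)]
  congr 1
  ext x
  simp only [Pi.mul_apply, gaussianPDF, gaussianPDFReal]
  rw [← ENNReal.ofReal_mul (by positivity), mul_assoc, ← Real.exp_add]
  congr 3
  push_cast
  ring

lemma lintegral_pi_gaussian_shift {ι : Type*} [Fintype ι] (a : ι → ℝ) {F : (ι → ℝ) → ℝ≥0∞}
    (hF : Measurable F) :
    ∫⁻ x, ENNReal.ofReal (Real.exp (-(∑ i, a i * x i) - (∑ i, a i ^ 2) / 2)) * F (x + a)
      ∂(Measure.pi fun _ : ι => gaussianReal 0 1) =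
    ∫⁻ x, F x ∂(Measure.pi fun _ : ι => gaussianReal 0 1) := by
  have h1 : (Measure.pi fun _ : ι => gaussianReal 0 1).withDensity
      (fun x => ENNReal.ofReal (Real.exp (-(∑ i, a i * x i) - (∑ i, a i ^ 2) / 2))) =
      Measure.pi fun i => gaussianReal (-a i) 1 := by
    symm
    refine Measure.pi_eq fun s hs => ?_
    set ρ : ι → ℝ → ℝ≥0∞ := fun i => (s i).indicator
      fun x => ENNReal.ofReal (Real.exp (-(a i * x) - a i ^ 2 / 2)) with hρ
    have hρm : ∀ i, Measurable (ρ i) := fun i => Measurable.indicator (by fun_prop) (hs i)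
    have h : ∀ x : ι → ℝ, (univ.pi s).indicator
        (fun x => ENNReal.ofReal (Real.exp (-(∑ i, a i * x i) - (∑ i, a i ^ 2) / 2))) x =
        ∏ i, ρ i (x i) := by
      intro x
      by_cases hx : x ∈ univ.pi s
      · rw [indicator_of_mem hx]
        have : ∀ i, ρ i (x i) = ENNReal.ofReal (Real.exp (-(a i * x i) - a i ^ 2 / 2)) :=
          fun i => indicator_of_mem (hx i (mem_univ i)) _
        simp_rw [this]
        rw [← ENNReal.ofReal_prod_of_nonneg (fun i _ => (Real.exp_pos _).le), ← Real.exp_sum]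
        congr 2
        rw [Finset.sum_sub_distrib, Finset.sum_neg_distrib, Finset.sum_div]
      · rw [indicator_of_notMem hx]
        obtain ⟨i, hi⟩ : ∃ i, x i ∉ s i := by simpa [Set.mem_pi] using hx
        exact (Finset.prod_eq_zero (Finset.mem_univ i) (indicator_of_notMem hi _)).symm
    rw [withDensity_apply _ (MeasurableSet.univ_pi hs),
      ← lintegral_indicator (MeasurableSet.univ_pi hs), lintegral_congr h,
      lintegral_prod_eq_prod_lintegral_of_indepFun Finset.univ (fun i (x : ι → ℝ) => ρ i (x i))
        (iIndepFun_pi fun i => (hρm i).aemeasurable)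
        (fun i => (hρm i).comp (measurable_pi_apply i))]
    refine Finset.prod_congr rfl fun i _ => ?_
    rw [(measurePreserving_eval (fun _ : ι => gaussianReal 0 1) i).lintegral_comp (hρm i),
      hρ, lintegral_indicator (hs i), ← gaussianReal_withDensity_exp, withDensity_apply _ (hs i)]
  have h2 : (Measure.pi fun i => gaussianReal (-a i) 1).map (fun x => x + a) =
      Measure.pi fun _ : ι => gaussianReal 0 1 := by
    have := Measure.pi_map_pi (μ := fun i => gaussianReal (-a i) 1) (f := fun i x => x + a i)
      (fun i => by fun_prop)
    simp only [gaussianReal_map_add_const, neg_add_cancel] at this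
    exact this
  have h3 : Measurable fun x : ι → ℝ => F (x + a) := hF.comp (by fun_prop)
  conv_rhs => rw [← h2, lintegral_map hF (by fun_prop), ← h1,
    lintegral_withDensity_eq_lintegral_mul _ (by fun_prop) h3]
  rfl

variable {K : Type*} [NormedAddCommGroup K] [InnerProductSpace ℝ K] [FiniteDimensional ℝ K]
  [MeasurableSpace K] [BorelSpace K]

lemma lintegral_stdGaussian_shift (a : K) {F : K → ℝ≥0∞} (hF : Measurable F) :
    ∫⁻ x, ENNReal.ofReal (Real.exp (-⟪a, x⟫ - ‖a‖ ^ 2 / 2)) * F (x + a) ∂(stdGaussian K) =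
    ∫⁻ x, F x ∂(stdGaussian K) := by
  have hm : Measurable fun x : Fin (Module.finrank ℝ K) → ℝ =>
      ∑ i, x i • stdOrthonormalBasis ℝ K i := by fun_prop
  have h3 : Measurable fun x : K => F (x + a) := hF.comp (by fun_prop)
  have h4 : Measurable fun x : K =>
      ENNReal.ofReal (Real.exp (-⟪a, x⟫ - ‖a‖ ^ 2 / 2)) := by fun_prop
  have h5 : Measurable fun x : K =>
      ENNReal.ofReal (Real.exp (-⟪a, x⟫ - ‖a‖ ^ 2 / 2)) * F (x + a) := h4.mul h3
  rw [stdGaussian, lintegral_map hF hm, lintegral_map h5 hm]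
  refine Eq.trans ?_
    (lintegral_pi_gaussian_shift (fun i => ⟪stdOrthonormalBasis ℝ K i, a⟫) (hF.comp hm))
  congr 1
  ext x
  have e1 : ⟪a, ∑ i, x i • stdOrthonormalBasis ℝ K i⟫ =
      ∑ i, ⟪stdOrthonormalBasis ℝ K i, a⟫ * x i := by
    rw [inner_sum]
    refine Finset.sum_congr rfl fun i _ => ?_
    rw [real_inner_smul_right, real_inner_comm, mul_comm]
  have e2 : ‖a‖ ^ 2 = ∑ i, ⟪stdOrthonormalBasis ℝ K i, a⟫ ^ 2 :=
    ((stdOrthonormalBasis ℝ K).sum_sq_inner_right a).symm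
  have e3 : (∑ i, (x i + ⟪stdOrthonormalBasis ℝ K i, a⟫) • stdOrthonormalBasis ℝ K i) =
      (∑ i, x i • stdOrthonormalBasis ℝ K i) + a := by
    simp_rw [add_smul, Finset.sum_add_distrib, (stdOrthonormalBasis ℝ K).sum_repr' a]
  simp only [Pi.add_apply]
  rw [e1, e2, e3]

variable (K) in
/-- The centred Gaussian law on `K` with covariance `δ • id`: the law of the increment of a
`K`-valued Brownian motion over a time interval of length `δ`. -/
def gaussianIncr (δ : ℝ) : Measure K := (stdGaussian K).map fun x => √δ • x

instance (δ : ℝ) : IsProbabilityMeasure (gaussianIncr K δ) :=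
  Measure.isProbabilityMeasure_map (by fun_prop)

/-- The Cameron–Martin formula in finite dimension. -/
lemma lintegral_gaussianIncr_shift {δ : ℝ} (hδ : 0 ≤ δ) (a : K) {F : K → ℝ≥0∞}
    (hF : Measurable F) :
    ∫⁻ x, ENNReal.ofReal (Real.exp (-(⟪a, x⟫ + δ / 2 * ‖a‖ ^ 2))) * F (x + δ • a)
      ∂(gaussianIncr K δ) = ∫⁻ x, F x ∂(gaussianIncr K δ) := by
  have hm : Measurable fun x : K => √δ • x := by fun_prop
  have h3 : Measurable fun x : K => F (x + δ • a) := hF.comp (by fun_prop)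
  have h4 : Measurable fun x : K =>
      ENNReal.ofReal (Real.exp (-(⟪a, x⟫ + δ / 2 * ‖a‖ ^ 2))) := by fun_prop
  have h5 : Measurable fun x : K =>
      ENNReal.ofReal (Real.exp (-(⟪a, x⟫ + δ / 2 * ‖a‖ ^ 2))) * F (x + δ • a) := h4.mul h3
  rw [gaussianIncr, lintegral_map hF hm, lintegral_map h5 hm]
  refine Eq.trans ?_ (lintegral_stdGaussian_shift (√δ • a) (hF.comp hm))
  congr 1
  ext x
  rw [real_inner_smul_right, real_inner_smul_left, norm_smul, mul_pow, Real.norm_eq_abs, sq_abs,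
    Real.sq_sqrt hδ, smul_add, smul_smul, Real.mul_self_sqrt hδ]
  congr 3
  ring

lemma lintegral_gaussianIncr_sq {δ : ℝ} (hδ : 0 ≤ δ) (s : ℝ) (a : K) :
    ∫⁻ x, ENNReal.ofReal ((s + ⟪a, x⟫) ^ 2) ∂(gaussianIncr K δ) =
      ENNReal.ofReal (s ^ 2 + δ * ‖a‖ ^ 2) := by
  rw [gaussianIncr, lintegral_map (by fun_prop) (by fun_prop)]
  simp_rw [real_inner_smul_right]
  have hL : MemLp (fun x : K => ⟪a, x⟫) 2 (stdGaussian K) := by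
    have := (IsGaussian.memLp_two_id (μ := stdGaussian K))
    exact this.const_inner a
  have hi : Integrable (fun x : K => ⟪a, x⟫) (stdGaussian K) := hL.integrable one_le_two
  have hi2 : Integrable (fun x : K => ⟪a, x⟫ ^ 2) (stdGaussian K) := hL.integrable_sq
  have h0 : ∫ x, ⟪a, x⟫ ∂(stdGaussian K) = 0 := by
    simpa using integral_strongDual_stdGaussian (innerSL ℝ a)
  have h2 : ∫ x, ⟪a, x⟫ ^ 2 ∂(stdGaussian K) = ‖a‖ ^ 2 := by
    have := variance_dual_stdGaussian (innerSL ℝ a)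
    rw [variance_of_integral_eq_zero (by fun_prop) (by simpa using h0)] at this
    simpa using this
  have e : ∀ x : K, (s + √δ * ⟪a, x⟫) ^ 2 = s ^ 2 + (2 * s * √δ) * ⟪a, x⟫ + δ * ⟪a, x⟫ ^ 2 := by
    intro x
    rw [add_sq, mul_pow, Real.sq_sqrt hδ]; ring
  rw [← ofReal_integral_eq_lintegral_ofReal _ (ae_of_all _ fun x => sq_nonneg _)]
  · congr 1
    simp_rw [e]
    rw [integral_add, integral_add, integral_const_mul, integral_const_mul, h0, h2]
    · simp
    · exact integrable_const _
    · exact hi.const_mul _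
    · exact (integrable_const _).add (hi.const_mul _)
    · exact hi2.const_mul _
  · simp_rw [e]
    exact ((integrable_const _).add (hi.const_mul _)).add (hi2.const_mul _)

end Gaussian


/-! ### Girsanov's theorem in discrete time -/

section Discrete

open scoped RealInnerProductSpace

variable {K : Type*} [NormedAddCommGroup K] [InnerProductSpace ℝ K] [FiniteDimensional ℝ K]
  [MeasurableSpace K] [BorelSpace K]
variable {Ω : Type*} {mΩ : MeasurableSpace Ω} {P : Measure Ω} [IsProbabilityMeasure P]

/-- `g 0, …, g (N - 1)` are Gaussian increments over time steps of length `δ`, adapted to the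
discrete filtration `𝓗` and independent of its past. -/
structure IsNoise (𝓗 : ℕ → MeasurableSpace Ω) (g : ℕ → Ω → K) (δ : ℝ) (N : ℕ)
    (P : Measure Ω) : Prop where
  mono : Monotone 𝓗
  le : ∀ j, 𝓗 j ≤ mΩ
  meas : ∀ j < N, Measurable[𝓗 (j + 1)] (g j)
  indep : ∀ j < N, Indep (MeasurableSpace.comap (g j) inferInstance) (𝓗 j) P
  law : ∀ j < N, P.map (g j) = gaussianIncr K δ

variable {𝓗 : ℕ → MeasurableSpace Ω} {g θ : ℕ → Ω → K} {δ : ℝ} {N : ℕ}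

lemma lintegral_of_indep {Ω Z K' : Type*} [MeasurableSpace Z] [MeasurableSpace K']
    {m mΩ : MeasurableSpace Ω} {P : Measure Ω} [IsProbabilityMeasure P] (hm : m ≤ mΩ)
    {ξ : Ω → K'} (hξ : Measurable ξ)
    (hi : Indep (MeasurableSpace.comap ξ inferInstance) m P)
    {Ξ : Ω → Z} (hΞ : Measurable[m] Ξ) {F : Z × K' → ℝ≥0∞} (hF : Measurable F) :
    ∫⁻ ω, F (Ξ ω, ξ ω) ∂P = ∫⁻ ω, ∫⁻ x, F (Ξ ω, x) ∂(P.map ξ) ∂P := by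
  have hΞ' : Measurable Ξ := hΞ.mono hm le_rfl
  have hind : IndepFun Ξ ξ P := by
    rw [IndepFun_iff_Indep]
    exact indep_of_indep_of_le_left hi.symm (measurable_iff_comap_le.1 hΞ)
  have hprob : IsProbabilityMeasure (P.map ξ) := Measure.isProbabilityMeasure_map hξ.aemeasurable
  have h := (indepFun_iff_map_prod_eq_prod_map_map hΞ'.aemeasurable hξ.aemeasurable).1 hind
  calc ∫⁻ ω, F (Ξ ω, ξ ω) ∂P = ∫⁻ z, F z ∂(P.map fun ω => (Ξ ω, ξ ω)) :=
        (lintegral_map hF (hΞ'.prodMk hξ)).symm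
    _ = ∫⁻ z, ∫⁻ x, F (z, x) ∂(P.map ξ) ∂(P.map Ξ) := by rw [h, lintegral_prod _ hF.aemeasurable]
    _ = _ := lintegral_map hF.lintegral_prod_right' hΞ'

/-- The first `N` terms of a sequence, continued by zeros. -/
def trunc (N : ℕ) (u : ℕ → K) : ℕ → K := fun j => if j < N then u j else 0

/-- Replacement of the `N`-th term of a sequence. -/
def setTerm (N : ℕ) (u : ℕ → K) (x : K) : ℕ → K := fun j => if j = N then x else u j

lemma trunc_succ (N : ℕ) (u : ℕ → K) : trunc (N + 1) u = setTerm N (trunc N u) (u N) := by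
  ext j
  simp only [trunc, setTerm]
  grind

lemma measurable_setTerm (N : ℕ) : Measurable fun q : (ℕ → K) × K => setTerm N q.1 q.2 := by
  refine measurable_pi_iff.2 fun j => ?_
  unfold setTerm
  by_cases h : j = N
  · simp only [h, if_true]; fun_prop
  · simp only [h, if_false]; fun_prop

lemma measurable_trunc {m : MeasurableSpace Ω} {u : ℕ → Ω → K} (hu : ∀ j < N, Measurable[m] (u j)) :
    Measurable[m] fun ω => trunc N fun j => u j ω := by
  refine measurable_pi_iff.2 fun j => ?_
  unfold trunc
  by_cases h : j < N
  · simpa only [h, if_true] using hu j h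
  · simp only [h, if_false]; exact measurable_const

/-- Minus the logarithm of the Girsanov density of the first `N` steps. -/
def logDensity (g θ : ℕ → Ω → K) (δ : ℝ) (N : ℕ) (ω : Ω) : ℝ :=
  ∑ j ∈ Finset.range N, (⟪θ j ω, g j ω⟫ + δ / 2 * ‖θ j ω‖ ^ 2)

lemma measurable_inner_of {Ω : Type*} {m : MeasurableSpace Ω} {a b : Ω → K}
    (ha : Measurable[m] a) (hb : Measurable[m] b) : Measurable[m] fun ω => ⟪a ω, b ω⟫ :=
  ha.inner hb

lemma measurable_mul_norm_sq {Ω : Type*} {m : MeasurableSpace Ω} {a : Ω → K} (c : ℝ)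
    (ha : Measurable[m] a) : Measurable[m] fun ω => c * ‖a ω‖ ^ 2 :=
  (ha.norm.pow_const 2).const_mul c

lemma IsNoise.measurable_le (h : IsNoise 𝓗 g δ N P) {j n : ℕ} (hj : j < N) (hn : j < n) :
    Measurable[𝓗 n] (g j) :=
  (h.meas j hj).mono (h.mono hn) le_rfl

lemma IsNoise.measurable_logDensity (h : IsNoise 𝓗 g δ N P) (hθ : ∀ j < N, Measurable[𝓗 j] (θ j))
    {n : ℕ} (hn : n ≤ N) : Measurable[𝓗 n] (logDensity g θ δ n) := by
  refine Finset.measurable_fun_sum _ fun j hj => ?_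
  have hj := Finset.mem_range.1 hj
  have h1 : Measurable[𝓗 n] (θ j) := (hθ j (hj.trans_le hn)).mono (h.mono hj.le) le_rfl
  exact (measurable_inner_of h1 (h.measurable_le (hj.trans_le hn) hj)).add
    (measurable_mul_norm_sq _ h1)

/-- Girsanov's theorem: after a change of measure the shifted increments have the law of the
unshifted ones, jointly with the initial information `Y`. -/
theorem IsNoise.lintegral_girsanov {𝒴 : Type*} [MeasurableSpace 𝒴] (hδ : 0 ≤ δ)
    (h : IsNoise 𝓗 g δ N P) (hθ : ∀ j < N, Measurable[𝓗 j] (θ j))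
    {Y : Ω → 𝒴} (hY : Measurable[𝓗 0] Y) {n : ℕ} (hn : n ≤ N)
    {F : 𝒴 × (ℕ → K) → ℝ≥0∞} (hF : Measurable F) :
    ∫⁻ ω, ENNReal.ofReal (Real.exp (-logDensity g θ δ n ω)) *
      F (Y ω, trunc n fun j => g j ω + δ • θ j ω) ∂P =
    ∫⁻ ω, F (Y ω, trunc n fun j => g j ω) ∂P := by
  induction n generalizing F with
  | zero =>
    have : ∀ u : ℕ → K, trunc 0 u = 0 := fun u => funext fun j => by simp [trunc]
    simp [logDensity, this]
  | succ n ih =>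
    have hnN : n < N := hn
    have hYn : Measurable[𝓗 n] Y := hY.mono (h.mono (Nat.zero_le n)) le_rfl
    have hgm : Measurable (g n) := (h.meas n hnN).mono (h.le _) le_rfl
    have hU : Measurable[𝓗 n] fun ω => trunc n fun j => g j ω + δ • θ j ω :=
      measurable_trunc fun j hj => (h.measurable_le (hj.trans hnN) hj).add
        (((hθ j (hj.trans hnN)).mono (h.mono hj.le) le_rfl).const_smul δ)
    have hG : Measurable[𝓗 n] fun ω => trunc n fun j => g j ω :=
      measurable_trunc fun j hj => h.measurable_le (hj.trans hnN) hj
    set F' : 𝒴 × (ℕ → K) → ℝ≥0∞ :=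
      fun q => ∫⁻ x, F (q.1, setTerm n q.2 x) ∂(gaussianIncr K δ) with hF'
    have hFs : Measurable fun q : (𝒴 × (ℕ → K)) × K => F (q.1.1, setTerm n q.1.2 q.2) :=
      hF.comp ((measurable_fst.comp measurable_fst).prodMk
        ((measurable_setTerm n).comp ((measurable_snd.comp measurable_fst).prodMk measurable_snd)))
    have hF'm : Measurable F' := hFs.lintegral_prod_right'
    have hsplit : ∀ q : 𝒴 × (ℕ → K), ∀ a : K, Measurable fun x => F (q.1, setTerm n q.2 x) :=
      fun q a => hFs.comp measurable_prodMk_left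
    -- The last increment is independent of the past: integrate it out.
    have hR : ∫⁻ ω, F (Y ω, trunc (n + 1) fun j => g j ω) ∂P =
        ∫⁻ ω, F' (Y ω, trunc n fun j => g j ω) ∂P := by
      simp_rw [trunc_succ]
      rw [lintegral_of_indep (h.le n) hgm (h.indep n hnN) (hYn.prodMk hG) hFs, h.law n hnN]
    -- Given the past, the Cameron–Martin formula removes the shift of the last increment.
    set Φ : ((𝒴 × (ℕ → K)) × K × ℝ) × K → ℝ≥0∞ := fun q =>
      ENNReal.ofReal (Real.exp (-q.1.2.2)) *
        (ENNReal.ofReal (Real.exp (-(⟪q.1.2.1, q.2⟫ + δ / 2 * ‖q.1.2.1‖ ^ 2))) *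
          F (q.1.1.1, setTerm n q.1.1.2 (q.2 + δ • q.1.2.1))) with hΦ
    have hΦm : Measurable Φ := by
      have e1 : Measurable fun q : ((𝒴 × (ℕ → K)) × K × ℝ) × K =>
          (q.1.1, q.2 + δ • q.1.2.1) := by fun_prop
      have e2 : Measurable fun q : ((𝒴 × (ℕ → K)) × K × ℝ) × K => ⟪q.1.2.1, q.2⟫ :=
        measurable_inner_of (by fun_prop) (by fun_prop)
      have := hFs.comp e1
      refine Measurable.mul (by fun_prop) (Measurable.mul (by fun_prop) this)
    have hL : ∫⁻ ω, ENNReal.ofReal (Real.exp (-logDensity g θ δ (n + 1) ω)) *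
        F (Y ω, trunc (n + 1) fun j => g j ω + δ • θ j ω) ∂P =
        ∫⁻ ω, Φ (((Y ω, trunc n fun j => g j ω + δ • θ j ω), θ n ω, logDensity g θ δ n ω),
          g n ω) ∂P := by
      refine lintegral_congr fun ω => ?_
      simp only [hΦ, trunc_succ]
      rw [← mul_assoc, ← ENNReal.ofReal_mul (Real.exp_pos _).le, ← Real.exp_add]
      congr 4
      simp only [logDensity, Finset.sum_range_succ]
      ring
    rw [hL, lintegral_of_indep (h.le n) hgm (h.indep n hnN)
      ((hYn.prodMk hU).prodMk ((hθ n hnN).prodMk (h.measurable_logDensity hθ hnN.le))) hΦm,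
      h.law n hnN, hR, ← ih hnN.le hF'm]
    refine lintegral_congr fun ω => ?_
    simp only [hΦ]
    rw [lintegral_const_mul, lintegral_gaussianIncr_shift hδ (θ n ω) (hsplit (Y ω, _) 0)]
    have := (hsplit (Y ω, trunc n fun j => g j ω + δ • θ j ω) 0).comp
      (measurable_id.add_const (δ • θ n ω))
    exact Measurable.mul (by fun_prop) this

/-- Itô's isometry for discrete stochastic integrals. -/
lemma IsNoise.lintegral_sq_sum (hδ : 0 ≤ δ)
    (h : IsNoise 𝓗 g δ N P) (hθ : ∀ j < N, Measurable[𝓗 j] (θ j)) {n : ℕ} (hn : n ≤ N) :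
    ∫⁻ ω, ENNReal.ofReal ((∑ j ∈ Finset.range n, ⟪θ j ω, g j ω⟫) ^ 2) ∂P =
    ∫⁻ ω, ENNReal.ofReal (∑ j ∈ Finset.range n, δ * ‖θ j ω‖ ^ 2) ∂P := by
  induction n with
  | zero => simp
  | succ n ih =>
    have hnN : n < N := hn
    have hgm : Measurable (g n) := (h.meas n hnN).mono (h.le _) le_rfl
    have hS : Measurable[𝓗 n] fun ω => ∑ j ∈ Finset.range n, ⟪θ j ω, g j ω⟫ := by
      refine Finset.measurable_fun_sum _ fun j hj => ?_
      have hj := Finset.mem_range.1 hj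
      exact measurable_inner_of ((hθ j (hj.trans hnN)).mono (h.mono hj.le) le_rfl)
        (h.measurable_le (hj.trans hnN) hj)
    have hSm := hS.mono (h.le n) le_rfl
    have hF : Measurable fun q : (ℝ × K) × K => ENNReal.ofReal ((q.1.1 + ⟪q.1.2, q.2⟫) ^ 2) := by
      have : Measurable fun q : (ℝ × K) × K => ⟪q.1.2, q.2⟫ :=
        measurable_inner_of (by fun_prop) (by fun_prop)
      fun_prop
    have e1 : ∀ ω, ENNReal.ofReal (∑ j ∈ Finset.range (n + 1), δ * ‖θ j ω‖ ^ 2) =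
        ENNReal.ofReal (∑ j ∈ Finset.range n, δ * ‖θ j ω‖ ^ 2) +
          ENNReal.ofReal (δ * ‖θ n ω‖ ^ 2) := fun ω => by
      rw [Finset.sum_range_succ, ENNReal.ofReal_add (by positivity) (by positivity)]
    simp_rw [e1]
    have hθm : Measurable (θ n) := (hθ n hnN).mono (h.le n) le_rfl
    rw [lintegral_add_right _ (by fun_prop), ← ih hnN.le, ← lintegral_add_right _ (by fun_prop)]
    simp_rw [Finset.sum_range_succ]
    rw [lintegral_of_indep (Z := ℝ × K) (h.le n) hgm (h.indep n hnN) (hS.prodMk (hθ n hnN)) hF,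
      h.law n hnN]
    refine lintegral_congr fun ω => ?_
    rw [lintegral_gaussianIncr_sq hδ, ENNReal.ofReal_add (by positivity) (by positivity)]

/-- Comparison of the shifted increments with the unshifted ones. The shift is stopped before its
energy exceeds `κ`; the density is then bounded below by `exp (-(l + κ / 2))` outside of an event
which Chebyshev's inequality controls. -/
theorem IsNoise.lintegral_shift_le {𝒴 : Type*} [MeasurableSpace 𝒴] (hδ : 0 ≤ δ)
    (h : IsNoise 𝓗 g δ N P) (hθ : ∀ j < N, Measurable[𝓗 j] (θ j))
    {Y : Ω → 𝒴} (hY : Measurable[𝓗 0] Y)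
    {F : 𝒴 × (ℕ → K) → ℝ≥0∞} (hF : Measurable F) (hF1 : ∀ q, F q ≤ 1) {l κ : ℝ} (hl : 0 < l)
    (hκ : 0 ≤ κ) :
    ∫⁻ ω, F (Y ω, trunc N fun j => g j ω + δ • θ j ω) ∂P ≤
      ENNReal.ofReal (Real.exp (l + κ / 2)) * ∫⁻ ω, F (Y ω, trunc N fun j => g j ω) ∂P +
      P {ω | κ < ∑ j ∈ Finset.range N, δ * ‖θ j ω‖ ^ 2} + ENNReal.ofReal (κ / l ^ 2) := by
  classical
  set En : ℕ → Ω → ℝ := fun n ω => ∑ j ∈ Finset.range n, δ * ‖θ j ω‖ ^ 2 with hEn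
  have hEmono : ∀ ω, Monotone fun n => En n ω := fun ω => by
    refine monotone_nat_of_le_succ fun n => ?_
    simp only [hEn, Finset.sum_range_succ]
    have : 0 ≤ δ * ‖θ n ω‖ ^ 2 := by positivity
    linarith
  -- The shift, set to zero from the first step at which its energy exceeds `κ`. It remains adapted,
  -- because the energy after step `j` only involves `θ 0, …, θ j`.
  set θ' : ℕ → Ω → K := fun j ω => if En (j + 1) ω ≤ κ then θ j ω else 0 with hθ'
  have hEm : ∀ n ≤ N, Measurable (En n) := fun n hn => by
    refine Finset.measurable_fun_sum _ fun j hj => ?_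
    have : Measurable (θ j) :=
      (hθ j ((Finset.mem_range.1 hj).trans_le hn)).mono (h.le j) le_rfl
    fun_prop
  have hθ'm : ∀ j < N, Measurable[𝓗 j] (θ' j) := by
    intro j hj
    have hE : Measurable[𝓗 j] (En (j + 1)) := by
      refine Finset.measurable_fun_sum _ fun i hi => ?_
      have hi := Finset.mem_range.1 hi
      have : Measurable[𝓗 j] (θ i) :=
        (hθ i (by omega)).mono (h.mono (by omega)) le_rfl
      exact measurable_mul_norm_sq _ this
    exact Measurable.ite (measurableSet_le hE measurable_const) (hθ j hj) measurable_const
  have hle : ∀ n ω, ∑ j ∈ Finset.range n, δ * ‖θ' j ω‖ ^ 2 ≤ κ := by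
    intro n ω
    induction n with
    | zero => simpa using hκ
    | succ n ih =>
      by_cases hc : En (n + 1) ω ≤ κ
      · refine le_trans (Finset.sum_le_sum fun j _ => ?_) hc
        simp only [hθ']
        split_ifs
        · exact le_rfl
        · simpa using by positivity
      · rw [Finset.sum_range_succ]
        simpa [hθ', hc] using ih
  have heq : ∀ ω, En N ω ≤ κ → ∀ j < N, θ' j ω = θ j ω := by
    intro ω hω j hj
    have : En (j + 1) ω ≤ κ := (hEmono ω hj).trans hω
    simp [hθ', this]
  set S : Ω → ℝ := fun ω => ∑ j ∈ Finset.range N, ⟪θ' j ω, g j ω⟫ with hS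
  have hSm : Measurable S := by
    refine Finset.measurable_fun_sum _ fun j hj => ?_
    have hj := Finset.mem_range.1 hj
    exact measurable_inner_of ((hθ'm j hj).mono (h.le j) le_rfl)
      ((h.meas j hj).mono (h.le _) le_rfl)
  have hlog : ∀ ω, S ω ≤ l → logDensity g θ' δ N ω ≤ l + κ / 2 := by
    intro ω hω
    have := hle N ω
    have e : logDensity g θ' δ N ω = S ω + (∑ j ∈ Finset.range N, δ * ‖θ' j ω‖ ^ 2) / 2 := by
      simp only [logDensity, hS, Finset.sum_add_distrib, Finset.sum_div]
      congr 1
      exact Finset.sum_congr rfl fun j _ => by ring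
    linarith
  have hpt : ∀ ω, F (Y ω, trunc N fun j => g j ω + δ • θ j ω) ≤
      ENNReal.ofReal (Real.exp (l + κ / 2)) *
        (ENNReal.ofReal (Real.exp (-logDensity g θ' δ N ω)) *
          F (Y ω, trunc N fun j => g j ω + δ • θ' j ω)) +
      {ω | κ < En N ω}.indicator 1 ω + {ω | l ^ 2 ≤ S ω ^ 2}.indicator 1 ω := by
    intro ω
    by_cases h1 : κ < En N ω
    · rw [indicator_of_mem (show ω ∈ {ω | κ < En N ω} from h1)]
      exact (hF1 _).trans (le_add_right le_add_self)
    by_cases h2 : l ^ 2 ≤ S ω ^ 2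
    · rw [indicator_of_mem (show ω ∈ {ω | l ^ 2 ≤ S ω ^ 2} from h2)]
      exact (hF1 _).trans le_add_self
    have h3 : logDensity g θ' δ N ω ≤ l + κ / 2 :=
      hlog ω (le_of_lt (lt_of_pow_lt_pow_left₀ 2 hl.le (not_le.1 h2)))
    have h4 : (trunc N fun j => g j ω + δ • θ' j ω) = trunc N fun j => g j ω + δ • θ j ω := by
      ext j
      simp only [trunc]
      split_ifs with hj
      · rw [heq ω (not_lt.1 h1) j hj]
      · rfl
    rw [h4, ← mul_assoc, ← ENNReal.ofReal_mul (Real.exp_pos _).le, ← Real.exp_add]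
    refine le_trans ?_ (le_add_right (le_add_right le_rfl))
    refine le_mul_of_one_le_left' ?_
    rw [ENNReal.one_le_ofReal]
    exact Real.one_le_exp (by linarith)
  have hUm : Measurable fun ω => F (Y ω, trunc N fun j => g j ω + δ • θ' j ω) := by
    refine hF.comp ((hY.mono (h.le 0) le_rfl).prodMk (measurable_trunc fun j hj => ?_))
    exact ((h.meas j hj).mono (h.le _) le_rfl).add
      (((hθ'm j hj).mono (h.le j) le_rfl).const_smul δ)
  have hDm : Measurable fun ω => ENNReal.ofReal (Real.exp (-logDensity g θ' δ N ω)) := by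
    have := (h.measurable_logDensity hθ'm le_rfl).mono (h.le N) le_rfl
    fun_prop
  refine (lintegral_mono hpt).trans ?_
  have hDU : Measurable fun ω => ENNReal.ofReal (Real.exp (-logDensity g θ' δ N ω)) *
      F (Y ω, trunc N fun j => g j ω + δ • θ' j ω) := hDm.mul hUm
  have hA : MeasurableSet {ω | κ < En N ω} := measurableSet_lt measurable_const (hEm N le_rfl)
  have hB : MeasurableSet {ω | l ^ 2 ≤ S ω ^ 2} :=
    measurableSet_le measurable_const (hSm.pow_const 2)
  rw [lintegral_add_right _ (measurable_one.indicator hB),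
    lintegral_add_right _ (measurable_one.indicator hA), lintegral_indicator_one hA,
    lintegral_indicator_one hB, lintegral_const_mul _ hDU,
    h.lintegral_girsanov hδ hθ'm hY le_rfl hF]
  refine add_le_add le_rfl ?_
  have hcheb : ENNReal.ofReal (l ^ 2) * P {ω | l ^ 2 ≤ S ω ^ 2} ≤ ENNReal.ofReal κ := by
    have h1 : {ω | l ^ 2 ≤ S ω ^ 2} = {ω | ENNReal.ofReal (l ^ 2) ≤ ENNReal.ofReal (S ω ^ 2)} := by
      ext ω
      simp only [mem_ofPred_eq]
      rw [ENNReal.ofReal_le_ofReal_iff (by positivity)]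
    rw [h1]
    refine (mul_meas_ge_le_lintegral (by fun_prop) _).trans ?_
    rw [h.lintegral_sq_sum hδ hθ'm le_rfl]
    refine (lintegral_mono fun ω => ENNReal.ofReal_le_ofReal (hle N ω)).trans ?_
    simp
  rw [ENNReal.ofReal_div_of_pos (by positivity), ENNReal.le_div_iff_mul_le
    (Or.inl (by simpa using hl.ne')) (Or.inl ENNReal.ofReal_ne_top), mul_comm]
  exact hcheb

end Discrete


/-! ### Causal functionals and their primitives -/

/-- A measurable functional `f(r, y, v)` of time, of a parameter `y` and of a path `v`, which at
time `r` only depends on the path up to time `r`, and which is bounded in `r` for fixed `y`, `v`. -/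
structure CausalFunctional (T : ℝ≥0) (𝒴 K : Type*) [MeasurableSpace 𝒴]
    [NormedAddCommGroup K] [MeasurableSpace K] where
  /-- The underlying function. -/
  toFun : ℝ → 𝒴 → PathSpace T K → K
  measurable' : Measurable fun q : ℝ × 𝒴 × PathSpace T K => toFun q.1 q.2.1 q.2.2
  causal' : ∀ r y v v', (∀ t : Time T, (t : ℝ) ≤ r → v t = v' t) → toFun r y v = toFun r y v'
  bounded' : ∀ y v, ∃ M, ∀ r, ‖toFun r y v‖ ≤ M

section Hoelder

lemma lintegral_sq_le_measure_mul {α : Type*} {mα : MeasurableSpace α} (μ : Measure α)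
    {g : α → ℝ≥0∞} (hg : AEMeasurable g μ) :
    (∫⁻ x, g x ∂μ) ^ 2 ≤ μ univ * ∫⁻ x, g x ^ 2 ∂μ := by
  have h := ENNReal.lintegral_mul_le_Lp_mul_Lq μ Real.HolderConjugate.two_two
    (f := fun _ => 1) (g := g) aemeasurable_const hg
  simp only [Pi.mul_apply, one_mul, ENNReal.one_rpow, lintegral_const] at h
  calc (∫⁻ x, g x ∂μ) ^ 2 ≤
      ((μ univ) ^ (1 / 2 : ℝ) * (∫⁻ x, g x ^ (2 : ℝ) ∂μ) ^ (1 / 2 : ℝ)) ^ 2 := by gcongr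
    _ = _ := by
      rw [mul_pow, ← ENNReal.rpow_natCast, ← ENNReal.rpow_mul, ← ENNReal.rpow_natCast,
        ← ENNReal.rpow_mul]
      norm_num

lemma enorm_integral_sq_le {K : Type*} [NormedAddCommGroup K] [NormedSpace ℝ K] {a b : ℝ}
    (hab : a ≤ b) {φ : ℝ → K} (hφ : AEStronglyMeasurable φ volume) :
    ‖∫ r in a..b, φ r‖ₑ ^ 2 ≤ ENNReal.ofReal (b - a) * ∫⁻ r in Ioc a b, ‖φ r‖ₑ ^ 2 := by
  rw [intervalIntegral.integral_of_le hab]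
  calc ‖∫ r in Ioc a b, φ r‖ₑ ^ 2 ≤ (∫⁻ r in Ioc a b, ‖φ r‖ₑ) ^ 2 := by
        gcongr; exact enorm_integral_le_lintegral_enorm _
    _ ≤ _ := lintegral_sq_le_measure_mul _ hφ.restrict.enorm
    _ = _ := by simp

end Hoelder

namespace CausalFunctional

variable {T : ℝ≥0} {𝒴 K : Type*} [MeasurableSpace 𝒴]
  [NormedAddCommGroup K] [InnerProductSpace ℝ K] [FiniteDimensional ℝ K]
  [MeasurableSpace K] [BorelSpace K]

instance : CoeFun (CausalFunctional T 𝒴 K) (fun _ => ℝ → 𝒴 → PathSpace T K → K) := ⟨toFun⟩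

variable (f : CausalFunctional T 𝒴 K)

lemma measurable_uncurry : Measurable fun q : ℝ × 𝒴 × PathSpace T K => f q.1 q.2.1 q.2.2 :=
  f.measurable'

lemma measurable_time (y : 𝒴) (v : PathSpace T K) : Measurable fun r => f r y v :=
  f.measurable'.comp (measurable_prodMk_right (y := (y, v)))

lemma causal {r : ℝ} {y : 𝒴} {v v' : PathSpace T K}
    (h : ∀ t : Time T, (t : ℝ) ≤ r → v t = v' t) : f r y v = f r y v' := f.causal' r y v v' h

lemma intervalIntegrable (y : 𝒴) (v : PathSpace T K) (a b : ℝ) :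
    IntervalIntegrable (fun r => f r y v) volume a b := by
  obtain ⟨M, hM⟩ := f.bounded' y v
  refine (intervalIntegrable_const (c := M)).mono_fun'
    (f.measurable_time y v).aestronglyMeasurable (ae_of_all _ hM)

/-- The path `t ↦ ∫₀ᵗ f(r, y, v) dr`. -/
def primitive (y : 𝒴) (v : PathSpace T K) : PathSpace T K where
  toFun t := ∫ r in (0 : ℝ)..t, f r y v
  continuous_toFun := (intervalIntegral.continuous_primitive (f.intervalIntegrable y v) 0).comp
    continuous_subtype_val

lemma primitive_apply (y : 𝒴) (v : PathSpace T K) (t : Time T) :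
    f.primitive y v t = ∫ r in (0 : ℝ)..t, f r y v := rfl

lemma primitive_zeroTime (y : 𝒴) (v : PathSpace T K) : f.primitive y v (zeroTime T) = 0 := by
  simp [primitive_apply, zeroTime]

lemma measurable_primitive : Measurable fun q : 𝒴 × PathSpace T K => f.primitive q.1 q.2 := by
  refine measurable_path_iff.2 fun t => ?_
  simp only [primitive_apply, intervalIntegral.integral_of_le t.2.1]
  have h : StronglyMeasurable fun q : (𝒴 × PathSpace T K) × ℝ => f q.2 q.1.1 q.1.2 :=
    (f.measurable_uncurry.comp (measurable_snd.prodMk measurable_fst)).stronglyMeasurable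
  exact (h.integral_prod_right (ν := volume.restrict (Ioc (0 : ℝ) t))).measurable

lemma primitive_congr {y y' : 𝒴} {v v' : PathSpace T K} {t : Time T}
    (h : ∀ r : ℝ, 0 < r → r ≤ t → f r y v = f r y' v') :
    f.primitive y v t = f.primitive y' v' t := by
  simp only [primitive_apply]
  refine intervalIntegral.integral_congr_ae (ae_of_all _ fun r hr => ?_)
  rw [uIoc_of_le t.2.1] at hr
  exact h r hr.1 hr.2

lemma primitive_stopAt (y : 𝒴) (v : PathSpace T K) (t : Time T) :
    f.primitive y (stopAt t v) t = f.primitive y v t :=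
  f.primitive_congr fun r _ hr => f.causal fun s hs => by
    have hst : s ≤ t := Subtype.coe_le_coe.1 (hs.trans hr)
    simp [hst]

/-- Primitives along adapted processes are adapted. -/
lemma measurable_primitive_apply {Ω : Type*} {m : MeasurableSpace Ω} {Y : Ω → 𝒴}
    {V : Ω → PathSpace T K} {t : Time T} (hY : Measurable[m] Y)
    (hV : ∀ r ≤ t, Measurable[m] fun ω => V ω r) :
    Measurable[m] fun ω => f.primitive (Y ω) (V ω) t := by
  have h := (measurable_eval t).comp
    (f.measurable_primitive.comp (hY.prodMk (measurable_stopAt_iff.2 hV)))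
  have e : (fun ω => f.primitive (Y ω) (V ω) t) =
      fun ω => f.primitive (Y ω) (stopAt t (V ω)) t := by
    ext ω; rw [f.primitive_stopAt]
  rw [e]
  exact h

/-- The energy `∫₀ᵀ |f(r, y, v)|² dr`. -/
def energy (y : 𝒴) (v : PathSpace T K) : ℝ≥0∞ := ∫⁻ r in Ioc (0 : ℝ) T, ‖f r y v‖ₑ ^ 2

lemma measurable_energy : Measurable fun q : 𝒴 × PathSpace T K => f.energy q.1 q.2 := by
  have h : Measurable fun q : (𝒴 × PathSpace T K) × ℝ => ‖f q.2 q.1.1 q.1.2‖ₑ ^ 2 :=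
    (f.measurable_uncurry.comp (measurable_snd.prodMk measurable_fst)).enorm.pow_const 2
  exact h.lintegral_prod_right'

lemma enorm_primitive_sub_sq_le (y : 𝒴) (v : PathSpace T K) {a b : Time T} (hab : a ≤ b) :
    ‖f.primitive y v b - f.primitive y v a‖ₑ ^ 2 ≤
      ENNReal.ofReal (b - a) * ∫⁻ r in Ioc (a : ℝ) b, ‖f r y v‖ₑ ^ 2 := by
  rw [primitive_apply, primitive_apply, intervalIntegral.integral_interval_sub_left
    (f.intervalIntegrable y v _ _) (f.intervalIntegrable y v _ _)]
  exact enorm_integral_sq_le hab (f.measurable_time y v).aestronglyMeasurable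

end CausalFunctional


/-! ### Comparison of a Brownian motion with drift and a Brownian motion -/

/-- An inequality between integrals of continuous functions extends to measurable sets. -/
lemma measure_le_of_forall_lintegral_le {Z : Type*} [TopologicalSpace Z]
    [TopologicalSpace.PseudoMetrizableSpace Z] [MeasurableSpace Z] [BorelSpace Z]
    {μ ν : Measure Z} [IsFiniteMeasure μ] [IsFiniteMeasure ν] {c e : ℝ≥0∞} (hc : c ≠ ∞)
    (h : ∀ G : BoundedContinuousFunction Z ℝ≥0, (∀ z, G z ≤ 1) →
      ∫⁻ z, G z ∂μ ≤ c * ∫⁻ z, G z ∂ν + e) {A : Set Z} (hA : MeasurableSet A) :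
    μ A ≤ c * ν A + e := by
  rw [hA.measure_eq_iSup_isClosed_of_ne_top (measure_ne_top μ A)]
  refine iSup_le fun C => iSup_le fun hCA => iSup_le fun hC => ?_
  have h1 : μ C ≤ c * ν C + e := by
    refine le_of_tendsto_of_tendsto' (HasOuterApproxClosed.tendsto_lintegral_apprSeq hC μ)
      ((ENNReal.Tendsto.const_mul (HasOuterApproxClosed.tendsto_lintegral_apprSeq hC ν)
        (Or.inr hc)).add_const e) fun n => h _ (HasOuterApproxClosed.apprSeq_apply_le_one hC n)
  exact h1.trans (by gcongr)

section Grid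

variable {T : ℝ≥0}

/-- The `j`-th point of the grid which divides `[0, T]` into `N` intervals. -/
def grid (T : ℝ≥0) (N j : ℕ) : Time T := projIcc 0 (T : ℝ) T.2 (j * (T / N))

lemma coe_grid {N j : ℕ} (hj : j ≤ N) : (grid T N j : ℝ) = j * (T / N) := by
  have h : (j * (T / N) : ℝ) ∈ Icc (0 : ℝ) T := by
    refine ⟨by positivity, ?_⟩
    rcases Nat.eq_zero_or_pos N with h0 | h0
    · simp [h0]
    · have : (j : ℝ) ≤ N := by exact_mod_cast hj
      calc (j * (T / N) : ℝ) ≤ N * (T / N) := by gcongr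
        _ = T := by field_simp
  exact congrArg Subtype.val (projIcc_of_mem T.2 h)

lemma grid_mono (N : ℕ) : Monotone (grid T N) := fun i j hij =>
  monotone_projIcc T.2 (by gcongr)

lemma zeroTime_le (t : Time T) : zeroTime T ≤ t := t.2.1

lemma grid_zero (N : ℕ) : grid T N 0 = zeroTime T := by
  ext; rw [coe_grid (Nat.zero_le _)]; simp [zeroTime]

/-- The number of the last grid point before time `t`. -/
def gridIndex (N : ℕ) (t : Time T) : ℕ := ⌊(t : ℝ) / (T / N)⌋₊

lemma gridIndex_le {N : ℕ} (hN : 0 < N) (t : Time T) : gridIndex N t ≤ N := by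
  refine Nat.floor_le_of_le ?_
  refine div_le_of_le_mul₀ (by positivity) (by positivity) ?_
  have := t.2.2
  field_simp
  exact this

lemma tendsto_grid_gridIndex_sub (hT : 0 < T) (i : ℕ) (t : Time T) :
    Tendsto (fun k : ℕ => grid T (k + 1) (gridIndex (k + 1) t - i)) atTop (𝓝 t) := by
  rw [tendsto_subtype_rng]
  have h0 : Tendsto (fun k : ℕ => ((i : ℝ) + 1) * (T / ((k : ℝ) + 1))) atTop (𝓝 0) := by
    have := (tendsto_one_div_add_atTop_nhds_zero_nat (𝕜 := ℝ)).const_mul (((i : ℝ) + 1) * T)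
    simp only [mul_zero] at this
    refine this.congr fun k => ?_
    ring
  have hlow : Tendsto (fun k : ℕ => (t : ℝ) - ((i : ℝ) + 1) * (T / ((k : ℝ) + 1))) atTop
      (𝓝 (t : ℝ)) := by simpa using h0.const_sub (t : ℝ)
  refine tendsto_of_tendsto_of_tendsto_of_le_of_le hlow tendsto_const_nhds (fun k => ?_)
    fun k => ?_
  all_goals
    have hT' : (0 : ℝ) < T := by exact_mod_cast hT
    have hδ : 0 < (T : ℝ) / ((k : ℝ) + 1) := by positivity
    have hle : gridIndex (k + 1) t ≤ k + 1 := gridIndex_le (Nat.succ_pos k) t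
    have hc : (grid T (k + 1) (gridIndex (k + 1) t - i) : ℝ) =
        ((gridIndex (k + 1) t - i : ℕ) : ℝ) * (T / ((k : ℝ) + 1)) := by
      rw [coe_grid (by omega)]; push_cast; rfl
  · have h1 : (t : ℝ) / (T / ((k : ℝ) + 1)) < gridIndex (k + 1) t + 1 := by
      have := Nat.lt_floor_add_one ((t : ℝ) / (T / ((k : ℝ) + 1)))
      simpa [gridIndex] using this
    have h2 : ((gridIndex (k + 1) t : ℕ) : ℝ) ≤ ((gridIndex (k + 1) t - i : ℕ) : ℝ) + i := by
      exact_mod_cast (by omega : gridIndex (k + 1) t ≤ gridIndex (k + 1) t - i + i)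
    rw [div_lt_iff₀ hδ] at h1
    simp only [hc]
    nlinarith
  · have h1 : (gridIndex (k + 1) t : ℝ) ≤ (t : ℝ) / (T / ((k : ℝ) + 1)) := by
      have := Nat.floor_le (a := (t : ℝ) / (T / ((k : ℝ) + 1)))
        (div_nonneg t.2.1 hδ.le)
      simpa [gridIndex] using this
    have h2 : ((gridIndex (k + 1) t - i : ℕ) : ℝ) ≤ (gridIndex (k + 1) t : ℕ) := by
      exact_mod_cast Nat.sub_le _ _
    rw [le_div_iff₀ hδ] at h1
    simp only [hc]
    nlinarith

end Grid

section Comparison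

open scoped RealInnerProductSpace

variable {T : ℝ≥0} {K : Type*} [NormedAddCommGroup K] [InnerProductSpace ℝ K]
  [FiniteDimensional ℝ K] [MeasurableSpace K] [BorelSpace K]
variable {Ω : Type*} {mΩ : MeasurableSpace Ω} {P : Measure Ω} [IsProbabilityMeasure P]

/-- `W` is a standard `K`-valued Brownian motion with respect to the filtration `H`. -/
structure IsBM (H : Time T → MeasurableSpace Ω) (W : Ω → PathSpace T K) (P : Measure Ω) :
    Prop where
  mono : Monotone H
  le : ∀ t, H t ≤ mΩ
  meas : ∀ t, Measurable[H t] fun ω => W ω t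
  start : ∀ᵐ ω ∂P, W ω (zeroTime T) = 0
  indep : ∀ s t, s ≤ t →
    Indep (MeasurableSpace.comap (fun ω => W ω t - W ω s) inferInstance) (H s) P
  law : ∀ s t : Time T, s ≤ t → P.map (fun ω => W ω t - W ω s) = gaussianIncr K (t - s)

variable {H : Time T → MeasurableSpace Ω} {W V U : Ω → PathSpace T K}
  {𝒴 : Type*} [MeasurableSpace 𝒴] {Y : Ω → 𝒴}

lemma IsBM.measurable (hW : IsBM H W P) : Measurable W :=
  measurable_path_iff.2 fun t => (hW.meas t).mono (hW.le t) le_rfl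

lemma IsBM.isNoise_grid (hW : IsBM H W P) (N : ℕ) :
    IsNoise (fun j => H (grid T N j)) (fun j ω => W ω (grid T N (j + 1)) - W ω (grid T N j))
      (T / N) N P where
  mono := fun i j hij => hW.mono (grid_mono N hij)
  le := fun j => hW.le _
  meas := fun j _ => (hW.meas _).sub
    ((hW.meas _).mono (hW.mono (grid_mono N (Nat.le_succ j))) le_rfl)
  indep := fun j _ => hW.indep _ _ (grid_mono N (Nat.le_succ j))
  law := fun j hj => by
    rw [hW.law _ _ (grid_mono N (Nat.le_succ j)), coe_grid hj, coe_grid hj.le]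
    congr 1
    push_cast
    ring

/-- The average of the drift over the grid interval before the `j`-th grid point; it serves as the
drift over the interval after this point, so as to be known at its start. It vanishes for `j = 0`,
where the truncated subtraction gives `j - 1 = 0`. -/
def gridDrift (I : PathSpace T K) (N j : ℕ) : K :=
  ((T : ℝ) / N)⁻¹ • (I (grid T N j) - I (grid T N (j - 1)))

lemma sum_gridDrift (hT : 0 < T) {N : ℕ} (hN : 0 < N) (I : PathSpace T K)
    (hI : I (zeroTime T) = 0) (m : ℕ) :
    ∑ j ∈ Finset.range m, ((T : ℝ) / N) • gridDrift I N j = I (grid T N (m - 1)) := by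
  have hδ : ((T : ℝ) / N) ≠ 0 := by positivity
  simp only [gridDrift, smul_inv_smul₀ hδ]
  induction m with
  | zero => simp [grid_zero, hI]
  | succ m ih =>
    rw [Finset.sum_range_succ, ih]
    simp

lemma sum_energy_gridDrift_le (hT : 0 < T) {N : ℕ} (hN : 0 < N) (f : CausalFunctional T 𝒴 K)
    (y : 𝒴) (v : PathSpace T K) :
    ENNReal.ofReal (∑ j ∈ Finset.range N, (T : ℝ) / N * ‖gridDrift (f.primitive y v) N j‖ ^ 2) ≤
      f.energy y v := by
  have hδ : 0 < ((T : ℝ) / N) := by positivity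
  have hstep : ∀ j < N, ENNReal.ofReal ((T : ℝ) / N * ‖gridDrift (f.primitive y v) N j‖ ^ 2) ≤
      ∫⁻ r in Ioc (grid T N (j - 1) : ℝ) (grid T N j), ‖f r y v‖ₑ ^ 2 := by
    intro j hj
    rcases Nat.eq_zero_or_pos j with h0 | h0
    · simp [h0, gridDrift]
    have h := f.enorm_primitive_sub_sq_le y v (grid_mono (T := T) N (Nat.sub_le j 1))
    have hd : (grid T N j : ℝ) - grid T N (j - 1) = T / N := by
      rw [coe_grid hj.le, coe_grid (by omega), Nat.cast_sub h0]
      push_cast; ring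
    rw [hd] at h
    have e : (T : ℝ) / N * ‖gridDrift (f.primitive y v) N j‖ ^ 2 =
        ((T : ℝ) / N)⁻¹ * ‖f.primitive y v (grid T N j) -
          f.primitive y v (grid T N (j - 1))‖ ^ 2 := by
      rw [gridDrift, norm_smul, mul_pow, norm_inv, Real.norm_of_nonneg hδ.le]
      field_simp
    rw [e, ENNReal.ofReal_mul (by positivity), ENNReal.ofReal_inv_of_pos hδ,
      ENNReal.ofReal_pow (norm_nonneg _), ofReal_norm]
    rw [ENNReal.inv_mul_le_iff (by simpa using hδ) ENNReal.ofReal_ne_top]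
    exact h
  have hsum : ∀ m ≤ N, ∑ j ∈ Finset.range m,
      ∫⁻ r in Ioc (grid T N (j - 1) : ℝ) (grid T N j), ‖f r y v‖ₑ ^ 2 ≤
      ∫⁻ r in Ioc (0 : ℝ) (grid T N (m - 1)), ‖f r y v‖ₑ ^ 2 := by
    intro m hm
    induction m with
    | zero => simp
    | succ m ih =>
      rw [Finset.sum_range_succ]
      refine (add_le_add_left (ih (by omega)) _).trans ?_
      rw [← lintegral_union measurableSet_Ioc (Ioc_disjoint_Ioc_of_le le_rfl),
        Ioc_union_Ioc_eq_Ioc (grid T N (m - 1)).2.1 (grid_mono N (Nat.sub_le m 1))]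
      simp
  rw [ENNReal.ofReal_sum_of_nonneg fun j _ => by positivity]
  refine (Finset.sum_le_sum fun j hj => hstep j (Finset.mem_range.1 hj)).trans
    ((hsum N le_rfl).trans ?_)
  exact lintegral_mono_set (Ioc_subset_Ioc_right (grid T N (N - 1)).2.2)

/-- If `U = W + ∫ f(r, Y, V) dr` for an adapted process `V`, then the law of `(Y, U)` is dominated,
up to an error controlled by the energy of the drift, by a multiple of the law of `(Y, W)`. It is
a quantitative form of Girsanov's theorem, obtained from the discrete one along finer and finer
grids. -/
theorem IsBM.measure_shift_le [TopologicalSpace 𝒴] [PolishSpace 𝒴] [BorelSpace 𝒴] (hT : 0 < T)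
    (hW : IsBM H W P) (f : CausalFunctional T 𝒴 K) (hY : Measurable[H (zeroTime T)] Y)
    (hV : ∀ t, Measurable[H t] fun ω => V ω t) (hUm : Measurable U)
    (hU : ∀ᵐ ω ∂P, U ω = W ω + f.primitive (Y ω) (V ω))
    {A : Set (𝒴 × PathSpace T K)} (hA : MeasurableSet A) {l κ : ℝ} (hl : 0 < l) (hκ : 0 ≤ κ) :
    P {ω | (Y ω, U ω) ∈ A} ≤
      ENNReal.ofReal (Real.exp (l + κ / 2)) * P {ω | (Y ω, W ω) ∈ A} +
      (P {ω | ENNReal.ofReal κ < f.energy (Y ω) (V ω)} + ENNReal.ofReal (κ / l ^ 2)) := by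
  have hYm : Measurable Y := hY.mono (hW.le _) le_rfl
  have hWm := hW.measurable
  -- A path is encoded by its values at a dense sequence of times. It then suffices to test the laws
  -- against bounded continuous functions of sequences.
  set e : 𝒴 × PathSpace T K → 𝒴 × (ℕ → K) := fun q => (q.1, evalDense T K q.2) with he
  have hec : Continuous e := continuous_fst.prodMk (continuous_evalDense.comp continuous_snd)
  have hei : Function.Injective e := by
    rintro ⟨y, v⟩ ⟨y', v'⟩ h
    simp only [he, Prod.mk.injEq] at h
    exact Prod.ext h.1 (injective_evalDense h.2)
  have hem : MeasurableEmbedding e := hec.measurableEmbedding hei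
  set μ := P.map fun ω => e (Y ω, U ω) with hμ
  set ν := P.map fun ω => e (Y ω, W ω) with hν
  have hmU : Measurable fun ω => e (Y ω, U ω) := hem.measurable.comp (hYm.prodMk hUm)
  have hmW : Measurable fun ω => e (Y ω, W ω) := hem.measurable.comp (hYm.prodMk hWm)
  have : IsProbabilityMeasure μ := Measure.isProbabilityMeasure_map hmU.aemeasurable
  have : IsProbabilityMeasure ν := Measure.isProbabilityMeasure_map hmW.aemeasurable
  have hpre : ∀ Z : Ω → PathSpace T K,
      {ω | (Y ω, Z ω) ∈ A} = (fun ω => e (Y ω, Z ω)) ⁻¹' (e '' A) := by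
    intro Z
    ext ω
    exact (hei.mem_set_image (s := A) (a := (Y ω, Z ω))).symm
  have hA' : MeasurableSet (e '' A) := hem.measurableSet_image.2 hA
  rw [hpre U, hpre W, ← Measure.map_apply hmU hA', ← Measure.map_apply hmW hA']
  refine measure_le_of_forall_lintegral_le ENNReal.ofReal_ne_top (fun G hG => ?_) hA'
  have hG' : ∀ z, (G z : ℝ≥0∞) ≤ 1 := fun z => by exact_mod_cast hG z
  have hGm : Measurable fun z => (G z : ℝ≥0∞) := by
    have := G.continuous.measurable
    fun_prop
  rw [lintegral_map hGm hmU, lintegral_map hGm hmW]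
  -- The dense times are rounded down to the grid; the drift lags by one more step of the grid,
  -- which is what summing `gridDrift` produces.
  set q := TopologicalSpace.denseSeq (Time T) with hq
  have hlimU : Tendsto (fun k : ℕ => ∫⁻ ω, G (Y ω, fun i =>
      W ω (grid T (k + 1) (gridIndex (k + 1) (q i) - 0)) +
        f.primitive (Y ω) (V ω) (grid T (k + 1) (gridIndex (k + 1) (q i) - 1))) ∂P) atTop
      (𝓝 (∫⁻ ω, G (e (Y ω, U ω)) ∂P)) := by
    refine tendsto_lintegral_of_dominated_convergence' (fun _ => 1) (fun k => ?_)
      (fun k => ae_of_all _ fun ω => hG' _) (by simp) ?_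
    · refine (hGm.comp (hYm.prodMk (measurable_pi_iff.2 fun i => ?_))).aemeasurable
      exact ((measurable_eval _).comp hWm).add
        ((f.measurable_primitive_apply (hY.mono (hW.mono (zeroTime_le _)) le_rfl)
          fun r hr => (hV r).mono (hW.mono hr) le_rfl).mono (hW.le _) le_rfl)
    · filter_upwards [hU] with ω hω
      refine ENNReal.tendsto_coe.2 ((G.continuous.tendsto _).comp ?_)
      refine tendsto_const_nhds.prodMk_nhds (tendsto_pi_nhds.2 fun i => ?_)
      have h1 := ((W ω).continuous.tendsto (q i)).comp (tendsto_grid_gridIndex_sub hT 0 (q i))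
      have h2 := ((f.primitive (Y ω) (V ω)).continuous.tendsto (q i)).comp
        (tendsto_grid_gridIndex_sub hT 1 (q i))
      have h3 := h1.add h2
      simp only [evalDense, hω]
      exact h3
  have hlimW : Tendsto (fun k : ℕ => ∫⁻ ω, G (Y ω, fun i =>
      W ω (grid T (k + 1) (gridIndex (k + 1) (q i) - 0))) ∂P) atTop
      (𝓝 (∫⁻ ω, G (e (Y ω, W ω)) ∂P)) := by
    refine tendsto_lintegral_of_dominated_convergence' (fun _ => 1) (fun k => ?_)
      (fun k => ae_of_all _ fun ω => hG' _) (by simp) ?_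
    · refine (hGm.comp (hYm.prodMk (measurable_pi_iff.2 fun i => ?_))).aemeasurable
      exact (measurable_eval _).comp hWm
    · refine ae_of_all _ fun ω => ENNReal.tendsto_coe.2 ((G.continuous.tendsto _).comp ?_)
      refine tendsto_const_nhds.prodMk_nhds (tendsto_pi_nhds.2 fun i => ?_)
      exact ((W ω).continuous.tendsto (q i)).comp (tendsto_grid_gridIndex_sub hT 0 (q i))
  refine le_of_tendsto_of_tendsto' hlimU ((ENNReal.Tendsto.const_mul hlimW
    (Or.inr ENNReal.ofReal_ne_top)).add_const _) fun k => ?_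
  -- For a fixed grid, this is the comparison of Gaussian increments shifted by `gridDrift`.
  set N := k + 1 with hN
  have hNpos : 0 < N := Nat.succ_pos k
  have hθ : ∀ j < N, Measurable[H (grid T N j)]
      fun ω => gridDrift (f.primitive (Y ω) (V ω)) N j := by
    intro j _
    have hp : ∀ i ≤ j, Measurable[H (grid T N j)]
        fun ω => f.primitive (Y ω) (V ω) (grid T N i) := fun i hi =>
      f.measurable_primitive_apply
        (hY.mono (hW.mono (zeroTime_le _)) le_rfl)
        fun r hr => (hV r).mono (hW.mono (hr.trans (grid_mono N hi))) le_rfl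
    exact ((hp j le_rfl).sub (hp (j - 1) (Nat.sub_le j 1))).const_smul _
  set F : 𝒴 × (ℕ → K) → ℝ≥0∞ := fun p =>
    G (p.1, fun i => ∑ j ∈ Finset.range (gridIndex N (q i)), p.2 j) with hF
  have hFm : Measurable F := by
    refine hGm.comp (measurable_fst.prodMk (measurable_pi_iff.2 fun i => ?_))
    exact Finset.measurable_fun_sum _ fun j _ => (measurable_pi_apply j).comp measurable_snd
  have hYg : Measurable[H (grid T N 0)] Y := by rw [grid_zero]; exact hY
  have key := (hW.isNoise_grid N).lintegral_shift_le (by positivity) hθ hYg hFm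
    (fun p => hG' _) hl hκ
  have hsumW : ∀ ω, W ω (zeroTime T) = 0 → ∀ m, ∑ j ∈ Finset.range m,
      (W ω (grid T N (j + 1)) - W ω (grid T N j)) = W ω (grid T N m) := fun ω hω m => by
    rw [Finset.sum_range_sub (fun j => W ω (grid T N j)), grid_zero, hω, sub_zero]
  have htr : ∀ (u : ℕ → K) i, ∑ j ∈ Finset.range (gridIndex N (q i)), trunc N u j =
      ∑ j ∈ Finset.range (gridIndex N (q i)), u j := fun u i =>
    Finset.sum_congr rfl fun j hj => if_pos
      ((Finset.mem_range.1 hj).trans_le (gridIndex_le hNpos (q i)))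
  have hkU : ∫⁻ ω, G (Y ω, fun i => W ω (grid T N (gridIndex N (q i) - 0)) +
        f.primitive (Y ω) (V ω) (grid T N (gridIndex N (q i) - 1))) ∂P =
      ∫⁻ ω, F (Y ω, trunc N fun j => W ω (grid T N (j + 1)) - W ω (grid T N j) +
        ((T : ℝ) / N) • gridDrift (f.primitive (Y ω) (V ω)) N j) ∂P := by
    refine lintegral_congr_ae ?_
    filter_upwards [hW.start] with ω hω
    simp only [hF, htr, Finset.sum_add_distrib, hsumW ω hω, Nat.sub_zero,
      sum_gridDrift hT hNpos _ (f.primitive_zeroTime (Y ω) (V ω))]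
  have hkW : ∫⁻ ω, G (Y ω, fun i => W ω (grid T N (gridIndex N (q i) - 0))) ∂P =
      ∫⁻ ω, F (Y ω, trunc N fun j => W ω (grid T N (j + 1)) - W ω (grid T N j)) ∂P := by
    refine lintegral_congr_ae ?_
    filter_upwards [hW.start] with ω hω
    simp only [hF, htr, hsumW ω hω, Nat.sub_zero]
  rw [hkU, hkW, ← add_assoc]
  refine key.trans ?_
  gcongr
  rename_i ω
  intro hω
  refine lt_of_lt_of_le ?_ (sum_energy_gridDrift_le hT hNpos f (Y ω) (V ω))
  exact (ENNReal.ofReal_lt_ofReal_iff (hκ.trans_lt hω)).2 hω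

end Comparison


/-! ### Delayed equations -/

namespace CausalFunctional

variable {T : ℝ≥0} {𝒴 K : Type*} [MeasurableSpace 𝒴]
  [NormedAddCommGroup K] [InnerProductSpace ℝ K] [FiniteDimensional ℝ K]
  [MeasurableSpace K] [BorelSpace K]

/-- The functional `f(r - h, y, v)`. -/
def delay (f : CausalFunctional T 𝒴 K) (h : ℝ≥0) : CausalFunctional T 𝒴 K where
  toFun r y v := f (r - h) y v
  measurable' := f.measurable_uncurry.comp
    ((measurable_fst.sub_const (h : ℝ)).prodMk measurable_snd)
  causal' _ _ _ _ H := f.causal fun t ht => H t (ht.trans (sub_le_self _ h.2))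
  bounded' y v := (f.bounded' y v).imp fun _ hM _ => hM _

lemma delay_apply (f : CausalFunctional T 𝒴 K) (h : ℝ≥0) (r : ℝ) (y : 𝒴) (v : PathSpace T K) :
    f.delay h r y v = f (r - h) y v := rfl

instance : Sub (CausalFunctional T 𝒴 K) where
  sub f g :=
  { toFun := fun r y v => f r y v - g r y v
    measurable' := f.measurable_uncurry.sub g.measurable_uncurry
    causal' := fun r y v v' H => by rw [f.causal H, g.causal H]
    bounded' := fun y v => by
      obtain ⟨M, hM⟩ := f.bounded' y v
      obtain ⟨M', hM'⟩ := g.bounded' y v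
      exact ⟨M + M', fun r => (norm_sub_le _ _).trans (add_le_add (hM r) (hM' r))⟩ }

lemma sub_apply (f g : CausalFunctional T 𝒴 K) (r : ℝ) (y : 𝒴) (v : PathSpace T K) :
    (f - g) r y v = f r y v - g r y v := rfl

lemma primitive_sub (f g : CausalFunctional T 𝒴 K) (y : 𝒴) (v : PathSpace T K) :
    (f - g).primitive y v = f.primitive y v - g.primitive y v := by
  ext1 t
  simp only [primitive_apply, sub_apply, ContinuousMap.sub_apply]
  exact intervalIntegral.integral_sub (f.intervalIntegrable _ _ _ _) (g.intervalIntegrable _ _ _ _)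

lemma energy_sub_le (f g k : CausalFunctional T 𝒴 K) (y : 𝒴) (v : PathSpace T K) :
    (f - g).energy y v ≤ 2 * (f - k).energy y v + 2 * (g - k).energy y v := by
  have hm : ∀ p q : CausalFunctional T 𝒴 K, Measurable fun r => ‖(p - q) r y v‖ₑ ^ 2 :=
    fun p q => ((p - q).measurable_time y v).enorm.pow_const 2
  simp only [energy]
  rw [← lintegral_const_mul _ (hm f k), ← lintegral_const_mul _ (hm g k),
    ← lintegral_add_left ((hm f k).const_mul 2)]
  refine lintegral_mono fun r => ?_
  have h1 : (f - g) r y v = (f - k) r y v - (g - k) r y v := by simp [sub_apply]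
  rw [h1]
  calc ‖(f - k) r y v - (g - k) r y v‖ₑ ^ 2
      ≤ (‖(f - k) r y v‖ₑ + ‖(g - k) r y v‖ₑ) ^ 2 := by
        gcongr; exact enorm_sub_le
    _ ≤ _ := by
        rw [← mul_add]
        have := ENNReal.rpow_add_le_mul_rpow_add_rpow ‖(f - k) r y v‖ₑ ‖(g - k) r y v‖ₑ
          (p := 2) one_le_two
        norm_num at this
        exact this

/-- The noise recovered from the parameter and the solution: `v - ∫ f(r, y, v) dr`. -/
def residual (f : CausalFunctional T 𝒴 K) (y : 𝒴) (v : PathSpace T K) : PathSpace T K :=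
  v - f.primitive y v

lemma measurable_residual (f : CausalFunctional T 𝒴 K) :
    Measurable fun q : 𝒴 × PathSpace T K => f.residual q.1 q.2 := by
  refine measurable_path_iff.2 fun t => ?_
  exact ((measurable_eval t).comp measurable_snd).sub
    ((measurable_eval t).comp f.measurable_primitive)

lemma residual_eq_iff (f : CausalFunctional T 𝒴 K) {y : 𝒴} {v w : PathSpace T K} :
    f.residual y v = w ↔ v = w + f.primitive y v := sub_eq_iff_eq_add

/-- The Picard iterates of the equation `v = w + ∫ f(r, y, v) dr`. -/
def picard (f : CausalFunctional T 𝒴 K) (y : 𝒴) (w : PathSpace T K) : ℕ → PathSpace T K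
  | 0 => w
  | j + 1 => w + f.primitive y (picard f y w j)

lemma measurable_picard (f : CausalFunctional T 𝒴 K) (j : ℕ) :
    Measurable fun q : 𝒴 × PathSpace T K => f.picard q.1 q.2 j := by
  induction j with
  | zero => exact measurable_snd
  | succ j ih =>
    refine measurable_path_iff.2 fun t => ?_
    exact ((measurable_eval t).comp measurable_snd).add
      ((measurable_eval t).comp (f.measurable_primitive.comp (measurable_fst.prodMk ih)))

lemma picard_delay_eq (f : CausalFunctional T 𝒴 K) (h : ℝ≥0) (y : 𝒴) (w : PathSpace T K)
    (j : ℕ) (t : Time T) (ht : (t : ℝ) ≤ j * h) :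
    (f.delay h).picard y w j t = (f.delay h).picard y w (j + 1) t := by
  induction j generalizing t with
  | zero =>
    have h0 : (t : ℝ) ≤ 0 := by simpa using ht
    have : t = zeroTime T := le_antisymm (Subtype.coe_le_coe.1 h0) t.2.1
    simp [picard, this, primitive_zeroTime]
  | succ j ih =>
    change w t + (f.delay h).primitive y ((f.delay h).picard y w j) t =
      w t + (f.delay h).primitive y ((f.delay h).picard y w (j + 1)) t
    congr 1
    refine primitive_congr _ fun r _ hr => f.causal fun s hs => ih s ?_
    push_cast at ht
    linarith

/-- The solution of the delayed equation `v = w + ∫ f(r - h, y, v) dr`, which Picard's iteration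
reaches after finitely many steps. -/
def delaySol (f : CausalFunctional T 𝒴 K) (h : ℝ≥0) (y : 𝒴) (w : PathSpace T K) : PathSpace T K :=
  (f.delay h).picard y w ⌈(T : ℝ) / h⌉₊

lemma measurable_delaySol (f : CausalFunctional T 𝒴 K) (h : ℝ≥0) :
    Measurable fun q : 𝒴 × PathSpace T K => f.delaySol h q.1 q.2 :=
  (f.delay h).measurable_picard _

lemma residual_delaySol (f : CausalFunctional T 𝒴 K) {h : ℝ≥0} (hh : 0 < h) (y : 𝒴)
    (w : PathSpace T K) : (f.delay h).residual y (f.delaySol h y w) = w := by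
  rw [residual_eq_iff]
  ext1 t
  refine f.picard_delay_eq h y w _ t (t.2.2.trans ?_)
  have hh' : (0 : ℝ) < h := by exact_mod_cast hh
  rw [← div_le_iff₀ hh']
  exact Nat.le_ceil _

/-- Solutions of delayed equations are unique, and causal in the parameter and in the noise. -/
lemma eq_of_delay_eq (f : CausalFunctional T 𝒴 K) {h : ℝ≥0} (hh : 0 < h) {y y' : 𝒴}
    {v v' w w' : PathSpace T K} {t : Time T} (hw : ∀ s ≤ t, w s = w' s)
    (hf : ∀ r : ℝ, r ≤ t → ∀ u, f r y u = f r y' u)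
    (hv : (f.delay h).residual y v = w) (hv' : (f.delay h).residual y' v' = w') :
    ∀ s ≤ t, v s = v' s := by
  rw [residual_eq_iff] at hv hv'
  have key : ∀ j : ℕ, ∀ s ≤ t, (s : ℝ) ≤ j * h → v s = v' s := by
    intro j
    induction j with
    | zero =>
      intro s hst hs
      have h0 : (s : ℝ) ≤ 0 := by simpa using hs
      have : s = zeroTime T := le_antisymm (Subtype.coe_le_coe.1 h0) s.2.1
      rw [hv, hv', ContinuousMap.add_apply, ContinuousMap.add_apply, hw s hst, this,
        primitive_zeroTime, primitive_zeroTime]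
    | succ j ih =>
      intro s hst hs
      rw [hv, hv', ContinuousMap.add_apply, ContinuousMap.add_apply, hw s hst]
      congr 1
      refine primitive_congr _ fun r _ hr => ?_
      rw [delay_apply, delay_apply, hf (r - h) ((sub_le_self r h.2).trans
        (hr.trans (Subtype.coe_le_coe.2 hst)))]
      push_cast at hs
      have hh0 : (0 : ℝ) ≤ h := h.2
      refine f.causal fun q hq => ih q ?_ (by linarith)
      have : (q : ℝ) ≤ s := by linarith
      exact (Subtype.coe_le_coe.1 this).trans hst
  intro s hs
  have hh' : (0 : ℝ) < h := by exact_mod_cast hh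
  refine key ⌈(T : ℝ) / h⌉₊ s hs (s.2.2.trans ?_)
  rw [← div_le_iff₀ hh']
  exact Nat.le_ceil _

lemma delaySol_residual (f : CausalFunctional T 𝒴 K) {h : ℝ≥0} (hh : 0 < h) (y : 𝒴)
    (v : PathSpace T K) : f.delaySol h y ((f.delay h).residual y v) = v := by
  ext1 t
  exact f.eq_of_delay_eq hh (fun s _ => rfl) (fun r _ u => rfl)
    (f.residual_delaySol hh y _) rfl t le_rfl

/-- The solution of the delayed equation is adapted to every filtration which makes the noise
and the relevant part of the parameter adapted. -/
lemma measurable_delaySol_apply (f : CausalFunctional T 𝒴 K) {h : ℝ≥0} (hh : 0 < h) {Ω : Type*}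
    {m : MeasurableSpace Ω} {Y : Ω → 𝒴} {W : Ω → PathSpace T K} {t : Time T} {τ : 𝒴 → 𝒴}
    (hτ : ∀ r : ℝ, r ≤ t → ∀ y u, f r (τ y) u = f r y u)
    (hY : Measurable[m] fun ω => τ (Y ω)) (hW : ∀ r ≤ t, Measurable[m] fun ω => W ω r) :
    ∀ r ≤ t, Measurable[m] fun ω => f.delaySol h (Y ω) (W ω) r := by
  intro r hr
  have e : (fun ω => f.delaySol h (Y ω) (W ω) r) =
      fun ω => f.delaySol h (τ (Y ω)) (stopAt t (W ω)) r := by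
    ext1 ω
    refine f.eq_of_delay_eq hh (w' := stopAt t (W ω)) (fun s hs => ?_)
      (fun r hr u => (hτ r hr _ _).symm) (f.residual_delaySol hh _ _)
      (f.residual_delaySol hh _ _) r hr
    simp [hs]
  rw [e]
  exact (measurable_eval r).comp ((f.measurable_delaySol h).comp
    (hY.prodMk (measurable_stopAt_iff.2 hW)))

/-- `f` vanishes outside of `[0, T]` and is of linear growth in the current state, with a constant
`C y` which may depend on the parameter. -/
structure IsGrowth (f : CausalFunctional T 𝒴 K) (C : 𝒴 → ℝ) : Prop where
  measurable : Measurable C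
  pos : ∀ y, 0 < C y
  zero : ∀ r y v, r ∉ Icc (0 : ℝ) T → f r y v = 0
  le : ∀ r y v, ‖f r y v‖ ≤ C y * (1 + ‖v (projIcc 0 (T : ℝ) T.2 r)‖)

variable {f : CausalFunctional T 𝒴 K} {C : 𝒴 → ℝ}

/-- Grönwall's bound for delayed equations, uniform in the delay. -/
lemma IsGrowth.norm_le (hf : f.IsGrowth C) {h : ℝ≥0} {y : 𝒴} {v w : PathSpace T K}
    (hv : (f.delay h).residual y v = w) :
    ‖v‖ ≤ (‖w‖ + C y * T) * Real.exp (C y * T) := by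
  rw [residual_eq_iff] at hv
  have hC := hf.pos y
  set φ : ℝ → ℝ := fun r => ‖v (projIcc 0 (T : ℝ) T.2 r)‖ with hφ
  have hφc : Continuous φ := by fun_prop
  set ψ : ℝ → ℝ := fun t => ∫ r in (0 : ℝ)..t, φ r with hψ
  set a := ‖w‖ + C y * T with ha
  have hψ0 : ∀ t, 0 ≤ t → 0 ≤ ψ t := fun t ht =>
    intervalIntegral.integral_nonneg ht fun r _ => norm_nonneg _
  have hψd : ∀ t, HasDerivAt ψ (φ t) t := fun t =>
    intervalIntegral.integral_hasDerivAt_right (hφc.intervalIntegrable _ _)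
      (hφc.stronglyMeasurableAtFilter _ _) hφc.continuousAt
  have hfi : ∀ a b, IntervalIntegrable (fun r => ‖f r y v‖) volume a b := fun a b =>
    (f.intervalIntegrable y v a b).norm
  have hbound : ∀ t : Time T, ‖v t‖ ≤ a + C y * ψ t := by
    intro t
    have h1 : ‖(f.delay h).primitive y v t‖ ≤ ∫ r in (0 : ℝ)..t, ‖f r y v‖ := by
      rw [primitive_apply]
      refine (intervalIntegral.norm_integral_le_integral_norm t.2.1).trans ?_
      simp only [delay_apply]
      rw [intervalIntegral.integral_comp_sub_right (fun r => ‖f r y v‖) (h : ℝ)]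
      rw [← intervalIntegral.integral_add_adjacent_intervals (hfi (0 - h) 0) (hfi 0 (t - h))]
      have hz : ∫ r in (0 - (h : ℝ))..0, ‖f r y v‖ = 0 := by
        refine intervalIntegral.integral_zero_ae ?_
        have : ∀ᵐ r : ℝ, r ≠ 0 := by simp [ae_iff]
        filter_upwards [this] with r hr0 hr
        rw [uIoc_of_le (by simp)] at hr
        rw [hf.zero r y v fun h' => hr0 (le_antisymm hr.2 h'.1), norm_zero]
      rw [hz, zero_add, ← sub_nonneg, intervalIntegral.integral_interval_sub_left (hfi _ _)
        (hfi _ _)]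
      exact intervalIntegral.integral_nonneg (sub_le_self _ h.2) fun r _ => norm_nonneg _
    have h2 : ∫ r in (0 : ℝ)..t, ‖f r y v‖ ≤ ∫ r in (0 : ℝ)..t, C y * (1 + φ r) :=
      intervalIntegral.integral_mono_on t.2.1 (hfi _ _)
        ((by fun_prop : Continuous fun r => C y * (1 + φ r)).intervalIntegrable _ _)
        fun r _ => hf.le r y v
    have h3 : ∫ r in (0 : ℝ)..t, C y * (1 + φ r) = C y * t + C y * ψ t := by
      rw [intervalIntegral.integral_const_mul, intervalIntegral.integral_add
        (by simp) (hφc.intervalIntegrable _ _)]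
      simp [hψ, mul_add]
    have h4 : ‖v t‖ ≤ ‖w t‖ + ‖(f.delay h).primitive y v t‖ := by
      conv_lhs => rw [hv]
      exact norm_add_le _ _
    have h5 : C y * t ≤ C y * T := mul_le_mul_of_nonneg_left t.2.2 hC.le
    have h6 := w.norm_coe_le_norm t
    linarith
  have hgr : ∀ t ∈ Icc (0 : ℝ) T, ‖ψ t‖ ≤ gronwallBound 0 (C y) a (t - 0) := by
    refine norm_le_gronwallBound_of_norm_deriv_right_le (f' := φ)
      (fun t _ => (hψd t).continuousAt.continuousWithinAt)
      (fun t _ => (hψd t).hasDerivWithinAt) (by simp [hψ]) fun t ht => ?_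
    have ht' : t ∈ Icc (0 : ℝ) T := ⟨ht.1, ht.2.le⟩
    have := hbound ⟨t, ht'⟩
    rw [Real.norm_of_nonneg (norm_nonneg _), Real.norm_of_nonneg (hψ0 t ht.1)]
    have e : φ t = ‖v ⟨t, ht'⟩‖ := congrArg (fun s => ‖v s‖) (projIcc_of_mem T.2 ht')
    change φ t ≤ _
    rw [e]
    linarith
  have ha0 : 0 ≤ a := by positivity
  rw [ContinuousMap.norm_le _ (by positivity)]
  intro t
  have h1 := hgr t t.2
  rw [Real.norm_of_nonneg (hψ0 t t.2.1), gronwallBound_of_K_ne_0 hC.ne'] at h1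
  have h2 : Real.exp (C y * (t - 0)) ≤ Real.exp (C y * T) := by
    have := t.2.2
    gcongr
    linarith
  have h3 : C y * ψ t ≤ a * (Real.exp (C y * T) - 1) := by
    calc C y * ψ t ≤ C y * (0 * Real.exp (C y * (t - 0)) +
          a / C y * (Real.exp (C y * (t - 0)) - 1)) := by gcongr
      _ = a * (Real.exp (C y * (t - 0)) - 1) := by field_simp; ring
      _ ≤ _ := by gcongr
  have := hbound t
  linarith

lemma IsGrowth.norm_le' (hf : f.IsGrowth C) (r : ℝ) (y : 𝒴) (v : PathSpace T K) :
    ‖f r y v‖ ≤ C y * (1 + ‖v‖) := by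
  refine (hf.le r y v).trans ?_
  have := (hf.pos y).le
  gcongr
  exact v.norm_coe_le_norm _

/-- A bound for the energy of the drift of the delayed equations, uniform in the delay. -/
lemma IsGrowth.energy_delay_le (hf : f.IsGrowth C) {h : ℝ≥0} {y : 𝒴} {v w : PathSpace T K}
    (hv : (f.delay h).residual y v = w) :
    (f.delay h).energy y v ≤
      ENNReal.ofReal ((C y * (1 + (‖w‖ + C y * T) * Real.exp (C y * T))) ^ 2 * T) := by
  have hC := (hf.pos y).le
  have h1 : ∀ r, ‖f.delay h r y v‖ₑ ^ 2 ≤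
      ENNReal.ofReal ((C y * (1 + (‖w‖ + C y * T) * Real.exp (C y * T))) ^ 2) := by
    intro r
    rw [← ofReal_norm, ← ENNReal.ofReal_pow (norm_nonneg _)]
    refine ENNReal.ofReal_le_ofReal ?_
    gcongr
    refine (hf.norm_le' _ y v).trans ?_
    gcongr
    exact hf.norm_le hv
  refine (lintegral_mono h1).trans ?_
  rw [ENNReal.ofReal_mul (by positivity)]
  simp

/-- As the delay tends to zero, the delayed drift converges in mean square. -/
lemma IsGrowth.tendsto_energy_delay_sub (hf : f.IsGrowth C) (y : 𝒴) (v : PathSpace T K)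
    {h : ℕ → ℝ≥0} (hh : Tendsto h atTop (𝓝 0)) :
    Tendsto (fun k => (f.delay (h k) - f).energy y v) atTop (𝓝 0) := by
  set φ : ℝ → K := fun r => f r y v with hφ
  have hφm : Measurable φ := f.measurable_time y v
  obtain ⟨M, hM⟩ := f.bounded' y v
  have hmem : MemLp φ 2 volume := by
    have h1 : MemLp ((Icc (0 : ℝ) T).indicator fun _ => M) 2 volume :=
      memLp_indicator_const 2 measurableSet_Icc M (Or.inr (by simp))
    refine h1.mono hφm.aestronglyMeasurable (ae_of_all _ fun r => ?_)
    by_cases hr : r ∈ Icc (0 : ℝ) T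
    · rw [indicator_of_mem hr]
      exact (hM r).trans (le_abs_self M)
    · simp [hφ, hf.zero r y v hr]
  set g : ℝ → C(ℝ, ℝ) := fun s => ⟨fun r => r - s, by fun_prop⟩ with hg
  have hgc : Continuous g := by
    have : g = (ContinuousMap.mk (fun p : ℝ × ℝ => p.2 - p.1) (by fun_prop)).curry := by
      ext s r; rfl
    rw [this]
    exact ContinuousMap.continuous _
  have hgm : ∀ s, MeasurePreserving (g s) volume volume := fun s =>
    measurePreserving_sub_right volume s
  -- Translations act continuously on square integrable functions of time.
  have hlim : Tendsto (fun k => Lp.compMeasurePreserving (g (h k)) (hgm (h k)) (hmem.toLp φ)) atTop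
      (𝓝 (Lp.compMeasurePreserving (g 0) (hgm 0) (hmem.toLp φ))) := by
    refine Filter.Tendsto.compMeasurePreservingLp tendsto_const_nhds ?_ _ _ (by simp)
    refine (hgc.tendsto 0).comp ?_
    simpa using NNReal.tendsto_coe.2 hh
  rw [Lp.tendsto_Lp_iff_tendsto_eLpNorm'] at hlim
  have e0 : ∀ s, (Lp.compMeasurePreserving (g s) (hgm s) (hmem.toLp φ) : ℝ → K) =ᵐ[volume]
      φ ∘ g s := fun s =>
    (Lp.coeFn_compMeasurePreserving _ (hgm s)).trans
      ((hgm s).quasiMeasurePreserving.ae_eq_comp hmem.coeFn_toLp)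
  have hle : ∀ k, (f.delay (h k) - f).energy y v ≤
      eLpNorm ((Lp.compMeasurePreserving (g (h k)) (hgm (h k)) (hmem.toLp φ) : ℝ → K) -
        (Lp.compMeasurePreserving (g 0) (hgm 0) (hmem.toLp φ) : ℝ → K)) 2 volume ^ 2 := by
    intro k
    rw [eLpNorm_congr_ae ((e0 _).sub (e0 0)),
      eLpNorm_eq_lintegral_rpow_enorm_toReal (by simp) (by simp),
      ← ENNReal.rpow_natCast, ← ENNReal.rpow_mul]
    norm_num
    refine (setLIntegral_le_lintegral _ _).trans (le_of_eq (lintegral_congr fun r => ?_))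
    simp [sub_apply, delay_apply, hg, hφ]
  refine tendsto_of_tendsto_of_tendsto_of_le_of_le tendsto_const_nhds ?_ (fun _ => bot_le) hle
  have := ENNReal.Tendsto.pow (n := 2) hlim
  simpa using this

/-- As the delay tends to zero, the recovered noise converges uniformly. -/
lemma IsGrowth.tendsto_residual_delay (hf : f.IsGrowth C) (y : 𝒴) (v : PathSpace T K)
    {h : ℕ → ℝ≥0} (hh : Tendsto h atTop (𝓝 0)) :
    Tendsto (fun k => (f.delay (h k)).residual y v) atTop (𝓝 (f.residual y v)) := by
  have h1 := hf.tendsto_energy_delay_sub y v hh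
  have h2 : Tendsto (fun k => √((ENNReal.ofReal T * (f.delay (h k) - f).energy y v).toReal))
      atTop (𝓝 0) := by
    have h3 := ENNReal.Tendsto.const_mul (a := ENNReal.ofReal T) h1 (Or.inr ENNReal.ofReal_ne_top)
    rw [mul_zero] at h3
    have := (Real.continuous_sqrt.tendsto _).comp
      ((ENNReal.tendsto_toReal ENNReal.zero_ne_top).comp h3)
    rw [ENNReal.toReal_zero, Real.sqrt_zero] at this
    exact this
  have hfin : ∀ᶠ k in atTop, (f.delay (h k) - f).energy y v < 1 :=
    h1.eventually_lt_const one_pos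
  rw [tendsto_iff_norm_sub_tendsto_zero]
  refine tendsto_of_tendsto_of_tendsto_of_le_of_le' tendsto_const_nhds h2
    (Eventually.of_forall fun _ => norm_nonneg _) ?_
  filter_upwards [hfin] with k hk
  have e : (f.delay (h k)).residual y v - f.residual y v = - (f.delay (h k) - f).primitive y v := by
    rw [primitive_sub, residual, residual]; abel
  rw [e, norm_neg, ContinuousMap.norm_le _ (Real.sqrt_nonneg _)]
  intro t
  refine Real.le_sqrt_of_sq_le ?_
  have h4 := (f.delay (h k) - f).enorm_primitive_sub_sq_le y v (zeroTime_le t)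
  rw [primitive_zeroTime, sub_zero] at h4
  have h5 : ‖(f.delay (h k) - f).primitive y v t‖ₑ ^ 2 ≤
      ENNReal.ofReal T * (f.delay (h k) - f).energy y v := by
    refine h4.trans ?_
    have : Ioc ((zeroTime T : Time T) : ℝ) t ⊆ Ioc (0 : ℝ) T := Ioc_subset_Ioc_right t.2.2
    have ht : (t : ℝ) - (zeroTime T : Time T) ≤ T := by simpa [zeroTime] using t.2.2
    exact mul_le_mul' (ENNReal.ofReal_le_ofReal ht) (lintegral_mono_set this)
  have h6 := ENNReal.toReal_mono (ENNReal.mul_ne_top ENNReal.ofReal_ne_top hk.ne_top) h5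
  simpa using h6

end CausalFunctional


/-! ### Limits of measures in total variation -/

section TotalVariation

variable {Z : Type*} [MeasurableSpace Z]

/-- Uniform convergence on measurable sets, that is, convergence in total variation. -/
def TendstoUnif (μ : ℕ → Measure Z) (ν : Measure Z) : Prop :=
  ∀ ε : ℝ≥0∞, 0 < ε → ∃ N, ∀ k ≥ N, ∀ A, MeasurableSet A → μ k A ≤ ν A + ε ∧ ν A ≤ μ k A + ε

lemma tendsto_of_forall_le_add {x : ℕ → ℝ≥0∞} {a : ℝ≥0∞} (ha : a ≠ ∞)
    (h : ∀ ε : ℝ≥0∞, 0 < ε → ∃ N, ∀ k ≥ N, x k ≤ a + ε ∧ a ≤ x k + ε) :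
    Tendsto x atTop (𝓝 a) := by
  rw [ENNReal.tendsto_nhds ha]
  intro ε hε
  obtain ⟨N, hN⟩ := h ε hε
  filter_upwards [eventually_ge_atTop N] with k hk
  exact ⟨tsub_le_iff_right.2 (hN k hk).2, (hN k hk).1⟩

/-- Probability measures are complete for the total variation distance. -/
theorem exists_tendstoUnif (μ : ℕ → Measure Z) [∀ k, IsProbabilityMeasure (μ k)]
    (h : ∀ ε : ℝ≥0∞, 0 < ε → ∃ N, ∀ k ≥ N, ∀ l ≥ N, ∀ A, MeasurableSet A →
      μ k A ≤ μ l A + ε) :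
    ∃ ν : Measure Z, IsProbabilityMeasure ν ∧ TendstoUnif μ ν := by
  set m : Set Z → ℝ≥0∞ := fun A => limsup (fun k => μ k A) atTop with hm
  have hclose : ∀ ε : ℝ≥0∞, 0 < ε → ∃ N, ∀ k ≥ N, ∀ A, MeasurableSet A →
      μ k A ≤ m A + ε ∧ m A ≤ μ k A + ε := by
    intro ε hε
    obtain ⟨N, hN⟩ := h ε hε
    refine ⟨N, fun k hk A hA => ⟨?_, ?_⟩⟩
    · rw [← tsub_le_iff_right]
      refine le_limsup_of_frequently_le (Eventually.frequently ?_)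
      filter_upwards [eventually_ge_atTop N] with l hl
      exact tsub_le_iff_right.2 (hN k hk l hl A hA)
    · refine limsup_le_of_le (h := ?_)
      filter_upwards [eventually_ge_atTop N] with l hl
      exact hN l hl k hk A hA
  have hm1 : ∀ A, m A ≤ 1 := fun A =>
    limsup_le_of_le (h := Eventually.of_forall fun k => prob_le_one)
  have hlim : ∀ A, MeasurableSet A → Tendsto (fun k => μ k A) atTop (𝓝 (m A)) := fun A hA =>
    tendsto_of_forall_le_add ((hm1 A).trans_lt ENNReal.one_lt_top).ne fun ε hε =>
      (hclose ε hε).imp fun _ hN k hk => hN k hk A hA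
  have hm0 : m ∅ = 0 := by simp [hm]
  have hmono : ∀ A B, MeasurableSet A → MeasurableSet B → A ⊆ B → m A ≤ m B :=
    fun A B hA hB hAB => le_of_tendsto_of_tendsto' (hlim A hA) (hlim B hB)
      fun k => measure_mono hAB
  have hsum : ∀ (A : ℕ → Set Z), (∀ i, MeasurableSet (A i)) → Pairwise (Function.onFun Disjoint A) →
      ∀ s : Finset ℕ, m (⋃ i ∈ s, A i) = ∑ i ∈ s, m (A i) := by
    intro A hA hd s
    refine tendsto_nhds_unique (hlim _ (s.measurableSet_biUnion fun i _ => hA i)) ?_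
    have : ∀ k, μ k (⋃ i ∈ s, A i) = ∑ i ∈ s, μ k (A i) := fun k =>
      measure_biUnion_finset (fun i _ j _ hij => hd hij) fun i _ => hA i
    simp_rw [this]
    exact tendsto_finsetSum _ fun i _ => hlim _ (hA i)
  set ν : Measure Z := Measure.ofMeasurable (fun A _ => m A) hm0 (by
    intro A hA hd
    refine le_antisymm ?_ ?_
    · refine ENNReal.le_of_forall_pos_le_add fun ε hε _ => ?_
      have hε' : (0 : ℝ≥0∞) < ε / 3 := by
        refine ENNReal.div_pos ?_ (by simp)
        exact_mod_cast hε.ne'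
      obtain ⟨N, hN⟩ := hclose _ hε'
      have hU := MeasurableSet.iUnion hA
      have h1 := (hN N le_rfl _ hU).2
      have h2 : ∃ s : Finset ℕ, μ N (⋃ i, A i) ≤ ∑ i ∈ s, μ N (A i) + ε / 3 := by
        rw [measure_iUnion hd hA]
        have hne : ∑' i, μ N (A i) ≠ ∞ := by
          rw [← measure_iUnion hd hA]; exact measure_ne_top _ _
        obtain ⟨s, hs⟩ := ((ENNReal.tendsto_nhds hne).1 ENNReal.summable.hasSum _ hε').exists
        exact ⟨s, tsub_le_iff_right.1 hs.1⟩
      obtain ⟨s, hs⟩ := h2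
      have hsU : MeasurableSet (⋃ i ∈ s, A i) := s.measurableSet_biUnion fun i _ => hA i
      have h3 := (hN N le_rfl _ hsU).1
      rw [hsum A hA hd s, measure_biUnion_finset (fun i _ j _ hij => hd hij) fun i _ => hA i] at h3
      calc m (⋃ i, A i) ≤ ((∑ i ∈ s, m (A i) + ε / 3) + ε / 3) + ε / 3 :=
            h1.trans (by gcongr; exact hs.trans (by gcongr))
        _ = ∑ i ∈ s, m (A i) + ε := by
            rw [add_assoc, add_assoc, ← add_assoc (ε / 3 : ℝ≥0∞), ENNReal.add_thirds]
        _ ≤ ∑' i, m (A i) + ε := by gcongr; exact ENNReal.sum_le_tsum s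
    · rw [ENNReal.tsum_eq_iSup_sum]
      refine iSup_le fun s => ?_
      rw [← hsum A hA hd s]
      exact hmono _ _ (s.measurableSet_biUnion fun i _ => hA i) (MeasurableSet.iUnion hA)
        (iUnion₂_subset fun i _ => subset_iUnion A i)) with hν
  have hνm : ∀ A, MeasurableSet A → ν A = m A := fun A hA => Measure.ofMeasurable_apply A hA
  refine ⟨ν, ⟨?_⟩, fun ε hε => ?_⟩
  · rw [hνm _ MeasurableSet.univ]
    refine tendsto_nhds_unique (hlim _ MeasurableSet.univ) ?_
    simp
  · obtain ⟨N, hN⟩ := hclose ε hε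
    refine ⟨N, fun k hk A hA => ?_⟩
    rw [hνm A hA]
    exact hN k hk A hA

end TotalVariation

/-! ### Uniqueness in law and existence for causal equations -/

section Equation

variable {T : ℝ≥0} {K : Type*} [NormedAddCommGroup K] [InnerProductSpace ℝ K]
  [FiniteDimensional ℝ K] [MeasurableSpace K] [BorelSpace K]
variable {Ω : Type*} {mΩ : MeasurableSpace Ω} {P : Measure Ω} [IsProbabilityMeasure P]
variable {H : Time T → MeasurableSpace Ω} {W : Ω → PathSpace T K}
  {𝒴 : Type*} [MeasurableSpace 𝒴] {Y : Ω → 𝒴}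
  [TopologicalSpace 𝒴] [PolishSpace 𝒴] [BorelSpace 𝒴]

lemma exists_ofReal_le {ε : ℝ≥0∞} (hε : 0 < ε) : ∃ e : ℝ, 0 < e ∧ ENNReal.ofReal e ≤ ε := by
  obtain ⟨q, hq0, hq⟩ := ENNReal.lt_iff_exists_nnreal_btwn.1 hε
  exact ⟨q, by exact_mod_cast hq0, by simpa using hq.le⟩

lemma exists_exp_add_le {ε : ℝ} (hε : 0 < ε) :
    ∃ l : ℝ, 0 < l ∧ (Real.exp (l + l ^ 3 / 2) - 1) + l ≤ ε := by
  have hc : Continuous fun l : ℝ => (Real.exp (l + l ^ 3 / 2) - 1) + l := by fun_prop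
  have h0 : Tendsto (fun l : ℝ => (Real.exp (l + l ^ 3 / 2) - 1) + l) (𝓝[>] 0) (𝓝 0) := by
    have := (hc.tendsto 0).mono_left (nhdsWithin_le_nhds (s := Ioi 0))
    simpa using this
  obtain ⟨l, hl, hl'⟩ := ((h0.eventually_le_const hε).and self_mem_nhdsWithin).exists
  exact ⟨l, hl', hl⟩

/-- A drift of small energy changes the law of a Brownian motion little in total variation. -/
theorem IsBM.exists_measure_shift_le (hT : 0 < T) (hW : IsBM H W P)
    (hY : Measurable[H (zeroTime T)] Y) {ε : ℝ≥0∞} (hε : 0 < ε) :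
    ∃ κ : ℝ, 0 < κ ∧ ∀ (f : CausalFunctional T 𝒴 K) (V U : Ω → PathSpace T K),
      (∀ t, Measurable[H t] fun ω => V ω t) → Measurable U →
      (∀ᵐ ω ∂P, U ω = W ω + f.primitive (Y ω) (V ω)) →
      ∀ A : Set (𝒴 × PathSpace T K), MeasurableSet A →
      P {ω | (Y ω, U ω) ∈ A} ≤ P {ω | (Y ω, W ω) ∈ A} +
        (P {ω | ENNReal.ofReal κ < f.energy (Y ω) (V ω)} + ε) ∧
      P {ω | (Y ω, W ω) ∈ A} ≤ P {ω | (Y ω, U ω) ∈ A} +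
        (P {ω | ENNReal.ofReal κ < f.energy (Y ω) (V ω)} + ε) := by
  obtain ⟨ε', hε', hle⟩ := exists_ofReal_le hε
  -- With `κ = l ^ 3`, both the excess `exp (l + κ / 2) - 1` of the factor in `measure_shift_le` and
  -- the error `κ / l ^ 2 = l` are small for small `l`.
  obtain ⟨l, hl, hlε⟩ := exists_exp_add_le hε'
  refine ⟨l ^ 3, by positivity, fun f V U hV hUm hU => ?_⟩
  have hYm : Measurable Y := hY.mono (hW.le _) le_rfl
  set c := P {ω | ENNReal.ofReal (l ^ 3) < f.energy (Y ω) (V ω)} with hc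
  have key : ∀ A : Set (𝒴 × PathSpace T K), MeasurableSet A →
      P {ω | (Y ω, U ω) ∈ A} ≤ P {ω | (Y ω, W ω) ∈ A} + (c + ε) := by
    intro A hA
    have h1 := hW.measure_shift_le hT f hY hV hUm hU hA hl (pow_nonneg hl.le 3)
    have h2 : l ^ 3 / l ^ 2 = l := by field_simp
    have h3 : (1 : ℝ) ≤ Real.exp (l + l ^ 3 / 2) := Real.one_le_exp (by positivity)
    have h4 : ENNReal.ofReal (Real.exp (l + l ^ 3 / 2)) =
        1 + ENNReal.ofReal (Real.exp (l + l ^ 3 / 2) - 1) := by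
      rw [← ENNReal.ofReal_one, ← ENNReal.ofReal_add zero_le_one (by linarith)]
      congr 1; ring
    rw [h2, h4, add_mul, one_mul] at h1
    refine h1.trans ?_
    rw [add_assoc]
    gcongr P _ + ?_
    calc ENNReal.ofReal (Real.exp (l + l ^ 3 / 2) - 1) * P {ω | (Y ω, W ω) ∈ A} +
          (c + ENNReal.ofReal l)
        ≤ ENNReal.ofReal (Real.exp (l + l ^ 3 / 2) - 1) * 1 + (c + ENNReal.ofReal l) := by
          gcongr; exact prob_le_one
      _ = c + ENNReal.ofReal ((Real.exp (l + l ^ 3 / 2) - 1) + l) := by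
          rw [mul_one, ENNReal.ofReal_add (by linarith) hl.le]; ring
      _ ≤ c + ε := by
          gcongr; exact (ENNReal.ofReal_le_ofReal hlε).trans hle
  refine fun A hA => ⟨key A hA, ?_⟩
  -- The second inequality is the first one for the complement of `A`.
  have h1 := key Aᶜ hA.compl
  have e : ∀ Z : Ω → PathSpace T K, Measurable Z →
      P {ω | (Y ω, Z ω) ∈ Aᶜ} = 1 - P {ω | (Y ω, Z ω) ∈ A} := fun Z hZ =>
    prob_compl_eq_one_sub (hYm.prodMk hZ hA)
  rw [e U hUm, e W hW.measurable, tsub_le_iff_right] at h1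
  set a := P {ω | (Y ω, W ω) ∈ A}
  set b := P {ω | (Y ω, U ω) ∈ A}
  have ha : a ≤ 1 := prob_le_one
  have h2 : a + (1 - a) ≤ (b + (c + ε)) + (1 - a) := by
    rw [add_tsub_cancel_of_le ha]
    refine h1.trans (le_of_eq ?_)
    ring
  exact (ENNReal.add_le_add_iff_right (ne_top_of_le_ne_top ENNReal.one_ne_top tsub_le_self)).1 h2

variable {f : CausalFunctional T 𝒴 K} {C : 𝒴 → ℝ}

lemma CausalFunctional.energy_sub_comm (f g : CausalFunctional T 𝒴 K) (y : 𝒴)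
    (v : PathSpace T K) : (f - g).energy y v = (g - f).energy y v := by
  simp only [CausalFunctional.energy, CausalFunctional.sub_apply]
  refine lintegral_congr fun r => ?_
  rw [← enorm_neg, neg_sub]

lemma CausalFunctional.IsGrowth.tendsto_measure_energy (hf : f.IsGrowth C) {h : ℕ → ℝ≥0}
    (hh : Tendsto h atTop (𝓝 0)) {κ : ℝ≥0∞} (hκ : 0 < κ) (μ : Measure (𝒴 × PathSpace T K))
    [IsFiniteMeasure μ] :
    Tendsto (fun k => μ {q | κ < (f.delay (h k) - f).energy q.1 q.2}) atTop (𝓝 0) := by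
  have hm : ∀ k, MeasurableSet {q : 𝒴 × PathSpace T K | κ < (f.delay (h k) - f).energy q.1 q.2} :=
    fun k => measurableSet_lt measurable_const (CausalFunctional.measurable_energy _)
  have h1 : Tendsto (fun k => ∫⁻ q, {q : 𝒴 × PathSpace T K |
      κ < (f.delay (h k) - f).energy q.1 q.2}.indicator 1 q ∂μ) atTop (𝓝 (∫⁻ _, 0 ∂μ)) := by
    have h1m : Measurable (1 : 𝒴 × PathSpace T K → ℝ≥0∞) := measurable_one
    refine tendsto_lintegral_of_dominated_convergence (1 : 𝒴 × PathSpace T K → ℝ≥0∞)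
      (fun k => h1m.indicator (hm k)) (fun k => ae_of_all _ fun q => ?_)
      (by simp) (ae_of_all _ fun q => ?_)
    · exact indicator_le_self _ (1 : 𝒴 × PathSpace T K → ℝ≥0∞) q
    refine tendsto_const_nhds.congr' ?_
    filter_upwards [(hf.tendsto_energy_delay_sub q.1 q.2 hh).eventually_le_const hκ] with k hk
    rw [indicator_of_notMem]
    exact not_lt.2 hk
  simpa only [lintegral_indicator_one (hm _), lintegral_zero] using h1

/-- Uniqueness in law: the law of a solution is the limit of the laws of the solutions of the
delayed equations, which are functions of the parameter and of the noise. -/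
theorem IsBM.tendsto_measure_delaySol (hT : 0 < T) (hW : IsBM H W P)
    (hY : Measurable[H (zeroTime T)] Y) (hf : f.IsGrowth C) {V : Ω → PathSpace T K}
    (hV : ∀ t, Measurable[H t] fun ω => V ω t) (hVW : ∀ᵐ ω ∂P, f.residual (Y ω) (V ω) = W ω)
    {h : ℕ → ℝ≥0} (hpos : ∀ k, 0 < h k) (hh : Tendsto h atTop (𝓝 0))
    {A : Set (𝒴 × PathSpace T K)} (hA : MeasurableSet A) :
    Tendsto (fun k => P {ω | (Y ω, f.delaySol (h k) (Y ω) (W ω)) ∈ A}) atTop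
      (𝓝 (P {ω | (Y ω, V ω) ∈ A})) := by
  have hYm : Measurable Y := hY.mono (hW.le _) le_rfl
  have hVm : Measurable V := measurable_path_iff.2 fun t => (hV t).mono (hW.le t) le_rfl
  have hYV := hYm.prodMk hVm
  refine tendsto_of_forall_le_add (measure_ne_top P _) fun ε hε => ?_
  obtain ⟨κ, hκ, hκ'⟩ := hW.exists_measure_shift_le hT hY (ENNReal.half_pos hε.ne')
  have : IsProbabilityMeasure (P.map fun ω => (Y ω, V ω)) :=
    Measure.isProbabilityMeasure_map hYV.aemeasurable
  obtain ⟨N, hN⟩ := eventually_atTop.1 ((hf.tendsto_measure_energy hh (ENNReal.ofReal_pos.2 hκ)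
    (P.map fun ω => (Y ω, V ω))).eventually_le_const (ENNReal.half_pos hε.ne'))
  refine ⟨N, fun k hk => ?_⟩
  set g := f.delay (h k)
  have hUm : Measurable fun ω => g.residual (Y ω) (V ω) := g.measurable_residual.comp hYV
  have hA' : MeasurableSet {q : 𝒴 × PathSpace T K | (q.1, f.delaySol (h k) q.1 q.2) ∈ A} :=
    (measurable_fst.prodMk (f.measurable_delaySol (h k))) hA
  -- `V` solves the delayed equation driven by `g.residual (Y, V) = W + ∫ (f - g)(r, Y, V) dr`.
  have h1 := hκ' (f - g) V (fun ω => g.residual (Y ω) (V ω)) hV hUm (by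
    filter_upwards [hVW] with ω hω
    rw [← hω, CausalFunctional.primitive_sub, CausalFunctional.residual, CausalFunctional.residual]
    abel) _ hA'
  have h2 : P {ω | ENNReal.ofReal κ < (f - g).energy (Y ω) (V ω)} ≤ ε / 2 := by
    have h3 := hN k hk
    rw [Measure.map_apply hYV (measurableSet_lt measurable_const
      (CausalFunctional.measurable_energy _))] at h3
    simp_rw [CausalFunctional.energy_sub_comm f g]
    exact h3
  simp only [mem_ofPred_eq, f.delaySol_residual (hpos k), g] at h1
  have h4 : P {ω | ENNReal.ofReal κ < (f - g).energy (Y ω) (V ω)} + ε / 2 ≤ ε :=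
    (add_le_add_left h2 _).trans (ENNReal.add_halves ε).le
  exact ⟨h1.2.trans (by gcongr), h1.1.trans (by gcongr)⟩

end Equation


/-! ### Existence in law for causal equations -/

section Existence

variable {T : ℝ≥0} {K : Type*} [NormedAddCommGroup K] [InnerProductSpace ℝ K]
  [FiniteDimensional ℝ K] [MeasurableSpace K] [BorelSpace K]
variable {Ω : Type*} {mΩ : MeasurableSpace Ω} {P : Measure Ω} [IsProbabilityMeasure P]
variable {H : Time T → MeasurableSpace Ω} {W : Ω → PathSpace T K}
  {𝒴 : Type*} [MeasurableSpace 𝒴] {Y : Ω → 𝒴}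
  [TopologicalSpace 𝒴] [PolishSpace 𝒴] [BorelSpace 𝒴]
variable {f : CausalFunctional T 𝒴 K} {C : 𝒴 → ℝ} {h : ℕ → ℝ≥0}

lemma exists_measure_gt_le {α : Type*} {mα : MeasurableSpace α} (μ : Measure α) [IsFiniteMeasure μ]
    {g : α → ℝ} (hg : Measurable g) {ε : ℝ≥0∞} (hε : 0 < ε) :
    ∃ N : ℕ, μ {x | (N : ℝ) < g x} ≤ ε := by
  have h1 : Tendsto (fun N : ℕ => μ {x | (N : ℝ) < g x}) atTop
      (𝓝 (μ (⋂ N : ℕ, {x | (N : ℝ) < g x}))) := by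
    refine tendsto_measure_iInter_atTop
      (fun N => (measurableSet_lt measurable_const hg).nullMeasurableSet) ?_
      ⟨0, measure_ne_top _ _⟩
    intro M N hMN x hx
    have : (M : ℝ) ≤ N := by exact_mod_cast hMN
    exact lt_of_le_of_lt this hx
  have h2 : (⋂ N : ℕ, {x | (N : ℝ) < g x}) = ∅ := by
    refine eq_empty_of_forall_notMem fun x hx => ?_
    obtain ⟨N, hN⟩ := exists_nat_ge (g x)
    exact not_lt.2 hN (mem_iInter.1 hx N)
  rw [h2, measure_empty] at h1
  exact (h1.eventually_le_const hε).exists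

lemma IsBM.measurable_delaySol_apply (hW : IsBM H W P) (hY : Measurable[H (zeroTime T)] Y)
    {η : ℝ≥0} (hη : 0 < η) (t : Time T) :
    Measurable[H t] fun ω => f.delaySol η (Y ω) (W ω) t :=
  f.measurable_delaySol_apply (τ := id) hη (fun _ _ _ _ => rfl)
    (hY.mono (hW.mono (zeroTime_le t)) le_rfl)
    (fun r hr => (hW.meas r).mono (hW.mono hr) le_rfl) t le_rfl

lemma IsBM.measurable_delaySol (hW : IsBM H W P) (hY : Measurable[H (zeroTime T)] Y) (η : ℝ≥0) :
    Measurable fun ω => f.delaySol η (Y ω) (W ω) :=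
  (f.measurable_delaySol η).comp ((hY.mono (hW.le _) le_rfl).prodMk hW.measurable)

/-- The laws of the solutions of the delayed equations are uniformly absolutely continuous with
respect to the law of the parameter and the noise. -/
theorem IsBM.exists_forall_measure_delaySol_le (hT : 0 < T) (hW : IsBM H W P)
    (hY : Measurable[H (zeroTime T)] Y) (hf : f.IsGrowth C) {ε : ℝ≥0∞} (hε : 0 < ε) :
    ∃ δ : ℝ≥0∞, 0 < δ ∧ ∀ η : ℝ≥0, 0 < η → ∀ A : Set (𝒴 × PathSpace T K), MeasurableSet A →
      P {ω | (Y ω, W ω) ∈ A} ≤ δ → P {ω | (Y ω, f.delaySol η (Y ω) (W ω)) ∈ A} ≤ ε := by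
  have hYm : Measurable Y := hY.mono (hW.le _) le_rfl
  have hε3 : 0 < ε / 3 := ENNReal.div_pos hε.ne' (by simp)
  obtain ⟨e, he, hee⟩ := exists_ofReal_le hε3
  have hCY : Measurable fun ω => C (Y ω) := hf.measurable.comp hYm
  have hWn : Measurable fun ω => ‖W ω‖ := hW.measurable.norm
  -- Outside of a small event, `κ` bounds the energy of all the delayed drifts; then `l` makes the
  -- error `κ / l ^ 2` small.
  obtain ⟨κ, hκ⟩ := exists_measure_gt_le P (g := fun ω =>
    (C (Y ω) * (1 + (‖W ω‖ + C (Y ω) * T) * Real.exp (C (Y ω) * T))) ^ 2 * T)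
    (((hCY.mul (measurable_const.add ((hWn.add (hCY.mul_const _)).mul
      (hCY.mul_const _).exp))).pow_const 2).mul_const _) hε3
  set l : ℝ := κ / e + 1 with hl
  have hl1 : 1 ≤ l := by have : (0 : ℝ) ≤ κ / e := by positivity
                         linarith
  have hκl : (κ : ℝ) / l ^ 2 ≤ e := by
    rw [div_le_iff₀ (by positivity)]
    have h1 : (κ : ℝ) ≤ e * l := by rw [hl]; field_simp; linarith
    nlinarith [mul_nonneg he.le (mul_nonneg (zero_le_one.trans hl1) (sub_nonneg.2 hl1))]
  set M := ENNReal.ofReal (Real.exp (l + κ / 2)) with hM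
  have hM0 : M ≠ 0 := (ENNReal.ofReal_pos.2 (Real.exp_pos _)).ne'
  refine ⟨ε / 3 / M, ENNReal.div_pos hε3.ne' ENNReal.ofReal_ne_top, fun η hη A hA hδ => ?_⟩
  have h1 := hW.measure_shift_le hT (f.delay η) hY (hW.measurable_delaySol_apply (f := f) hY hη)
    (hW.measurable_delaySol hY η) (ae_of_all _ fun ω =>
      (CausalFunctional.residual_eq_iff _).1 (f.residual_delaySol hη (Y ω) (W ω))) hA
    (zero_lt_one.trans_le hl1) κ.cast_nonneg
  refine h1.trans ?_
  calc M * P {ω | (Y ω, W ω) ∈ A} + (P {ω | ENNReal.ofReal κ < (f.delay η).energy (Y ω)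
        (f.delaySol η (Y ω) (W ω))} + ENNReal.ofReal (κ / l ^ 2))
      ≤ ε / 3 + (ε / 3 + ε / 3) := by
        gcongr
        · exact (mul_le_mul_right hδ M).trans ENNReal.mul_div_le
        · refine (measure_mono fun ω hω => ?_).trans hκ
          exact (ENNReal.ofReal_lt_ofReal_iff_of_nonneg κ.cast_nonneg).1
            (hω.trans_le (hf.energy_delay_le (f.residual_delaySol hη (Y ω) (W ω))))
        · exact (ENNReal.ofReal_le_ofReal hκl).trans hee
    _ = ε := by rw [← add_assoc, ENNReal.add_thirds]

/-- The laws of the solutions of the delayed equations converge in total variation. -/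
theorem IsBM.exists_tendstoUnif_delaySol (hT : 0 < T) (hW : IsBM H W P)
    (hY : Measurable[H (zeroTime T)] Y) (hf : f.IsGrowth C) (hpos : ∀ k, 0 < h k)
    (hh : Tendsto h atTop (𝓝 0)) :
    ∃ Q : Measure (𝒴 × PathSpace T K), IsProbabilityMeasure Q ∧
      TendstoUnif (fun k => P.map fun ω => (Y ω, f.delaySol (h k) (Y ω) (W ω))) Q := by
  have hYm : Measurable Y := hY.mono (hW.le _) le_rfl
  have hm : ∀ k, Measurable fun ω => (Y ω, f.delaySol (h k) (Y ω) (W ω)) := fun k =>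
    hYm.prodMk (hW.measurable_delaySol hY _)
  have hprob : ∀ k, IsProbabilityMeasure (P.map fun ω => (Y ω, f.delaySol (h k) (Y ω) (W ω))) :=
    fun k => Measure.isProbabilityMeasure_map (hm k).aemeasurable
  refine exists_tendstoUnif _ fun ε hε => ?_
  have hε3 : 0 < ε / 3 := ENNReal.div_pos hε.ne' (by simp)
  obtain ⟨κ, hκ, hκ'⟩ := hW.exists_measure_shift_le hT hY hε3
  obtain ⟨δ, hδ, hδ'⟩ := hW.exists_forall_measure_delaySol_le hT hY hf hε3
  have hYW := hYm.prodMk hW.measurable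
  obtain ⟨N, hN⟩ := eventually_atTop.1 ((hf.tendsto_measure_energy hh
    (ENNReal.ofReal_pos.2 (by positivity : 0 < κ / 4))
    (P.map fun ω => (Y ω, W ω))).eventually_le_const hδ)
  refine ⟨N, fun k hk l hl A hA => ?_⟩
  set V : Ω → PathSpace T K := fun ω => f.delaySol (h k) (Y ω) (W ω) with hV
  have hVm : Measurable V := hW.measurable_delaySol hY _
  rw [Measure.map_apply (hm k) hA, Measure.map_apply (hm l) hA]
  have hA' : MeasurableSet {q : 𝒴 × PathSpace T K | (q.1, f.delaySol (h l) q.1 q.2) ∈ A} :=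
    (measurable_fst.prodMk (f.measurable_delaySol (h l))) hA
  -- The solution with delay `h k` solves the equation with delay `h l` driven by `W` plus the
  -- primitive of the difference of the two drifts.
  have h1 := (hκ' (f.delay (h k) - f.delay (h l)) V
    (fun ω => (f.delay (h l)).residual (Y ω) (V ω)) (hW.measurable_delaySol_apply hY (hpos k))
    ((f.delay (h l)).measurable_residual.comp (hYm.prodMk hVm)) (ae_of_all _ fun ω => by
      have h2 : (f.delay (h k)).residual (Y ω) (V ω) = W ω :=
        f.residual_delaySol (hpos k) (Y ω) (W ω)
      rw [← h2, CausalFunctional.primitive_sub, CausalFunctional.residual,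
        CausalFunctional.residual]
      abel) _ hA').1
  simp only [mem_ofPred_eq, f.delaySol_residual (hpos l)] at h1
  have hs : ∀ j ≥ N, P {ω | ENNReal.ofReal (κ / 4) <
      (f.delay (h j) - f).energy (Y ω) (V ω)} ≤ ε / 3 := by
    intro j hj
    have hmj : MeasurableSet {q : 𝒴 × PathSpace T K | ENNReal.ofReal (κ / 4) <
        (f.delay (h j) - f).energy q.1 q.2} :=
      measurableSet_lt measurable_const (CausalFunctional.measurable_energy _)
    refine hδ' (h k) (hpos k) _ hmj ?_
    have h3 := hN j hj
    rwa [Measure.map_apply hYW hmj] at h3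
  have hsub : {ω | ENNReal.ofReal κ < (f.delay (h k) - f.delay (h l)).energy (Y ω) (V ω)} ⊆
      {ω | ENNReal.ofReal (κ / 4) < (f.delay (h k) - f).energy (Y ω) (V ω)} ∪
      {ω | ENNReal.ofReal (κ / 4) < (f.delay (h l) - f).energy (Y ω) (V ω)} := by
    intro ω hω
    by_contra hcon
    simp only [mem_union, mem_ofPred_eq, not_or, not_lt] at hcon hω
    refine absurd hω (not_lt.2 ?_)
    refine (CausalFunctional.energy_sub_le _ _ f _ _).trans ?_
    calc _ ≤ 2 * ENNReal.ofReal (κ / 4) + 2 * ENNReal.ofReal (κ / 4) := by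
          gcongr
          · exact hcon.1
          · exact hcon.2
      _ = ENNReal.ofReal κ := by
          rw [← two_mul, ← mul_assoc, show (2 * 2 : ℝ≥0∞) = ENNReal.ofReal 4 by norm_num,
            ← ENNReal.ofReal_mul (by norm_num)]
          congr 1; ring
  refine h1.trans ?_
  gcongr P _ + ?_
  calc _ ≤ (ε / 3 + ε / 3) + ε / 3 := by
        gcongr
        exact (measure_mono hsub).trans ((measure_union_le _ _).trans
          (add_le_add (hs k hk) (hs l hl)))
    _ = ε := ENNReal.add_thirds ε

end Existence


/-! ### Stable limits of the delayed equations -/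

/-- Setwise convergence of dominated measures implies convergence of integrals, by the layer cake
formula. -/
lemma tendsto_lintegral_of_tendsto_measure {Z : Type*} [MeasurableSpace Z] {R ν : Measure Z}
    {μ : ℕ → Measure Z} (hle : ∀ k, μ k ≤ R)
    (hlim : ∀ D, MeasurableSet D → Tendsto (fun k => μ k D) atTop (𝓝 (ν D))) {g : Z → ℝ}
    (hg : Measurable g) (hg0 : ∀ z, 0 ≤ g z) (hgi : ∫⁻ z, ENNReal.ofReal (g z) ∂(R) ≠ ∞) :
    Tendsto (fun k => ∫⁻ z, ENNReal.ofReal (g z) ∂(μ k)) atTop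
      (𝓝 (∫⁻ z, ENNReal.ofReal (g z) ∂ν)) := by
  have e : ∀ μ : Measure Z, ∫⁻ z, ENNReal.ofReal (g z) ∂μ = ∫⁻ t in Ioi (0 : ℝ), μ {z | t < g z} :=
    fun μ => lintegral_eq_lintegral_meas_lt μ (ae_of_all _ hg0) hg.aemeasurable
  simp only [e] at hgi ⊢
  have hanti : ∀ μ : Measure Z, Measurable fun t : ℝ => μ {z | t < g z} := fun μ =>
    Antitone.measurable fun s t hst => measure_mono fun z (hz : t < g z) => hst.trans_lt hz
  exact tendsto_lintegral_of_dominated_convergence (fun t => R {z | t < g z})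
    (fun k => hanti _) (fun k => ae_of_all _ fun t => hle k _) hgi
    (ae_of_all _ fun t => hlim _ (measurableSet_lt measurable_const hg))

section Stable

variable {T : ℝ≥0} {K : Type*} [NormedAddCommGroup K] [InnerProductSpace ℝ K]
  [FiniteDimensional ℝ K] [MeasurableSpace K] [BorelSpace K]
variable {Ω : Type*} {mΩ : MeasurableSpace Ω} {P : Measure Ω} [IsProbabilityMeasure P]
variable {H : Time T → MeasurableSpace Ω} {W : Ω → PathSpace T K}
  {𝒴 : Type*} [MeasurableSpace 𝒴] {Y : Ω → 𝒴}
  [TopologicalSpace 𝒴] [PolishSpace 𝒴] [BorelSpace 𝒴]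
variable {f : CausalFunctional T 𝒴 K} {C : 𝒴 → ℝ} {h : ℕ → ℝ≥0}

lemma CausalFunctional.measurable_prodMk_residual (f : CausalFunctional T 𝒴 K) :
    Measurable fun q : 𝒴 × PathSpace T K => (q.1, f.residual q.1 q.2) :=
  measurable_fst.prodMk f.measurable_residual

/-- The noise is recovered from the solution of the delayed equation as its residual, so that an
open set containing the limiting noise eventually contains the noises: this gives the lower bound
for open events, and the general case by outer regularity of the law of the noise. -/
lemma exists_le_measure_add (hYm : Measurable Y) (hWm : Measurable W) (hf : f.IsGrowth C)
    (hpos : ∀ k, 0 < h k) (hh : Tendsto h atTop (𝓝 0)) {Q : Measure (𝒴 × PathSpace T K)}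
    [IsProbabilityMeasure Q]
    (hQ : TendstoUnif (fun k => P.map fun ω => (Y ω, f.delaySol (h k) (Y ω) (W ω))) Q)
    {D : Set (𝒴 × PathSpace T K)} (hD : MeasurableSet D) {G : Set (PathSpace T K)}
    (hG : MeasurableSet G) {ε : ℝ≥0∞} (hε : 0 < ε) :
    ∃ N, ∀ k ≥ N, Q {q | (q.1, f.residual q.1 q.2) ∈ D ∧ q.2 ∈ G} ≤
      P {ω | (Y ω, W ω) ∈ D ∧ f.delaySol (h k) (Y ω) (W ω) ∈ G} + ε := by
  have hε3 : 0 < ε / 3 := ENNReal.div_pos hε.ne' (by simp)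
  have hYW := hYm.prodMk hWm
  have : IsProbabilityMeasure (P.map fun ω => (Y ω, W ω)) :=
    Measure.isProbabilityMeasure_map hYW.aemeasurable
  obtain ⟨O, hDO, hO, hOD⟩ := hD.exists_isOpen_sdiff_lt (μ := P.map fun ω => (Y ω, W ω))
    (measure_ne_top _ _) hε3.ne'
  set S : ℕ → Set (𝒴 × PathSpace T K) := fun k =>
    {q | (q.1, (f.delay (h k)).residual q.1 q.2) ∈ O ∧ q.2 ∈ G} with hS
  have hSm : ∀ k, MeasurableSet (S k) := fun k =>
    ((f.delay (h k)).measurable_prodMk_residual hO.measurableSet).inter (measurable_snd hG)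
  set S' : ℕ → Set (𝒴 × PathSpace T K) := fun N => ⋂ k ≥ N, S k with hS'
  have hmono : Monotone S' := fun M N hMN q hq => by
    simp only [hS', mem_iInter] at hq ⊢
    exact fun k hk => hq k (hMN.trans hk)
  have hsub : {q : 𝒴 × PathSpace T K | (q.1, f.residual q.1 q.2) ∈ D ∧ q.2 ∈ G} ⊆
      ⋃ N, S' N := by
    rintro q ⟨hq, hqG⟩
    have h1 : Tendsto (fun k => (q.1, (f.delay (h k)).residual q.1 q.2)) atTop
        (𝓝 (q.1, f.residual q.1 q.2)) :=
      tendsto_const_nhds.prodMk_nhds (hf.tendsto_residual_delay q.1 q.2 hh)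
    obtain ⟨N, hN⟩ := eventually_atTop.1 (h1.eventually_mem (hO.mem_nhds (hDO hq)))
    exact mem_iUnion.2 ⟨N, mem_iInter₂.2 fun k hk => ⟨hN k hk, hqG⟩⟩
  have hlim := tendsto_measure_iUnion_atTop (μ := Q) hmono
  obtain ⟨N₁, hN₁⟩ := eventually_atTop.1
    (((ENNReal.tendsto_nhds (measure_ne_top Q _)).1 hlim) (ε / 3) hε3)
  obtain ⟨N₂, hN₂⟩ := hQ (ε / 3) hε3
  refine ⟨max N₁ N₂, fun k hk => ?_⟩
  have hm : Measurable fun ω => (Y ω, f.delaySol (h k) (Y ω) (W ω)) :=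
    hYm.prodMk ((f.measurable_delaySol _).comp hYW)
  have h1 := (hN₂ k ((le_max_right _ _).trans hk) _ (hSm k)).2
  rw [Measure.map_apply hm (hSm k)] at h1
  rw [Measure.map_apply hYW (hO.measurableSet.diff hD)] at hOD
  calc Q {q | (q.1, f.residual q.1 q.2) ∈ D ∧ q.2 ∈ G}
      ≤ Q (⋃ N, S' N) := measure_mono hsub
    _ ≤ Q (S' k) + ε / 3 := tsub_le_iff_right.1 (hN₁ k ((le_max_left _ _).trans hk)).1
    _ ≤ Q (S k) + ε / 3 := by
        gcongr
        exact iInter₂_subset k le_rfl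
    _ ≤ (P ((fun ω => (Y ω, f.delaySol (h k) (Y ω) (W ω))) ⁻¹' S k) + ε / 3) + ε / 3 := by gcongr
    _ ≤ ((P {ω | (Y ω, W ω) ∈ D ∧ f.delaySol (h k) (Y ω) (W ω) ∈ G} + ε / 3) + ε / 3) + ε / 3 := by
        gcongr
        refine (measure_mono fun ω hω => ?_).trans ((measure_union_le _ _).trans
          (add_le_add_right hOD.2.le _))
        simp only [hS, mem_preimage, mem_ofPred_eq, f.residual_delaySol (hpos k)] at hω
        by_cases hωD : (Y ω, W ω) ∈ D
        · exact Or.inl ⟨hωD, hω.2⟩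
        · exact Or.inr ⟨hω.1, hωD⟩
    _ = _ := by rw [add_assoc, add_assoc, ← add_assoc (ε / 3 : ℝ≥0∞), ENNReal.add_thirds]

/-- The lower bound `exists_le_measure_add`, applied to the complement of `D`, gives the matching
upper bound. -/
lemma tendsto_measure_and (hYm : Measurable Y) (hWm : Measurable W) (hf : f.IsGrowth C)
    (hpos : ∀ k, 0 < h k) (hh : Tendsto h atTop (𝓝 0)) {Q : Measure (𝒴 × PathSpace T K)}
    [IsProbabilityMeasure Q]
    (hQ : TendstoUnif (fun k => P.map fun ω => (Y ω, f.delaySol (h k) (Y ω) (W ω))) Q)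
    {D : Set (𝒴 × PathSpace T K)} (hD : MeasurableSet D) {G : Set (PathSpace T K)}
    (hG : MeasurableSet G) :
    Tendsto (fun k => P {ω | (Y ω, W ω) ∈ D ∧ f.delaySol (h k) (Y ω) (W ω) ∈ G}) atTop
      (𝓝 (Q {q | (q.1, f.residual q.1 q.2) ∈ D ∧ q.2 ∈ G})) := by
  refine tendsto_of_forall_le_add (measure_ne_top Q _) fun ε hε => ?_
  have hε2 : 0 < ε / 2 := ENNReal.half_pos hε.ne'
  obtain ⟨N₁, hN₁⟩ := exists_le_measure_add hYm hWm hf hpos hh hQ hD hG hε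
  obtain ⟨N₂, hN₂⟩ := exists_le_measure_add hYm hWm hf hpos hh hQ hD.compl hG hε2
  obtain ⟨N₃, hN₃⟩ := hQ (ε / 2) hε2
  refine ⟨max N₁ (max N₂ N₃), fun k hk => ⟨?_, hN₁ k ((le_max_left _ _).trans hk)⟩⟩
  have h2 := hN₂ k (((le_max_left _ _).trans (le_max_right _ _)).trans hk)
  have h3 := (hN₃ k (((le_max_right _ _).trans (le_max_right _ _)).trans hk) _
    (measurable_snd hG)).1
  have hYW := hYm.prodMk hWm
  have hm : Measurable fun ω => (Y ω, f.delaySol (h k) (Y ω) (W ω)) :=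
    hYm.prodMk ((f.measurable_delaySol _).comp hYW)
  rw [Measure.map_apply hm (measurable_snd hG)] at h3
  have e1 := measure_inter_add_sdiff (μ := P)
    ((fun ω => (Y ω, f.delaySol (h k) (Y ω) (W ω))) ⁻¹' (Prod.snd ⁻¹' G)) (hYW hD)
  have e2 := measure_inter_add_sdiff (μ := Q) (Prod.snd ⁻¹' G) (f.measurable_prodMk_residual hD)
  have s1 : (fun ω => (Y ω, f.delaySol (h k) (Y ω) (W ω))) ⁻¹' (Prod.snd ⁻¹' G) ∩
      (fun ω => (Y ω, W ω)) ⁻¹' D =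
      {ω | (Y ω, W ω) ∈ D ∧ f.delaySol (h k) (Y ω) (W ω) ∈ G} := by ext; simp [and_comm]
  have s2 : (fun ω => (Y ω, f.delaySol (h k) (Y ω) (W ω))) ⁻¹' (Prod.snd ⁻¹' G) \
      (fun ω => (Y ω, W ω)) ⁻¹' D =
      {ω | (Y ω, W ω) ∈ Dᶜ ∧ f.delaySol (h k) (Y ω) (W ω) ∈ G} := by ext; simp [and_comm]
  have s3 : (Prod.snd ⁻¹' G : Set (𝒴 × PathSpace T K)) ∩
      (fun q => (q.1, f.residual q.1 q.2)) ⁻¹' D =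
      {q | (q.1, f.residual q.1 q.2) ∈ D ∧ q.2 ∈ G} := by ext; simp [and_comm]
  have s4 : (Prod.snd ⁻¹' G : Set (𝒴 × PathSpace T K)) \
      (fun q => (q.1, f.residual q.1 q.2)) ⁻¹' D =
      {q | (q.1, f.residual q.1 q.2) ∈ Dᶜ ∧ q.2 ∈ G} := by ext; simp [and_comm]
  rw [s1, s2] at e1
  rw [s3, s4] at e2
  rw [← e1, ← e2] at h3
  set a := P {ω | (Y ω, W ω) ∈ D ∧ f.delaySol (h k) (Y ω) (W ω) ∈ G}
  set a' := P {ω | (Y ω, W ω) ∈ Dᶜ ∧ f.delaySol (h k) (Y ω) (W ω) ∈ G} with ha'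
  refine (ENNReal.add_le_add_iff_right (measure_ne_top P _ : a' ≠ ∞)).1 (h3.trans ?_)
  calc _ ≤ Q {q | (q.1, f.residual q.1 q.2) ∈ D ∧ q.2 ∈ G} + (a' + ε / 2) + ε / 2 := by gcongr
    _ = Q {q | (q.1, f.residual q.1 q.2) ∈ D ∧ q.2 ∈ G} + a' + (ε / 2 + ε / 2) := by ring
    _ = _ := by rw [ENNReal.add_halves]; ring

/-- Existence of a weak solution. On an extension of the given space by the kernel `κ`, evaluated
at the parameter and the noise, the new coordinate solves the equation; and this extension is the
stable limit of the solutions of the delayed equations. -/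
theorem IsBM.exists_kernel (hT : 0 < T) (hW : IsBM H W P)
    (hY : Measurable[H (zeroTime T)] Y) (hf : f.IsGrowth C) (hpos : ∀ k, 0 < h k)
    (hh : Tendsto h atTop (𝓝 0)) :
    ∃ κ : Kernel (𝒴 × PathSpace T K) (PathSpace T K), IsMarkovKernel κ ∧
      (∀ᵐ ω ∂P, ∀ᵐ v ∂(κ (Y ω, W ω)), f.residual (Y ω) v = W ω) ∧
      ∀ D : Set Ω, MeasurableSet D → ∀ G : Set (PathSpace T K), MeasurableSet G →
        Tendsto (fun k => P (D ∩ {ω | f.delaySol (h k) (Y ω) (W ω) ∈ G})) atTop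
          (𝓝 (∫⁻ ω in D, κ (Y ω, W ω) G ∂P)) := by
  have hYm : Measurable Y := hY.mono (hW.le _) le_rfl
  have hWm := hW.measurable
  have hYW := hYm.prodMk hWm
  obtain ⟨Q, hQp, hQ⟩ := hW.exists_tendstoUnif_delaySol hT hY hf hpos hh
  set r : 𝒴 × PathSpace T K → 𝒴 × PathSpace T K := fun q => (q.1, f.residual q.1 q.2) with hr
  have hrm : Measurable r := f.measurable_prodMk_residual
  have hst := fun D hD G hG => tendsto_measure_and (P := P) (D := D) (G := G) hYm hWm hf hpos hh hQ
    hD hG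
  set R := P.map fun ω => (Y ω, W ω) with hR
  have hRp : IsProbabilityMeasure R := Measure.isProbabilityMeasure_map hYW.aemeasurable
  have hQR : Q.map r = R := by
    ext D hD
    rw [Measure.map_apply hrm hD, hR, Measure.map_apply hYW hD]
    have h1 := hst D hD univ MeasurableSet.univ
    simp only [mem_univ, and_true] at h1
    exact tendsto_nhds_unique h1 tendsto_const_nhds
  set κ := condDistrib Prod.snd r Q with hκ
  have hJ : R ⊗ₘ κ = Q.map fun q => (r q, q.2) := by
    rw [← hQR, hκ]
    exact compProd_map_condDistrib measurable_snd.aemeasurable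
  refine ⟨κ, inferInstance, ?_, fun D hD G hG => ?_⟩
  · have hset : MeasurableSet {z : (𝒴 × PathSpace T K) × PathSpace T K |
        f.residual z.1.1 z.2 = z.1.2} :=
      measurableSet_eq_fun (f.measurable_residual.comp
        ((measurable_fst.comp measurable_fst).prodMk measurable_snd))
        (measurable_snd.comp measurable_fst)
    have h1 : ∀ᵐ z ∂(R ⊗ₘ κ), f.residual z.1.1 z.2 = z.1.2 := by
      rw [hJ, ae_map_iff (hrm.prodMk measurable_snd).aemeasurable hset]
      exact ae_of_all _ fun q => rfl
    exact ae_of_ae_map hYW.aemeasurable (Measure.ae_ae_of_ae_compProd h1)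
  · -- An event `D` of the given space enters through the density of the law of `(Y, W)` on `D`.
    set ρ := (P.restrict D).map fun ω => (Y ω, W ω) with hρ
    have hρR : ρ ≪ R := (Measure.absolutelyContinuous_of_le Measure.restrict_le_self).map hYW
    set g : 𝒴 × PathSpace T K → ℝ := fun z => (ρ.rnDeriv R z).toReal with hg
    have hgm : Measurable g := (Measure.measurable_rnDeriv _ _).ennreal_toReal
    have hgR : ∀ᵐ z ∂(R), ENNReal.ofReal (g z) = ρ.rnDeriv R z := by
      filter_upwards [Measure.rnDeriv_lt_top ρ R] with z hz
      exact ENNReal.ofReal_toReal hz.ne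
    have hwd : R.withDensity (ρ.rnDeriv R) = ρ := Measure.withDensity_rnDeriv_eq ρ R hρR
    have hκm : Measurable fun z => κ z G := κ.measurable_coe hG
    have hsm : ∀ k, MeasurableSet {z : 𝒴 × PathSpace T K | f.delaySol (h k) z.1 z.2 ∈ G} :=
      fun k => f.measurable_delaySol (h k) hG
    have hlim := tendsto_lintegral_of_tendsto_measure (R := R)
      (μ := fun k => R.restrict {z | f.delaySol (h k) z.1 z.2 ∈ G})
      (ν := R.withDensity fun z => κ z G) (fun k => Measure.restrict_le_self)
      (fun D' hD' => by
        have h1 := hst D' hD' G hG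
        have h2 : (R.withDensity fun z => κ z G) D' = (R ⊗ₘ κ) (D' ×ˢ G) := by
          rw [withDensity_apply _ hD', Measure.compProd_apply_prod hD' hG]
        rw [h2, hJ, Measure.map_apply (hrm.prodMk measurable_snd) (hD'.prod hG)]
        refine h1.congr fun k => ?_
        rw [Measure.restrict_apply hD', hR, Measure.map_apply hYW (hD'.inter (hsm k))]
        rfl) hgm (fun z => ENNReal.toReal_nonneg) (by
        rw [lintegral_congr_ae hgR, Measure.lintegral_rnDeriv hρR]
        exact measure_ne_top _ _)
    have e1 : ∀ k, ∫⁻ z, ENNReal.ofReal (g z) ∂(R.restrict {z | f.delaySol (h k) z.1 z.2 ∈ G}) =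
        P (D ∩ {ω | f.delaySol (h k) (Y ω) (W ω) ∈ G}) := by
      intro k
      rw [lintegral_congr_ae (ae_restrict_of_ae hgR), ← withDensity_apply _ (hsm k), hwd, hρ,
        Measure.map_apply hYW (hsm k), Measure.restrict_apply (hYW (hsm k)), inter_comm]
      rfl
    have e2 : ∫⁻ z, ENNReal.ofReal (g z) ∂(R.withDensity fun z => κ z G) =
        ∫⁻ ω in D, κ (Y ω, W ω) G ∂P := by
      rw [lintegral_withDensity_eq_lintegral_mul _ hκm hgm.ennreal_ofReal]
      rw [← lintegral_map (f := fun z => κ z G) (μ := P.restrict D) hκm hYW]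
      change _ = ∫⁻ z, κ z G ∂ρ
      rw [← hwd, lintegral_withDensity_eq_lintegral_mul _ (Measure.measurable_rnDeriv _ _) hκm]
      refine lintegral_congr_ae ?_
      filter_upwards [hgR] with z hz
      simp only [Pi.mul_apply, hz, mul_comm]
    simpa only [e1, e2] using hlim

end Stable


/-! ### Independence on extensions, under conditional laws, and in the limit -/

section Indep

variable {Ω : Type*}

lemma measurable_eventually_of_aestronglyMeasurable {m mΩ : MeasurableSpace Ω} {P : Measure Ω}
    {F : Type*}
    [TopologicalSpace F] [TopologicalSpace.PseudoMetrizableSpace F] [MeasurableSpace F]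
    [BorelSpace F] {g : Ω → F} (hg : AEStronglyMeasurable[m] g P) :
    Measurable[eventuallyMeasurableSpace m (ae P)] g := by
  obtain ⟨g', hg', h⟩ := hg
  exact Measurable.eventuallyMeasurable_of_eventuallyEq hg'.measurable h

/-- Independence is insensitive to the completion of a `σ`-field. -/
lemma indep_eventually {m₁ m₂ mΩ : MeasurableSpace Ω} {P : Measure Ω} (h : Indep m₁ m₂ P) :
    Indep m₁ (eventuallyMeasurableSpace m₂ (ae P)) P := by
  rw [Indep_iff] at h ⊢
  rintro A B hA ⟨B', hB', hBB'⟩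
  rw [measure_congr hBB', measure_congr ((ae_eq_refl A).inter hBB')]
  exact h A B' hA hB'

/-- Restriction of the law of `ξ` to an independent event. -/
lemma indep_iff_map_restrict {m mΩ : MeasurableSpace Ω} {P : Measure Ω} {F : Type*}
    [MeasurableSpace F] {ξ : Ω → F} (hξ : Measurable ξ) :
    Indep (MeasurableSpace.comap ξ inferInstance) m P ↔
      ∀ A, MeasurableSet[m] A → (P.restrict A).map ξ = P A • P.map ξ := by
  rw [Indep_iff]
  refine ⟨fun h A hA => ?_, fun h => ?_⟩
  · ext C hC
    rw [Measure.map_apply hξ hC, Measure.restrict_apply (hξ hC), h _ A ⟨C, hC, rfl⟩ hA,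
      Measure.smul_apply, Measure.map_apply hξ hC, smul_eq_mul, mul_comm]
  · rintro _ A ⟨C, hC, rfl⟩ hA
    have h1 := congrArg (fun μ : Measure F => μ C) (h A hA)
    simp only [Measure.smul_apply, smul_eq_mul] at h1
    rwa [Measure.map_apply hξ hC, Measure.restrict_apply (hξ hC), Measure.map_apply hξ hC,
      mul_comm] at h1

/-- Conditionally on `S`, the independence of `ξ(Z)` from `(S, η(Z))` becomes the independence of
`ξ(Z)` from `η(Z)`, and the law of `ξ(Z)` does not change. -/
lemma ae_condDistrib_indep {mΩ : MeasurableSpace Ω} {P : Measure Ω} [IsProbabilityMeasure P]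
    {𝒵 𝒳 𝒰 𝒱 : Type*} [MeasurableSpace 𝒵]
    [MeasurableSpace 𝒳] [StandardBorelSpace 𝒳] [Nonempty 𝒳] [MeasurableSpace 𝒰]
    [MeasurableSpace 𝒱] [MeasurableSpace.CountablyGenerated 𝒰]
    [MeasurableSpace.CountablyGenerated 𝒱] {S : Ω → 𝒵} (hS : Measurable S) {Z : Ω → 𝒳}
    (hZ : Measurable Z) {ξ : 𝒳 → 𝒰} (hξ : Measurable ξ) {η : 𝒳 → 𝒱} (hη : Measurable η)
    (h : IndepFun (fun ω => ξ (Z ω)) (fun ω => (S ω, η (Z ω))) P) :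
    ∀ᵐ s ∂(P.map S), IndepFun ξ η (condDistrib Z S P s) ∧
      (condDistrib Z S P s).map ξ = P.map fun ω => ξ (Z ω) := by
  set κ := condDistrib Z S P with hκ
  set ν := P.map fun ω => ξ (Z ω) with hν
  have hξZ : Measurable fun ω => ξ (Z ω) := hξ.comp hZ
  have : IsProbabilityMeasure ν := Measure.isProbabilityMeasure_map hξZ.aemeasurable
  have : IsProbabilityMeasure (P.map S) := Measure.isProbabilityMeasure_map hS.aemeasurable
  have hJ : P.map S ⊗ₘ κ = P.map fun ω => (S ω, Z ω) :=
    compProd_map_condDistrib hZ.aemeasurable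
  have hp : Measurable fun z => (ξ z, η z) := hξ.prodMk hη
  have hηm : IsMarkovKernel (κ.map η) := Kernel.IsMarkovKernel.map κ hη
  have hpm : IsMarkovKernel (κ.map fun z => (ξ z, η z)) := Kernel.IsMarkovKernel.map κ hp
  have key : κ.map (fun z => (ξ z, η z)) =ᵐ[P.map S] (Kernel.const 𝒵 ν) ×ₖ (κ.map η) := by
    refine Kernel.ae_eq_of_compProd_eq (Measure.ext_prod₃ fun {s t u} hs ht hu => ?_)
    rw [Measure.compProd_map hp, hJ, Measure.map_map (measurable_id.prodMap hp) (hS.prodMk hZ),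
      Measure.map_apply ((measurable_id.prodMap hp).comp (hS.prodMk hZ)) (hs.prod (ht.prod hu)),
      Measure.compProd_apply_prod hs (ht.prod hu)]
    simp only [Kernel.prod_apply, Kernel.const_apply, Measure.prod_prod]
    rw [lintegral_const_mul _ (Kernel.measurable_coe _ hu), ← Measure.compProd_apply_prod hs hu,
      Measure.compProd_map hη, hJ, Measure.map_map (measurable_id.prodMap hη) (hS.prodMk hZ),
      Measure.map_apply ((measurable_id.prodMap hη).comp (hS.prodMk hZ)) (hs.prod hu),
      hν, Measure.map_apply hξZ ht]
    have h1 := h.measure_inter_preimage_eq_mul t (s ×ˢ u) ht (hs.prod hu)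
    rw [← mul_comm, mul_comm]
    refine Eq.trans ?_ h1
    congr 1
    ext ω
    simp only [Function.comp_apply, mem_preimage, Prod.map_apply, mem_prod, mem_inter_iff, id]
    tauto
  filter_upwards [key] with s hs
  rw [Kernel.map_apply _ hp, Kernel.prod_apply, Kernel.const_apply, Kernel.map_apply _ hη] at hs
  have h2 : (κ s).map ξ = ν := by
    have h3 := congrArg Measure.fst hs
    have := Measure.isProbabilityMeasure_map (μ := κ s) hη.aemeasurable
    rwa [Measure.fst_map_prodMk hη, Measure.fst_prod] at h3
  refine ⟨?_, h2⟩
  rw [indepFun_iff_map_prod_eq_prod_map_map hξ.aemeasurable hη.aemeasurable, h2, hs]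

/-- Independence passes to the stable limit: if the noise `ξ` is independent of `𝒢` and the
processes `Φ_k` are `𝒢`-measurable up to time `t`, then `ξ` is independent of `𝒢` and of the
limiting process up to time `t`. -/
lemma indep_of_tendsto {𝒢 mΩ : MeasurableSpace Ω} {P : Measure Ω} [IsProbabilityMeasure P]
    {T : ℝ≥0} {F : Type*} [TopologicalSpace F]
    [PolishSpace F] [MeasurableSpace F] [BorelSpace F] {η : Kernel Ω (PathSpace T F)}
    [IsMarkovKernel η] {Φ : ℕ → Ω → PathSpace T F}
    (hlim : ∀ D, MeasurableSet D → ∀ G, MeasurableSet G →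
      Tendsto (fun k => P (D ∩ Φ k ⁻¹' G)) atTop (𝓝 ((P ⊗ₘ η) (D ×ˢ G))))
    (h𝒢 : 𝒢 ≤ mΩ) {U : Type*} [MeasurableSpace U] {ξ : Ω → U}
    (hξ : Measurable[mΩ] ξ) (hind : Indep (MeasurableSpace.comap ξ inferInstance) 𝒢 P) {t : Time T}
    (hΦ : ∀ k, ∀ r ≤ t, Measurable[eventuallyMeasurableSpace 𝒢 (ae P)] fun ω => Φ k ω r) :
    Indep (MeasurableSpace.comap (fun q : Ω × PathSpace T F => ξ q.1) inferInstance)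
      (MeasurableSpace.comap Prod.fst 𝒢 ⊔ generated Prod.snd t) (P ⊗ₘ η) := by
  have hsnd : generated (Prod.snd : Ω × PathSpace T F → PathSpace T F) t =
      MeasurableSpace.comap Prod.snd (generated (id : PathSpace T F → PathSpace T F) t) := by
    rw [← comap_stopAt, ← comap_stopAt, MeasurableSpace.comap_comp]
    rfl
  have hgen : generated (id : PathSpace T F → PathSpace T F) t ≤
      (inferInstance : MeasurableSpace (PathSpace T F)) := by
    rw [← comap_stopAt]
    exact (measurable_stopAt t).comap_le
  rw [hsnd]
  change Indep _ (@Prod.instMeasurableSpace _ _ 𝒢 (generated id t)) _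
  have hfst : Measurable (Prod.fst : Ω × PathSpace T F → Ω) := measurable_fst
  refine IndepSets.indep (p1 := {A | MeasurableSet[MeasurableSpace.comap
    (fun q : Ω × PathSpace T F => ξ q.1) inferInstance] A}) ((hξ.comp hfst).comap_le) ?_
    (@MeasurableSpace.isPiSystem_measurableSet _ (_))
    (@isPiSystem_prod _ _ 𝒢 (generated id t))
    (@MeasurableSpace.generateFrom_measurableSet _ (_)).symm
    (@generateFrom_prod _ _ 𝒢 (generated id t)).symm ?_
  · exact sup_le ((MeasurableSpace.comap_mono h𝒢).trans measurable_fst.comap_le)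
      ((MeasurableSpace.comap_mono hgen).trans measurable_snd.comap_le)
  rw [IndepSets_iff]
  rintro _ _ ⟨C, hC, rfl⟩ ⟨A, hA, G, hG, rfl⟩
  have hA' : MeasurableSet[𝒢] A := hA
  have hG' : MeasurableSet[generated (id : PathSpace T F → PathSpace T F) t] G := hG
  have hAm : MeasurableSet[mΩ] A := h𝒢 _ hA'
  have hGm : MeasurableSet G := hgen _ hG'
  have hξC : MeasurableSet (ξ ⁻¹' C) := hξ hC
  have e : (fun q : Ω × PathSpace T F => ξ q.1) ⁻¹' C ∩ A ×ˢ G = (ξ ⁻¹' C ∩ A) ×ˢ G := by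
    ext q; simp [and_assoc]
  have e2 : (P ⊗ₘ η) ((fun q : Ω × PathSpace T F => ξ q.1) ⁻¹' C) = P (ξ ⁻¹' C) := by
    change (P ⊗ₘ η) (Prod.fst ⁻¹' (ξ ⁻¹' C)) = _
    rw [← Measure.fst_apply hξC, Measure.fst_compProd]
  rw [e, e2]
  refine tendsto_nhds_unique (hlim _ (hξC.inter hAm) G hGm) ?_
  refine (ENNReal.Tendsto.const_mul (hlim A hAm G hGm) (Or.inr (measure_ne_top P _))).congr
    fun k => ?_
  rw [inter_assoc]
  refine ((Indep_iff _ _ _).1 (indep_eventually hind) _ _ ⟨C, hC, rfl⟩ ?_).symm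
  rw [← comap_stopAt] at hG'
  obtain ⟨G', hG'm, rfl⟩ := hG'
  refine MeasurableSet.inter (le_eventuallyMeasurableSpace _ hA') ?_
  exact measurable_stopAt_iff.2 (hΦ k) hG'm

end Indep

section Times

variable {T : ℝ≥0} {K : Type*} [NormedAddCommGroup K] [InnerProductSpace ℝ K]
  [FiniteDimensional ℝ K] [MeasurableSpace K] [BorelSpace K]
variable {Ω : Type*} {mΩ : MeasurableSpace Ω} {P : Measure Ω} [IsProbabilityMeasure P]

lemma gaussianIncr_zero : gaussianIncr K 0 = Measure.dirac 0 := by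
  simp [gaussianIncr, Measure.map_const]

lemma tendsto_lintegral_gaussianIncr (g : BoundedContinuousFunction K ℝ≥0) {δ : ℕ → ℝ} {δ₀ : ℝ}
    (hδ : Tendsto δ atTop (𝓝 δ₀)) :
    Tendsto (fun k => ∫⁻ x, g x ∂(gaussianIncr K (δ k))) atTop
      (𝓝 (∫⁻ x, g x ∂(gaussianIncr K δ₀))) := by
  have hg : Measurable fun x => (g x : ℝ≥0∞) := g.continuous.measurable.coe_nnreal_ennreal
  simp only [gaussianIncr]
  have e : ∀ δ : ℝ, ∫⁻ x, g x ∂((stdGaussian K).map fun x => √δ • x) =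
      ∫⁻ x, g (√δ • x) ∂(stdGaussian K) := fun δ =>
    lintegral_map hg (measurable_const_smul (√δ))
  simp only [e]
  refine tendsto_lintegral_of_dominated_convergence (fun _ => ((nndist g 0 : ℝ≥0) : ℝ≥0∞))
    (fun k => hg.comp (measurable_const_smul _)) (fun k => ae_of_all _ fun x => ?_) ?_
    (ae_of_all _ fun x => ?_)
  · exact ENNReal.coe_le_coe.2 (BoundedContinuousFunction.NNReal.upper_bound g _)
  · simp
  · refine ENNReal.tendsto_coe.2 ((g.continuous.tendsto _).comp ?_)
    exact ((Real.continuous_sqrt.tendsto _).comp hδ).smul_const x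

/-- It suffices to know the increments of a Brownian motion along a dense set of times. -/
lemma indep_and_law_of_dense {𝔾 : Time T → MeasurableSpace Ω} (hmono : Monotone 𝔾)
    {V : Ω → PathSpace T K} (hV : Measurable V) {D : Set (Time T)}
    (hD : Dense D)
    (h : ∀ r ∈ D, ∀ q ∈ D, r < q →
      Indep (MeasurableSpace.comap (fun ω => V ω q - V ω r) inferInstance) (𝔾 r) P ∧
      P.map (fun ω => V ω q - V ω r) = gaussianIncr K (q - r)) {s t : Time T} (hst : s ≤ t) :
    Indep (MeasurableSpace.comap (fun ω => V ω t - V ω s) inferInstance) (𝔾 s) P ∧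
      P.map (fun ω => V ω t - V ω s) = gaussianIncr K (t - s) := by
  have hm : ∀ r q, Measurable fun ω => V ω q - V ω r := fun r q =>
    ((measurable_eval q).comp hV).sub ((measurable_eval r).comp hV)
  rcases hst.eq_or_lt with rfl | hlt
  · simp only [sub_self, gaussianIncr_zero]
    refine ⟨?_, by simp [Measure.map_const]⟩
    rw [MeasurableSpace.comap_const]
    exact indep_bot_left _
  have key : ∀ A, MeasurableSet[𝔾 s] A →
      (P.restrict A).map (fun ω => V ω t - V ω s) = P A • gaussianIncr K (t - s) := by
    intro A hA
    obtain ⟨m, hm1, hm2⟩ := exists_between hlt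
    obtain ⟨r, -, hr, hrs⟩ := hD.exists_seq_strictAnti_tendsto_of_lt hm1
    obtain ⟨q, -, hq, hqt⟩ := hD.exists_seq_strictMono_tendsto_of_lt hm2
    have hfin : IsFiniteMeasure ((P.restrict A).map fun ω => V ω t - V ω s) := inferInstance
    refine ext_of_forall_lintegral_eq_of_IsFiniteMeasure fun g => ?_
    have hg : Measurable fun x => (g x : ℝ≥0∞) := g.continuous.measurable.coe_nnreal_ennreal
    have hk : ∀ k, ∫⁻ ω in A, g (V ω (q k) - V ω (r k)) ∂P =
        P A * ∫⁻ x, g x ∂(gaussianIncr K (q k - r k)) := by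
      intro k
      have hrk := (hr k).1.1
      obtain ⟨h1, h2⟩ := h (r k) (hr k).2 (q k) (hq k).2 ((hr k).1.2.trans (hq k).1.1)
      have h3 := (indep_iff_map_restrict (hm _ _)).1 h1 A (hmono hrk.le _ hA)
      rw [← lintegral_map hg (hm (r k) (q k)), h3, lintegral_smul_measure, h2, smul_eq_mul]
    rw [lintegral_map hg (hm s t), lintegral_smul_measure, smul_eq_mul]
    have hl1 : Tendsto (fun k => ∫⁻ ω in A, g (V ω (q k) - V ω (r k)) ∂P) atTop
        (𝓝 (∫⁻ ω in A, g (V ω t - V ω s) ∂P)) := by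
      refine tendsto_lintegral_of_dominated_convergence (fun _ => ((nndist g 0 : ℝ≥0) : ℝ≥0∞))
        (fun k => hg.comp (hm _ _)) (fun k => ae_of_all _ fun x => ?_) ?_
        (ae_of_all _ fun ω => ?_)
      · exact ENNReal.coe_le_coe.2 (BoundedContinuousFunction.NNReal.upper_bound g _)
      · rw [lintegral_const]
        exact ENNReal.mul_ne_top ENNReal.coe_ne_top (measure_ne_top _ _)
      · refine ENNReal.tendsto_coe.2 ((g.continuous.tendsto _).comp ?_)
        exact (((V ω).continuous.tendsto t).comp hqt).sub (((V ω).continuous.tendsto s).comp hrs)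
    simp only [hk] at hl1
    refine tendsto_nhds_unique hl1 (ENNReal.Tendsto.const_mul (tendsto_lintegral_gaussianIncr g ?_)
      (Or.inr (measure_ne_top P _)))
    exact ((continuous_subtype_val.tendsto t).comp hqt).sub
      ((continuous_subtype_val.tendsto s).comp hrs)
  have hlaw : P.map (fun ω => V ω t - V ω s) = gaussianIncr K (t - s) := by
    have h1 := key univ MeasurableSet.univ
    rwa [Measure.restrict_univ, measure_univ, one_smul] at h1
  exact ⟨(indep_iff_map_restrict (hm s t)).2 fun A hA => by rw [key A hA, hlaw], hlaw⟩

end Times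


/-! ### The noise of all players as one Brownian motion -/

section Noise

/-- The space `(ℝ^d)^n` with its Euclidean norm. -/
abbrev Noise (d n : ℕ) := PiLp 2 fun _ : Fin n => E d

variable {T : ℝ≥0} {d n : ℕ}

/-- A family of paths as one path in the product space. -/
def bundle (w : Fin n → PathSpace T (E d)) : PathSpace T (Noise d n) where
  toFun t := WithLp.toLp 2 fun i => w i t
  continuous_toFun := by fun_prop

@[simp] lemma bundle_apply (w : Fin n → PathSpace T (E d)) (t : Time T) (i : Fin n) :
    bundle w t i = w i t := rfl

lemma measurable_toLp_iff {Ω : Type*} {m : MeasurableSpace Ω} {u : Ω → Fin n → E d} :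
    Measurable (fun ω => WithLp.toLp 2 (u ω) : Ω → Noise d n) ↔ Measurable u :=
  ⟨fun h => (WithLp.measurable_ofLp 2 _).comp h, fun h => (WithLp.measurable_toLp 2 _).comp h⟩

lemma measurable_bundle_apply {Ω : Type*} {m : MeasurableSpace Ω}
    {w : Ω → Fin n → PathSpace T (E d)} {t : Time T} :
    Measurable (fun ω => bundle (w ω) t) ↔ ∀ i, Measurable fun ω => w ω i t :=
  measurable_toLp_iff.trans measurable_pi_iff

lemma measurable_bundle : Measurable (bundle : (Fin n → PathSpace T (E d)) → _) :=
  measurable_path_iff.2 fun t => measurable_bundle_apply.2 fun i =>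
    (measurable_eval t).comp (measurable_pi_apply i)

lemma comap_toLp {Ω : Type*} (u : Ω → Fin n → E d) :
    MeasurableSpace.comap (fun ω => WithLp.toLp 2 (u ω) : Ω → Noise d n) inferInstance =
      MeasurableSpace.comap u inferInstance :=
  le_antisymm (measurable_iff_comap_le.1 (measurable_toLp_iff.2 (comap_measurable u)))
    (measurable_iff_comap_le.1 (measurable_toLp_iff.1 (comap_measurable _)))

lemma bundle_sub_apply (w : Fin n → PathSpace T (E d)) (s t : Time T) :
    bundle w t - bundle w s = WithLp.toLp 2 fun i => w i t - w i s := rfl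

lemma charFun_multivariateGaussian_smul_one {δ : ℝ} (hδ : 0 ≤ δ) (x : E d) :
    charFun (multivariateGaussian 0 (δ • (1 : Matrix (Fin d) (Fin d) ℝ))) x =
      Complex.exp (-(δ * ‖x‖ ^ 2 / 2 : ℝ)) := by
  rw [charFun_multivariateGaussian (Matrix.PosSemidef.one.smul hδ)]
  congr 1
  have h : ‖x‖ ^ 2 = x.ofLp ⬝ᵥ x.ofLp := by
    rw [EuclideanSpace.real_norm_sq_eq, dotProduct]
    exact Finset.sum_congr rfl fun i _ => by ring
  rw [h]
  simp [Matrix.smul_mulVec]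

lemma map_toLp_pi_multivariateGaussian {δ : ℝ} (hδ : 0 ≤ δ) :
    (Measure.pi fun _ : Fin n => multivariateGaussian 0
      (δ • (1 : Matrix (Fin d) (Fin d) ℝ))).map (WithLp.toLp 2) = gaussianIncr (Noise d n) δ := by
  have : IsProbabilityMeasure ((Measure.pi fun _ : Fin n => multivariateGaussian 0
      (δ • (1 : Matrix (Fin d) (Fin d) ℝ))).map (WithLp.toLp 2)) :=
    Measure.isProbabilityMeasure_map (WithLp.measurable_toLp 2 _).aemeasurable
  refine Measure.ext_of_charFun (funext fun x => ?_)
  rw [charFun_pi, gaussianIncr, charFun_map_smul, charFun_stdGaussian]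
  simp_rw [charFun_multivariateGaussian_smul_one hδ]
  rw [← Complex.exp_sum]
  congr 1
  have h : ‖√δ • x‖ ^ 2 = ∑ i, δ * ‖x i‖ ^ 2 := by
    rw [norm_smul, Real.norm_of_nonneg (Real.sqrt_nonneg _), mul_pow, Real.sq_sqrt hδ,
      PiLp.norm_sq_eq_of_L2, Finset.mul_sum]
  rw [← Complex.ofReal_pow, h]
  push_cast
  rw [← Finset.sum_neg_distrib, Finset.sum_div]
  exact Finset.sum_congr rfl fun i _ => by ring

lemma map_bundle_sub_iff {Ω : Type*} {mΩ : MeasurableSpace Ω} {P : Measure Ω}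
    {w : Ω → Fin n → PathSpace T (E d)} (hw : Measurable w) {s t : Time T} (hst : s ≤ t) :
    P.map (fun ω => bundle (w ω) t - bundle (w ω) s) = gaussianIncr (Noise d n) (t - s) ↔
      HasLaw (fun ω i => w ω i t - w ω i s) (Measure.pi fun _ : Fin n => multivariateGaussian 0
        (((t : ℝ) - (s : ℝ)) • (1 : Matrix (Fin d) (Fin d) ℝ))) P := by
  have hst' : 0 ≤ (t : ℝ) - s := sub_nonneg.2 hst
  have hm : Measurable fun ω i => w ω i t - w ω i s := measurable_pi_iff.2 fun i =>
    ((measurable_eval t).comp ((measurable_pi_apply i).comp hw)).sub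
      ((measurable_eval s).comp ((measurable_pi_apply i).comp hw))
  rw [← map_toLp_pi_multivariateGaussian hst']
  have e : P.map (fun ω => bundle (w ω) t - bundle (w ω) s) =
      (P.map fun ω i => w ω i t - w ω i s).map (MeasurableEquiv.toLp 2 (Fin n → E d)) := by
    rw [Measure.map_map (MeasurableEquiv.measurable _) hm]
    rfl
  rw [e]
  refine ⟨fun h => ⟨hm.aemeasurable, ?_⟩, fun h => by rw [h.map_eq]; rfl⟩
  exact (MeasurableEquiv.toLp 2 (Fin n → E d)).map_measurableEquiv_injective h

lemma map_pi_some {ι F : Type*} [Fintype ι] [MeasurableSpace F] (ν : Measure F)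
    [IsProbabilityMeasure ν] :
    (Measure.pi fun _ : Option ι => ν).map (fun x i => x (some i)) = Measure.pi fun _ : ι => ν := by
  have hm : Measurable fun (x : Option ι → F) (i : ι) => x (some i) := by fun_prop
  refine (Measure.pi_eq fun s hs => ?_).symm
  rw [Measure.map_apply hm (MeasurableSet.univ_pi hs)]
  have e : (fun (x : Option ι → F) (i : ι) => x (some i)) ⁻¹' (univ.pi s) =
      univ.pi fun o : Option ι => o.elim univ s := by
    ext x
    simp [Set.mem_pi, Option.forall]
  rw [e, Measure.pi_pi, Fintype.prod_option]
  simp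

end Noise

/-! ### The drift of the players as a causal functional -/

section Model

variable {T : ℝ≥0} {d n : ℕ} [NeZero n] {p : ℝ≥0}

lemma tendsto_cost (x : E d) : Tendsto (fun x' => cost p x x') (𝓝 x) (𝓝 0) := by
  have h1 : Tendsto (fun x' : E d => edist x x') (𝓝 x) (𝓝 0) := by
    have := (continuous_const.edist continuous_id : Continuous fun x' : E d => edist x x').tendsto x
    simpa using this
  unfold cost
  split_ifs with hp
  · have := (tendsto_const_nhds (x := (1 : ℝ≥0∞))).min h1
    simpa using this
  · have h2 := h1.ennrpow_const (p : ℝ)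
    rwa [ENNReal.zero_rpow_of_pos (by positivity)] at h2

/-- The diagonal coupling bounds the distance of two empirical measures. -/
lemma wasserstein_empirical_le (x x' : Fin n → E d) :
    wasserstein p (empirical p x).1 (empirical p x').1 ≤
      ((n : ℝ≥0∞)⁻¹ * ∑ k, cost p (x k) (x' k)) ^ (1 / max 1 (p : ℝ)) := by
  unfold wasserstein
  refine ENNReal.rpow_le_rpow ?_ (by positivity)
  have hcost : Measurable fun z : E d × E d => cost p z.1 z.2 := by
    unfold cost
    split_ifs
    · exact measurable_const.min measurable_edist
    · exact measurable_edist.pow_const _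
  set π : Measure (E d × E d) := (n : ℝ≥0∞)⁻¹ • ∑ k, Measure.dirac (x k, x' k) with hπ
  have hmap : ∀ g : E d × E d → E d, Measurable g →
      π.map g = (n : ℝ≥0∞)⁻¹ • ∑ k, Measure.dirac (g (x k, x' k)) := by
    intro g hg
    rw [hπ, Measure.map_smul, ← Measure.mapₗ_apply_of_measurable hg, map_sum]
    simp only [Measure.mapₗ_apply_of_measurable hg, Measure.map_dirac' hg]
  have hcpl : π ∈ couplings (empirical p x).1 (empirical p x').1 :=
    ⟨hmap _ measurable_fst, hmap _ measurable_snd⟩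
  refine (iInf₂_le π hcpl).trans (le_of_eq ?_)
  · rw [hπ, lintegral_smul_measure, lintegral_finsetSum_measure, smul_eq_mul]
    congr 1
    exact Finset.sum_congr rfl fun k _ => lintegral_dirac' _ hcost

lemma continuous_empirical : Continuous (empirical p : (Fin n → E d) → PSpace p d) := by
  refine continuous_def.2 fun U hU => isOpen_iff_mem_nhds.2 fun x hx => ?_
  obtain ⟨ε, hε, h⟩ := hU _ hx
  have h1 : Tendsto (fun x' : Fin n → E d => (n : ℝ≥0∞)⁻¹ * ∑ k, cost p (x k) (x' k)) (𝓝 x)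
      (𝓝 0) := by
    have h2 : Tendsto (fun x' : Fin n → E d => ∑ k, cost p (x k) (x' k)) (𝓝 x)
        (𝓝 (∑ _k : Fin n, 0)) :=
      tendsto_finsetSum _ fun k _ => (tendsto_cost (x k)).comp ((continuous_apply k).tendsto x)
    have h3 := ENNReal.Tendsto.const_mul (a := (n : ℝ≥0∞)⁻¹) h2
      (Or.inr (ENNReal.inv_ne_top.2 (Nat.cast_ne_zero.2 (NeZero.ne n))))
    simpa using h3
  have hp : (0 : ℝ) < 1 / max 1 (p : ℝ) := by positivity
  have h4 := h1.ennrpow_const (1 / max 1 (p : ℝ))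
  rw [ENNReal.zero_rpow_of_pos hp] at h4
  filter_upwards [h4.eventually_lt_const hε] with x' hx'
  exact h _ ((wasserstein_empirical_le x x').trans_lt hx')

/-- The growth bound of the drift, along empirical measures. -/
lemma IsDrift.exists_norm_empirical_le {A : Type*} [TopologicalSpace A]
    {b : Time T → E d → PSpace p d → A → E d} (hb : IsDrift b) :
    ∃ c : ℝ, 0 < c ∧ ∀ t (x : Fin n → E d) i a, ∀ M : ℝ, (∀ k, ‖x k‖ ≤ M) →
      ‖b t (x i) (empirical p x) a‖ ≤ c * (1 + M) := by
  obtain ⟨c, hc, h⟩ := hb.growth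
  refine ⟨2 * c, by positivity, fun t x i a M hM => (h t _ _ a).trans ?_⟩
  have hM0 : 0 ≤ M := (norm_nonneg _).trans (hM i)
  have h1 : (if 0 < p then ‖x i‖ else 0) ≤ M := by split_ifs; exacts [hM i, hM0]
  have h2 : (if 0 < p then moment p (empirical p x) ^ (1 / max 1 (p : ℝ)) else 0) ≤ 1 + M := by
    split_ifs with hp
    swap; · linarith
    have hp' : (0 : ℝ) < p := by exact_mod_cast hp
    have hn : (n : ℝ) ≠ 0 := Nat.cast_ne_zero.2 (NeZero.ne n)
    have hmom : moment p (empirical p x) = (n : ℝ)⁻¹ * ∑ k, ‖x k‖ ^ (p : ℝ) := by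
      unfold moment empirical
      simp only [ProbabilityMeasure.coe_mk]
      rw [integral_smul_measure, integral_finsetSum_measure]
      · simp
      · exact fun k _ => integrable_dirac (by simp)
    have hmom1 : moment p (empirical p x) ≤ M ^ (p : ℝ) := by
      rw [hmom]
      calc (n : ℝ)⁻¹ * ∑ k, ‖x k‖ ^ (p : ℝ) ≤ (n : ℝ)⁻¹ * ∑ _k : Fin n, M ^ (p : ℝ) := by
            gcongr with k _
            exact hM k
        _ = M ^ (p : ℝ) := by simp [hn]
    have hmom0 : 0 ≤ moment p (empirical p x) := by rw [hmom]; positivity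
    calc moment p (empirical p x) ^ (1 / max 1 (p : ℝ))
        ≤ (M ^ (p : ℝ)) ^ (1 / max 1 (p : ℝ)) := Real.rpow_le_rpow hmom0 hmom1 (by positivity)
      _ = M ^ (p / max 1 (p : ℝ)) := by rw [← Real.rpow_mul hM0]; ring_nf
      _ ≤ (1 + M) ^ (p / max 1 (p : ℝ)) :=
          Real.rpow_le_rpow hM0 (by linarith) (by positivity)
      _ ≤ (1 + M) ^ (1 : ℝ) := Real.rpow_le_rpow_of_exponent_le (by linarith)
          ((div_le_one (by positivity)).2 (le_max_right _ _))
      _ = 1 + M := Real.rpow_one _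
  nlinarith [mul_le_mul_of_nonneg_left (add_le_add h1 h2) hc.le]

variable {A : Type*} [MetricSpace A] [CompactSpace A] [MeasurableSpace A] [BorelSpace A]
  {b : Time T → E d → PSpace p d → A → E d}
  {𝒮 : Type*} [TopologicalSpace 𝒮] [PolishSpace 𝒮] [MeasurableSpace 𝒮] [BorelSpace 𝒮]
  {α : Fin n → Time T → (Fin n → PathSpace T (E d)) → PathSpace T 𝒮 → A}

lemma IsDrift.measurable_playerDrift (hb : IsDrift b) (hα : ∀ i, IsControl (α i)) (i : Fin n) :
    Measurable fun q : Time T × (Fin n → PathSpace T (E d)) × PathSpace T 𝒮 =>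
      playerDrift b α i q.2.1 q.2.2 q.1 := by
  have h1 : Measurable (Function.uncurry fun (z : (Fin n → E d) × A) (t : Time T) =>
      b t (z.1 i) (empirical p z.1) z.2) := by
    refine measurable_uncurry_of_continuous_of_measurable (fun t => ?_) fun z => hb.measurable _ _ _
    exact (hb.continuous t).comp (((continuous_apply i).comp continuous_fst).prodMk
      ((continuous_empirical.comp continuous_fst).prodMk continuous_snd))
  have h2 : Measurable fun q : Time T × (Fin n → PathSpace T (E d)) × PathSpace T 𝒮 =>
      fun k => q.2.1 k q.1 := by
    refine measurable_pi_iff.2 fun k => ?_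
    have h3 : Measurable fun q : Time T × (Fin n → PathSpace T (E d)) × PathSpace T 𝒮 =>
        (q.2.1 k, q.1) :=
      ((measurable_pi_apply k).comp (measurable_fst.comp measurable_snd)).prodMk measurable_fst
    exact measurable_path_eval.comp h3
  exact h1.comp ((h2.prodMk (hα i).measurable).prodMk measurable_fst)

lemma playerDrift_congr (hα : ∀ i, IsControl (α i)) (i : Fin n)
    {x x' : Fin n → PathSpace T (E d)} {s s' : PathSpace T 𝒮} {t : Time T}
    (hx : ∀ r ≤ t, ∀ k, x k r = x' k r) (hs : ∀ r ≤ t, s r = s' r) :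
    playerDrift b α i x s t = playerDrift b α i x' s' t := by
  unfold playerDrift
  rw [(hα i).nonanticipative t x x' s s' fun r hr => ⟨hx r hr, hs r hr⟩]
  simp only [hx t le_rfl]

/-- The static parameter of the system: the initial states, and the paths of the signal and of
the common noise. -/
abbrev Param (T : ℝ≥0) (d n : ℕ) (𝒮 : Type*) [TopologicalSpace 𝒮] :=
  (Fin n → E d) × PathSpace T 𝒮 × PathSpace T (E d)

/-- The states `x₀ + L v + Γ β`, as a function of the parameter and of the driving path `v`. -/
def state (L : E d ≃L[ℝ] E d) (Γ : E d →L[ℝ] E d) (y : Param T d n 𝒮)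
    (v : PathSpace T (Noise d n)) (i : Fin n) : PathSpace T (E d) where
  toFun t := y.1 i + L (v t i) + Γ (y.2.2 t)
  continuous_toFun := by fun_prop

/-- The driving path `L⁻¹ (x - x₀ - Γ β)`, as a function of the parameter and of the states. -/
def costate (L : E d ≃L[ℝ] E d) (Γ : E d →L[ℝ] E d) (y : Param T d n 𝒮)
    (x : Fin n → PathSpace T (E d)) : PathSpace T (Noise d n) where
  toFun t := WithLp.toLp 2 fun i => L.symm (x i t - y.1 i - Γ (y.2.2 t))
  continuous_toFun := by fun_prop

variable {L : E d ≃L[ℝ] E d} {Γ : E d →L[ℝ] E d}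

lemma state_apply (y : Param T d n 𝒮) (v : PathSpace T (Noise d n)) (i : Fin n) (t : Time T) :
    state L Γ y v i t = y.1 i + L (v t i) + Γ (y.2.2 t) := rfl

lemma costate_apply (y : Param T d n 𝒮) (x : Fin n → PathSpace T (E d)) (t : Time T) (i : Fin n) :
    costate L Γ y x t i = L.symm (x i t - y.1 i - Γ (y.2.2 t)) := rfl

lemma state_costate (y : Param T d n 𝒮) (x : Fin n → PathSpace T (E d)) :
    state L Γ y (costate L Γ y x) = x := by
  ext1 i; ext1 t
  rw [state_apply, costate_apply, ContinuousLinearEquiv.apply_symm_apply]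
  abel

lemma measurable_state_apply {Ω : Type*} {m : MeasurableSpace Ω} {Y : Ω → Param T d n 𝒮}
    {V : Ω → PathSpace T (Noise d n)} {t : Time T} (h0 : Measurable fun ω => (Y ω).1)
    (hβ : Measurable fun ω => (Y ω).2.2 t) (hV : Measurable fun ω => V ω t) (i : Fin n) :
    Measurable fun ω => state L Γ (Y ω) (V ω) i t := by
  have hVi : Measurable fun ω => V ω t i :=
    (measurable_pi_apply i).comp ((WithLp.measurable_ofLp 2 _).comp hV)
  exact (((measurable_pi_apply i).comp h0).add (L.continuous.measurable.comp hVi)).add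
    (Γ.continuous.measurable.comp hβ)

lemma measurable_state :
    Measurable fun q : Param T d n 𝒮 × PathSpace T (Noise d n) => state L Γ q.1 q.2 :=
  measurable_pi_iff.2 fun i => measurable_path_iff.2 fun t => measurable_state_apply
    (measurable_fst.comp measurable_fst)
    ((measurable_eval t).comp (measurable_snd.comp (measurable_snd.comp measurable_fst)))
    ((measurable_eval t).comp measurable_snd) i

lemma measurable_costate_apply {Ω : Type*} {m : MeasurableSpace Ω} {Y : Ω → Param T d n 𝒮}
    {X : Ω → Fin n → PathSpace T (E d)} {t : Time T} (h0 : Measurable fun ω => (Y ω).1)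
    (hβ : Measurable fun ω => (Y ω).2.2 t) (hX : ∀ i, Measurable fun ω => X ω i t) :
    Measurable fun ω => costate L Γ (Y ω) (X ω) t :=
  measurable_toLp_iff.2 (measurable_pi_iff.2 fun i => L.symm.continuous.measurable.comp
    (((hX i).sub ((measurable_pi_apply i).comp h0)).sub (Γ.continuous.measurable.comp hβ)))

lemma exists_norm_toLp_le (d n : ℕ) :
    ∃ c : ℝ, 0 < c ∧ ∀ (u : Fin n → E d) (M : ℝ), 0 ≤ M → (∀ i, ‖u i‖ ≤ M) →
      ‖(WithLp.toLp 2 u : Noise d n)‖ ≤ c * M := by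
  refine ⟨√n + 1, by positivity, fun u M hM hu => ?_⟩
  have h1 : ‖(WithLp.toLp 2 u : Noise d n)‖ ≤ √n * M := by
    rw [PiLp.norm_eq_of_L2]
    refine Real.sqrt_le_iff.2 ⟨by positivity, ?_⟩
    rw [mul_pow, Real.sq_sqrt (Nat.cast_nonneg n)]
    calc ∑ i, ‖u i‖ ^ 2 ≤ ∑ _i : Fin n, M ^ 2 := by gcongr with i _; exact hu i
      _ = n * M ^ 2 := by simp
  linarith

end Model


section PlayerFunctional

variable {T : ℝ≥0} {d n : ℕ} [NeZero n] {p : ℝ≥0}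
variable {A : Type*} [MetricSpace A] [CompactSpace A] [MeasurableSpace A] [BorelSpace A]
  {b : Time T → E d → PSpace p d → A → E d}
  {𝒮 : Type*} [TopologicalSpace 𝒮] [PolishSpace 𝒮] [MeasurableSpace 𝒮] [BorelSpace 𝒮]
  {α : Fin n → Time T → (Fin n → PathSpace T (E d)) → PathSpace T 𝒮 → A}

/-- The drift `L⁻¹ b(t, X^i_t, μ^n_t, α^i(t, X, S))` of the equation satisfied by the driving path,
extended by zero outside `[0, T]`. -/
def playerField (b : Time T → E d → PSpace p d → A → E d)
    (α : Fin n → Time T → (Fin n → PathSpace T (E d)) → PathSpace T 𝒮 → A)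
    (L : E d ≃L[ℝ] E d) (Γ : E d →L[ℝ] E d) (r : ℝ) (y : Param T d n 𝒮)
    (v : PathSpace T (Noise d n)) : Noise d n :=
  (Icc (0 : ℝ) T).indicator (fun r => WithLp.toLp 2 fun i =>
    L.symm (playerDrift b α i (state L Γ y v) y.2.1 (projIcc 0 (T : ℝ) T.2 r))) r

variable (L : E d ≃L[ℝ] E d) (Γ : E d →L[ℝ] E d)

lemma playerField_of_mem {r : ℝ} (hr : r ∈ Icc (0 : ℝ) T) (y : Param T d n 𝒮)
    (v : PathSpace T (Noise d n)) (i : Fin n) : playerField b α L Γ r y v i =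
      L.symm (playerDrift b α i (state L Γ y v) y.2.1 (projIcc 0 (T : ℝ) T.2 r)) := by
  rw [playerField, indicator_of_mem hr]

lemma IsDrift.exists_norm_playerField_le (hb : IsDrift b) :
    ∃ C : Param T d n 𝒮 → ℝ, Measurable C ∧ (∀ y, 0 < C y) ∧ ∀ r y v,
      ‖playerField b α L Γ r y v‖ ≤ C y * (1 + ‖v (projIcc 0 (T : ℝ) T.2 r)‖) := by
  obtain ⟨c, hc, h⟩ := hb.exists_norm_empirical_le (n := n)
  obtain ⟨c', hc', h'⟩ := exists_norm_toLp_le d n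
  set Λ : E d →L[ℝ] E d := L.toContinuousLinearMap with hΛ
  set Λ' : E d →L[ℝ] E d := L.symm.toContinuousLinearMap with hΛ'
  refine ⟨fun y => c' * ((‖Λ'‖ + 1) * (c * ((1 + ‖Λ‖) * (1 + ‖y.1‖ + ‖Γ‖ * ‖y.2.2‖)))), ?_,
    fun y => by positivity, fun r y v => ?_⟩
  · have h1 : Measurable fun y : Param T d n 𝒮 => ‖y.1‖ := measurable_fst.norm
    have h2 : Measurable fun y : Param T d n 𝒮 => ‖y.2.2‖ :=
      (measurable_snd.comp measurable_snd).norm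
    exact (((((h1.const_add 1).add (h2.const_mul _)).const_mul _).const_mul c).const_mul
      _).const_mul _
  · by_cases hr : r ∈ Icc (0 : ℝ) T
    swap
    · rw [playerField, indicator_of_notMem hr, norm_zero]
      positivity
    rw [playerField, indicator_of_mem hr]
    set t := projIcc 0 (T : ℝ) T.2 r
    have hM : ∀ k, ‖state L Γ y v k t‖ ≤ ‖y.1‖ + ‖Λ‖ * ‖v t‖ + ‖Γ‖ * ‖y.2.2‖ := by
      intro k
      rw [state_apply]
      refine (norm_add₃_le).trans ?_
      gcongr
      · exact norm_le_pi_norm y.1 k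
      · refine (Λ.le_opNorm _).trans ?_
        gcongr
        exact PiLp.norm_apply_le _ _
      · refine (Γ.le_opNorm _).trans ?_
        gcongr
        exact y.2.2.norm_coe_le_norm t
    have h2 : 1 + (‖y.1‖ + ‖Λ‖ * ‖v t‖ + ‖Γ‖ * ‖y.2.2‖) ≤
        (1 + ‖Λ‖) * (1 + ‖y.1‖ + ‖Γ‖ * ‖y.2.2‖) * (1 + ‖v t‖) := by
      have e : (1 + ‖Λ‖) * (1 + ‖y.1‖ + ‖Γ‖ * ‖y.2.2‖) * (1 + ‖v t‖) =
          1 + (‖y.1‖ + ‖Λ‖ * ‖v t‖ + ‖Γ‖ * ‖y.2.2‖) +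
          (‖v t‖ + (‖y.1‖ + ‖Γ‖ * ‖y.2.2‖) * ‖v t‖ + ‖Λ‖ +
            ‖Λ‖ * (‖y.1‖ + ‖Γ‖ * ‖y.2.2‖) * (1 + ‖v t‖)) := by ring
      rw [e]
      exact le_add_of_nonneg_right (by positivity)
    refine (h' _ ((‖Λ'‖ + 1) * (c * (1 + (‖y.1‖ + ‖Λ‖ * ‖v t‖ + ‖Γ‖ * ‖y.2.2‖))))
      (by positivity) fun i => ?_).trans ?_
    · refine (Λ'.le_opNorm _).trans ?_
      gcongr
      · linarith
      · exact h t (fun k => state L Γ y v k t) i _ _ hM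
    · calc _ ≤ c' * ((‖Λ'‖ + 1) * (c * ((1 + ‖Λ‖) * (1 + ‖y.1‖ + ‖Γ‖ * ‖y.2.2‖) *
            (1 + ‖v t‖)))) := by gcongr
        _ = _ := by ring

/-- Up to time `r`, the drift only depends on the paths up to time `r`. -/
lemma playerField_congr (hα : ∀ i, IsControl (α i)) {r : ℝ} {y y' : Param T d n 𝒮}
    {v v' : PathSpace T (Noise d n)} (h0 : y.1 = y'.1)
    (hs : ∀ t : Time T, (t : ℝ) ≤ r → y.2.1 t = y'.2.1 t)
    (hβ : ∀ t : Time T, (t : ℝ) ≤ r → y.2.2 t = y'.2.2 t)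
    (hv : ∀ t : Time T, (t : ℝ) ≤ r → v t = v' t) :
    playerField b α L Γ r y v = playerField b α L Γ r y' v' := by
  by_cases hr : r ∈ Icc (0 : ℝ) T
  swap
  · rw [playerField, playerField, indicator_of_notMem hr, indicator_of_notMem hr]
  rw [playerField, playerField, indicator_of_mem hr, indicator_of_mem hr]
  have ht : ∀ t : Time T, t ≤ projIcc 0 (T : ℝ) T.2 r → (t : ℝ) ≤ r := fun t h =>
    (Subtype.coe_le_coe.2 h).trans (congrArg Subtype.val (projIcc_of_mem T.2 hr)).le
  congr 1
  ext1 i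
  rw [playerDrift_congr hα i (fun t h k => ?_) fun t h => hs t (ht t h)]
  rw [state_apply, state_apply, h0, hβ t (ht t h), hv t (ht t h)]

/-- The drift of the equation satisfied by the driving path, as a causal functional. -/
def playerFunctional (hb : IsDrift b) (hα : ∀ i, IsControl (α i)) :
    CausalFunctional T (Param T d n 𝒮) (Noise d n) where
  toFun := playerField b α L Γ
  measurable' := by
    have h1 : Measurable fun q : ℝ × Param T d n 𝒮 × PathSpace T (Noise d n) =>
        (projIcc 0 (T : ℝ) T.2 q.1, state L Γ q.2.1 q.2.2, q.2.1.2.1) :=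
      (continuous_projIcc.measurable.comp measurable_fst).prodMk
        ((measurable_state.comp measurable_snd).prodMk (measurable_fst.comp
          (measurable_snd.comp (measurable_fst.comp measurable_snd))))
    have h2 : Measurable fun q : ℝ × Param T d n 𝒮 × PathSpace T (Noise d n) =>
        (WithLp.toLp 2 fun i => L.symm (playerDrift b α i (state L Γ q.2.1 q.2.2) q.2.1.2.1
          (projIcc 0 (T : ℝ) T.2 q.1)) : Noise d n) :=
      measurable_toLp_iff.2 (measurable_pi_iff.2 fun i => L.symm.continuous.measurable.comp
        ((hb.measurable_playerDrift hα i).comp h1))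
    have h3 : MeasurableSet {q : ℝ × Param T d n 𝒮 × PathSpace T (Noise d n) |
        q.1 ∈ Icc (0 : ℝ) T} := measurable_fst measurableSet_Icc
    exact h2.indicator h3
  causal' _ _ _ _ H := playerField_congr L Γ hα rfl (fun _ _ => rfl) (fun _ _ => rfl) H
  bounded' y v := by
    obtain ⟨C, -, hC, h⟩ := hb.exists_norm_playerField_le (α := α) L Γ
    refine ⟨C y * (1 + ‖v‖), fun r => (h r y v).trans ?_⟩
    have := (hC y).le
    gcongr
    exact v.norm_coe_le_norm _

lemma playerFunctional_apply (hb : IsDrift b) (hα : ∀ i, IsControl (α i)) (r : ℝ)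
    (y : Param T d n 𝒮) (v : PathSpace T (Noise d n)) :
    playerFunctional L Γ hb hα r y v = playerField b α L Γ r y v := rfl

lemma exists_isGrowth_playerFunctional (hb : IsDrift b) (hα : ∀ i, IsControl (α i)) :
    ∃ C, (playerFunctional L Γ hb hα).IsGrowth C := by
  obtain ⟨C, hCm, hC, h⟩ := hb.exists_norm_playerField_le (α := α) L Γ
  refine ⟨C, hCm, hC, fun r y v hr => ?_, h⟩
  rw [playerFunctional_apply, playerField, indicator_of_notMem hr]

lemma playerDrift_eq (hb : IsDrift b) (hα : ∀ i, IsControl (α i)) (y : Param T d n 𝒮)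
    (x : Fin n → PathSpace T (E d)) (i : Fin n) {r : ℝ} (hr : r ∈ Icc (0 : ℝ) T) :
    playerDrift b α i x y.2.1 (projIcc 0 (T : ℝ) T.2 r) =
      (L.toContinuousLinearMap.comp (PiLp.proj 2 (fun _ : Fin n => E d) i))
        (playerFunctional L Γ hb hα r y (costate L Γ y x)) := by
  change _ = L (playerField b α L Γ r y (costate L Γ y x) i)
  rw [playerField_of_mem L Γ hr, state_costate, ContinuousLinearEquiv.apply_symm_apply]

lemma intervalIntegrable_playerDrift (hb : IsDrift b) (hα : ∀ i, IsControl (α i))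
    (x : Fin n → PathSpace T (E d)) (s : PathSpace T 𝒮) (i : Fin n) :
    IntervalIntegrable (fun r : ℝ => playerDrift b α i x s (projIcc 0 (T : ℝ) T.2 r))
      volume 0 T := by
  set y : Param T d n 𝒮 := (0, s, 0)
  have h1 := (playerFunctional (ContinuousLinearEquiv.refl ℝ (E d)) 0 hb hα).intervalIntegrable y
    (costate (ContinuousLinearEquiv.refl ℝ (E d)) 0 y x) 0 T
  have h2 := ((ContinuousLinearEquiv.refl ℝ (E d)).toContinuousLinearMap.comp
    (PiLp.proj 2 (fun _ : Fin n => E d) i)).integrable_comp h1.1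
  refine (intervalIntegrable_iff_integrableOn_Ioc_of_le T.2).2 ?_
  refine h2.congr (ae_restrict_of_forall_mem measurableSet_Ioc fun r hr => ?_)
  exact (playerDrift_eq _ 0 hb hα y x i ⟨hr.1.le, hr.2⟩).symm

/-- The system of stochastic differential equations, as an equation for the driving path. -/
lemma residual_costate_eq_bundle_iff (hb : IsDrift b) (hα : ∀ i, IsControl (α i))
    (y : Param T d n 𝒮) (x w : Fin n → PathSpace T (E d)) :
    (playerFunctional L Γ hb hα).residual y (costate L Γ y x) = bundle w ↔
      ∀ i (t : Time T), x i t = y.1 i +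
        (∫ r in (0 : ℝ)..t, playerDrift b α i x y.2.1 (projIcc 0 (T : ℝ) T.2 r)) +
        L (w i t) + Γ (y.2.2 t) := by
  set f := playerFunctional L Γ hb hα
  have key : ∀ i (t : Time T), L (f.primitive y (costate L Γ y x) t i) =
      ∫ r in (0 : ℝ)..t, playerDrift b α i x y.2.1 (projIcc 0 (T : ℝ) T.2 r) := by
    intro i t
    have h1 := ((L.toContinuousLinearMap).comp
      (PiLp.proj 2 (fun _ : Fin n => E d) i)).intervalIntegral_comp_comm
      (f.intervalIntegrable y (costate L Γ y x) 0 t)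
    refine h1.symm.trans (intervalIntegral.integral_congr_ae (ae_of_all _ fun r hr => ?_))
    rw [uIoc_of_le t.2.1] at hr
    exact (playerDrift_eq L Γ hb hα y x i ⟨hr.1.le, hr.2.trans t.2.2⟩).symm
  rw [CausalFunctional.residual_eq_iff]
  have h2 : ∀ i (t : Time T), costate L Γ y x t i = w i t + f.primitive y (costate L Γ y x) t i ↔
      x i t = y.1 i + (∫ r in (0 : ℝ)..t, playerDrift b α i x y.2.1 (projIcc 0 (T : ℝ) T.2 r)) +
        L (w i t) + Γ (y.2.2 t) := by
    intro i t
    rw [← L.injective.eq_iff, costate_apply, ContinuousLinearEquiv.apply_symm_apply, map_add,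
      key i t]
    constructor
    · intro h
      rw [sub_eq_iff_eq_add, sub_eq_iff_eq_add] at h
      rw [h]; abel
    · intro h
      rw [h]; abel
  refine ⟨fun h i t => (h2 i t).1 ?_, fun h => ?_⟩
  · have h3 := DFunLike.congr_fun h t
    exact congrArg (fun z : Noise d n => z i) h3
  · ext t i : 2
    exact (h2 i t).2 (h i t)

end PlayerFunctional


/-! ### The given noises as a Brownian motion with the signal as a parameter -/

section Signal

variable {T : ℝ≥0} {d n : ℕ} {𝒮 : Type*} [TopologicalSpace 𝒮] [PolishSpace 𝒮] [MeasurableSpace 𝒮]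
  [BorelSpace 𝒮]
variable {Ω : Type*} {mΩ : MeasurableSpace Ω} {P : Measure Ω}

lemma measurable_of_forall_apply {Ω ι : Type*} {m : MeasurableSpace Ω} {F : ι → Type*}
    [∀ i, MeasurableSpace (F i)] {u : Ω → ∀ i, F i} (h : ∀ i, Measurable fun ω => u ω i) :
    Measurable u := measurable_pi_iff.2 h

lemma generated_le_comap {Ω F : Type*} [TopologicalSpace F] [PolishSpace F] [MeasurableSpace F]
    [BorelSpace F] (Z : Ω → PathSpace T F) (t : Time T) :
    generated Z t ≤ MeasurableSpace.comap Z inferInstance := by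
  rw [← comap_stopAt]
  exact ((measurable_stopAt t).comp (comap_measurable Z)).comap_le

lemma IndepFun.prodMk_of_indep [IsProbabilityMeasure P] {𝒰 𝒱 𝒵 : Type*} [MeasurableSpace 𝒰]
    [MeasurableSpace 𝒱] [MeasurableSpace 𝒵] {ξ : Ω → 𝒰} {Z : Ω → 𝒱} {S : Ω → 𝒵}
    (hξ : Measurable ξ) (hZ : Measurable Z) (hS : Measurable S) (h1 : IndepFun ξ Z P)
    (h2 : IndepFun S (fun ω => (ξ ω, Z ω)) P) : IndepFun ξ (fun ω => (S ω, Z ω)) P := by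
  rw [indepFun_iff_map_prod_eq_prod_map_map hξ.aemeasurable (hS.prodMk hZ).aemeasurable]
  refine Measure.ext_prod₃ fun {a b c} ha hb hc => ?_
  have h3 : IndepFun S Z P := h2.comp (φ := id) (ψ := Prod.snd) measurable_id measurable_snd
  rw [Measure.prod_prod, Measure.map_apply hξ ha, Measure.map_apply (hS.prodMk hZ) (hb.prod hc),
    Measure.map_apply (hξ.prodMk (hS.prodMk hZ)) (ha.prod (hb.prod hc))]
  have e1 : (fun ω => (ξ ω, (S ω, Z ω))) ⁻¹' (a ×ˢ (b ×ˢ c)) =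
      S ⁻¹' b ∩ (fun ω => (ξ ω, Z ω)) ⁻¹' (a ×ˢ c) := by
    ext ω; simp only [mem_preimage, mem_prod, mem_inter_iff]; tauto
  have e2 : (fun ω => (ξ ω, Z ω)) ⁻¹' (a ×ˢ c) = ξ ⁻¹' a ∩ Z ⁻¹' c := rfl
  have e3 : (fun ω => (S ω, Z ω)) ⁻¹' (b ×ˢ c) = S ⁻¹' b ∩ Z ⁻¹' c := rfl
  rw [e1, h2.measure_inter_preimage_eq_mul _ _ hb (ha.prod hc), e2,
    h1.measure_inter_preimage_eq_mul _ _ ha hc, e3, h3.measure_inter_preimage_eq_mul _ _ hb hc]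
  ring

variable {𝔽 : Filtration (Time T) mΩ} {B : Ω → PathSpace T (E d)}
  {W : Ω → Fin n → PathSpace T (E d)} {X₀ : Ω → Fin n → E d} {S : Ω → PathSpace T 𝒮}

lemma IsSignal.measurable (hS : IsSignal 𝔽 P B W X₀ S) : Measurable S :=
  measurable_path_iff.2 fun t => (hS.adapted t).mono (𝔽.le t) le_rfl

lemma IsBrownian.measurable_player (hBW : IsBrownian (fun t => 𝔽 t) (noises B W) P) :
    Measurable W :=
  measurable_of_forall_apply fun i => (measurable_pi_apply (some i)).comp hBW.measurable

/-- The common noise is almost surely a measurable function of the signal. -/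
lemma IsSignal.exists_eq_comp (hS : IsSignal 𝔽 P B W X₀ S) :
    ∃ β : PathSpace T 𝒮 → PathSpace T (E d), Measurable β ∧ ∀ᵐ ω ∂P, B ω = β (S ω) := by
  have h1 : ∀ k : ℕ, ∃ g : PathSpace T 𝒮 → E d, Measurable g ∧
      ∀ᵐ ω ∂P, B ω (TopologicalSpace.denseSeq (Time T) k) = g (S ω) := by
    intro k
    obtain ⟨g, hg, h⟩ := (hS.adapted_noise (TopologicalSpace.denseSeq (Time T) k)).mono
      (generated_le_comap S _)
    obtain ⟨g', hg', rfl⟩ := hg.measurable.exists_eq_measurable_comp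
    exact ⟨g', hg', h⟩
  choose g hg h using h1
  obtain ⟨e, he, he'⟩ :=
    (measurableEmbedding_evalDense (T := T) (F := E d)).exists_measurable_extend measurable_id
      fun _ => ⟨0⟩
  refine ⟨fun s => e fun k => g k s, he.comp (measurable_of_forall_apply hg), ?_⟩
  filter_upwards [ae_all_iff.2 h] with ω hω
  have h2 : evalDense T (E d) (B ω) = fun k => g k (S ω) := funext hω
  rw [← h2]
  exact (congrFun he' (B ω)).symm

/-- The information used to solve the system: the initial states, the whole path of the signal,
and the noises of the players up to time `t`. -/
@[reducible] def signalFiltration (X₀ : Ω → Fin n → E d) (S : Ω → PathSpace T 𝒮)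
    (W : Ω → Fin n → PathSpace T (E d)) (t : Time T) : MeasurableSpace Ω :=
  MeasurableSpace.comap (fun ω => (S ω, X₀ ω, stopAt t (bundle (W ω)))) inferInstance

lemma measurable_signalFiltration {t : Time T} : Measurable[signalFiltration X₀ S W t]
    fun ω => (S ω, X₀ ω, stopAt t (bundle (W ω))) := comap_measurable _

lemma IsBrownian.indep_player (hBW : IsBrownian (fun t => 𝔽 t) (noises B W) P) {s t : Time T}
    (hst : s ≤ t) : Indep (MeasurableSpace.comap
      (fun ω => bundle (W ω) t - bundle (W ω) s) inferInstance) (𝔽 s) P := by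
  simp only [bundle_sub_apply]
  rw [comap_toLp]
  refine indep_of_indep_of_le_left (hBW.indep s t hst) ?_
  refine measurable_iff_comap_le.1 (measurable_of_forall_apply fun i => ?_)
  exact (measurable_pi_apply (some i)).comp
    (comap_measurable fun (ω : Ω) (o : Option (Fin n)) => noises B W ω o t - noises B W ω o s)

lemma IsBrownian.law_player (hBW : IsBrownian (fun t => 𝔽 t) (noises B W) P) {s t : Time T}
    (hst : s ≤ t) : P.map (fun ω => bundle (W ω) t - bundle (W ω) s) =
      gaussianIncr (Noise d n) (t - s) := by
  rw [map_bundle_sub_iff hBW.measurable_player hst]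
  have h1 := hBW.law s t hst
  have hm : Measurable fun (x : Option (Fin n) → E d) (i : Fin n) => x (some i) := by fun_prop
  have h2 : HasLaw (fun (x : Option (Fin n) → E d) (i : Fin n) => x (some i))
      (Measure.pi fun _ : Fin n => multivariateGaussian 0
        (((t : ℝ) - (s : ℝ)) • (1 : Matrix (Fin d) (Fin d) ℝ)))
      (Measure.pi fun _ : Option (Fin n) => multivariateGaussian 0
        (((t : ℝ) - (s : ℝ)) • (1 : Matrix (Fin d) (Fin d) ℝ))) :=
    ⟨hm.aemeasurable, map_pi_some _⟩
  exact h2.comp h1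

/-- The noises of the players are measurable with respect to the completion of `𝔽_t`. -/
lemma IsBrownian.measurable_bundle_eventually (hBW : IsBrownian (fun t => 𝔽 t) (noises B W) P)
    {r t : Time T} (hrt : r ≤ t) :
    Measurable[eventuallyMeasurableSpace (𝔽 t) (ae P)] fun ω => bundle (W ω) r :=
  measurable_bundle_apply.2 fun i => measurable_eventually_of_aestronglyMeasurable
    ((hBW.adapted r (some i)).mono (𝔽.mono hrt))

theorem IsSignal.isBM [IsProbabilityMeasure P] (hS : IsSignal 𝔽 P B W X₀ S)
    (hBW : IsBrownian (fun t => 𝔽 t) (noises B W) P) (hX₀ : Measurable[𝔽 (zeroTime T)] X₀) :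
    IsBM (signalFiltration X₀ S W) (fun ω => bundle (W ω)) P := by
  have hSm := hS.measurable
  have hWm := hBW.measurable_player
  have hbW : Measurable fun ω => bundle (W ω) := measurable_bundle.comp hWm
  have hXm : Measurable X₀ := hX₀.mono (𝔽.le _) le_rfl
  have hb : ∀ s t : Time T, Measurable fun ω => bundle (W ω) t - bundle (W ω) s := fun s t =>
    ((measurable_eval t).comp hbW).sub ((measurable_eval s).comp hbW)
  have hmeas : ∀ t, ∀ r ≤ t, Measurable[signalFiltration X₀ S W t] fun ω => bundle (W ω) r :=
    fun t => measurable_stopAt_iff.1 (measurable_snd.comp (measurable_snd.comp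
      measurable_signalFiltration))
  refine ⟨fun s t hst => ?_, fun t => ?_, fun t => hmeas t t le_rfl, ?_, fun s t hst => ?_,
    fun s t hst => hBW.law_player hst⟩
  · refine measurable_iff_comap_le.1 ?_
    exact (measurable_fst.comp measurable_signalFiltration).prodMk
      ((measurable_fst.comp (measurable_snd.comp measurable_signalFiltration)).prodMk
        (measurable_stopAt_iff.2 fun r hr => hmeas t r (hr.trans hst)))
  · exact (hSm.prodMk (hXm.prodMk ((measurable_stopAt t).comp hbW))).comap_le
  · filter_upwards [hBW.start] with ω hω
    ext i : 1
    exact hω (some i)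
  · set ξ : Ω → Noise d n := fun ω => bundle (W ω) t - bundle (W ω) s with hξ
    have h1 : IndepFun ξ (fun ω => (X₀ ω, stopAt s (bundle (W ω)))) P := by
      refine indep_of_indep_of_le_right (indep_eventually (hBW.indep_player hst)) ?_
      refine measurable_iff_comap_le.1 (Measurable.prodMk ?_ (measurable_stopAt_iff.2 fun r hr =>
        hBW.measurable_bundle_eventually hr))
      exact (hX₀.mono (𝔽.mono (zeroTime_le s)) le_rfl).mono (le_eventuallyMeasurableSpace) le_rfl
    have h2 : IndepFun S (fun ω => (ξ ω, (X₀ ω, stopAt s (bundle (W ω))))) P := by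
      refine hS.indep.comp (φ := id) (ψ := fun q : (Fin n → E d) × (Fin n → PathSpace T (E d)) =>
        (bundle q.2 t - bundle q.2 s, (q.1, stopAt s (bundle q.2)))) measurable_id ?_
      have h3 : Measurable fun q : (Fin n → E d) × (Fin n → PathSpace T (E d)) => bundle q.2 :=
        measurable_bundle.comp measurable_snd
      exact (((measurable_eval t).comp h3).sub ((measurable_eval s).comp h3)).prodMk
        (measurable_fst.prodMk ((measurable_stopAt s).comp h3))
    exact IndepFun.prodMk_of_indep (hb s t) (hXm.prodMk ((measurable_stopAt s).comp hbW)) hSm h1 h2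

end Signal

/-! ### Brownian motions under the conditional laws given the signal -/

section Conditional

variable {T : ℝ≥0} {d n : ℕ} {𝒮 : Type*} [TopologicalSpace 𝒮] [PolishSpace 𝒮] [MeasurableSpace 𝒮]
  [BorelSpace 𝒮] [Nonempty 𝒮]
variable {Ω : Type*} {mΩ : MeasurableSpace Ω} {P : Measure Ω} [IsProbabilityMeasure P]
variable {X W : Ω → Fin n → PathSpace T (E d)} {S : Ω → PathSpace T 𝒮}

/-- The space of paths of the states, the signal and the noises. -/
abbrev Triple (T : ℝ≥0) (d n : ℕ) (𝒮 : Type*) [TopologicalSpace 𝒮] :=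
  (Fin n → PathSpace T (E d)) × PathSpace T 𝒮 × (Fin n → PathSpace T (E d))

lemma iSup_generated_sup {t : Time T} :
    (⨆ i, generated (fun z : Triple T d n 𝒮 => z.1 i) t) ⊔ generated (fun z => z.2.1) t =
      MeasurableSpace.comap (fun z : Triple T d n 𝒮 => (stopAt t z.2.1, fun i => stopAt t (z.1 i)))
        inferInstance := by
  apply le_antisymm
  · refine sup_le (iSup_le fun i => ?_) ?_
    · rw [← comap_stopAt]
      exact measurable_iff_comap_le.1 ((measurable_pi_apply i).comp
        (measurable_snd.comp (comap_measurable
          fun z : Triple T d n 𝒮 => (stopAt t z.2.1, fun i => stopAt t (z.1 i)))))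
    · rw [← comap_stopAt]
      exact measurable_iff_comap_le.1 (measurable_fst.comp (comap_measurable
        fun z : Triple T d n 𝒮 => (stopAt t z.2.1, fun i => stopAt t (z.1 i))))
  · refine measurable_iff_comap_le.1 (Measurable.prodMk ?_ (measurable_of_forall_apply fun i => ?_))
    · refine measurable_iff_comap_le.2 ?_
      rw [comap_stopAt]
      exact le_sup_right
    · refine measurable_iff_comap_le.2 ?_
      rw [comap_stopAt]
      exact le_sup_of_le_left (le_iSup (fun i => generated (fun z : Triple T d n 𝒮 => z.1 i) t) i)

lemma ae_ae_condDistrib (hX : Measurable X) (hS : Measurable S) (hW : Measurable W)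
    {p : Triple T d n 𝒮 → Prop} (hp : MeasurableSet {z | p z})
    (h : ∀ᵐ ω ∂P, p (X ω, S ω, W ω)) :
    ∀ᵐ s ∂(P.map S), ∀ᵐ z ∂(condDistrib (fun ω => (X ω, S ω, W ω)) S P s), p z ∧ z.2.1 = s := by
  have hZ : Measurable fun ω => (X ω, S ω, W ω) := hX.prodMk (hS.prodMk hW)
  refine Measure.ae_ae_of_ae_compProd (p := fun q : PathSpace T 𝒮 × Triple T d n 𝒮 =>
    p q.2 ∧ q.2.2.1 = q.1) ?_
  rw [compProd_map_condDistrib hZ.aemeasurable, ae_map_iff (hS.prodMk hZ).aemeasurable]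
  · filter_upwards [h] with ω hω using ⟨hω, rfl⟩
  · exact (measurable_snd hp).inter (measurableSet_eq_fun
      (measurable_fst.comp (measurable_snd.comp measurable_snd)) measurable_fst)

/-- A criterion for a conditional Brownian motion: its increments are independent of the whole
signal and the past of the states, and it is a causal function of the states, given the signal. -/
theorem isConditionallyBrownian_of_indep (hX : Measurable X) (hS : Measurable S)
    (hW : Measurable W)
    (hind : ∀ s t : Time T, s ≤ t → IndepFun (fun ω => bundle (W ω) t - bundle (W ω) s)
      (fun ω => (S ω, fun i => stopAt s (X ω i))) P)
    (hlaw : ∀ s t : Time T, s ≤ t → P.map (fun ω => bundle (W ω) t - bundle (W ω) s) =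
      gaussianIncr (Noise d n) (t - s))
    (hstart : ∀ᵐ ω ∂P, ∀ i, W ω i (zeroTime T) = 0)
    {R : PathSpace T 𝒮 → (Fin n → PathSpace T (E d)) → PathSpace T (Noise d n)}
    (hRm : Measurable fun q : PathSpace T 𝒮 × (Fin n → PathSpace T (E d)) => R q.1 q.2)
    (hR : ∀ s x t, R s (fun i => stopAt t (x i)) t = R s x t)
    (hRW : ∀ᵐ ω ∂P, R (S ω) (X ω) = bundle (W ω)) :
    IsConditionallyBrownian P X S W := by
  set Z : Ω → Triple T d n 𝒮 := fun ω => (X ω, S ω, W ω) with hZdef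
  have hZ : Measurable Z := hX.prodMk (hS.prodMk hW)
  have hW2 : Measurable fun z : Triple T d n 𝒮 => z.2.2 := measurable_snd.comp measurable_snd
  have hbz : Measurable fun z : Triple T d n 𝒮 => bundle z.2.2 := measurable_bundle.comp hW2
  have hξ : ∀ s t : Time T, Measurable fun z : Triple T d n 𝒮 => bundle z.2.2 t - bundle z.2.2 s :=
    fun s t => ((measurable_eval t).comp hbz).sub ((measurable_eval s).comp hbz)
  have hη : ∀ t, Measurable fun z : Triple T d n 𝒮 => (stopAt t z.2.1, fun i => stopAt t (z.1 i)) :=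
    fun t => ((measurable_stopAt t).comp (measurable_fst.comp measurable_snd)).prodMk
      (measurable_of_forall_apply fun i => (measurable_stopAt t).comp
        ((measurable_pi_apply i).comp measurable_fst))
  have h0 : ∀ r t : Time T, r < t → ∀ᵐ s ∂(P.map S),
      IndepFun (fun z : Triple T d n 𝒮 => bundle z.2.2 t - bundle z.2.2 r)
        (fun z => (stopAt r z.2.1, fun i => stopAt r (z.1 i))) (condDistrib Z S P s) ∧
      (condDistrib Z S P s).map (fun z => bundle z.2.2 t - bundle z.2.2 r) =
        gaussianIncr (Noise d n) (t - r) := by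
    intro r t hrt
    rw [← hlaw r t hrt.le]
    refine ae_condDistrib_indep hS hZ (hξ r t) (hη r) ?_
    refine (hind r t hrt.le).comp (φ := id)
      (ψ := fun q : PathSpace T 𝒮 × (Fin n → PathSpace T (E d)) => (q.1, stopAt r q.1, q.2))
      measurable_id ?_
    exact measurable_fst.prodMk (((measurable_stopAt _).comp measurable_fst).prodMk measurable_snd)
  -- Only countably many times can be handled outside of one null set of signals.
  have h1 : ∀ᵐ s ∂(P.map S), ∀ k l : ℕ, TopologicalSpace.denseSeq (Time T) k <
      TopologicalSpace.denseSeq (Time T) l → _ := ae_all_iff.2 fun k => ae_all_iff.2 fun l =>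
    eventually_imp_distrib_left.2 fun hkl => h0 _ _ hkl
  have hp : MeasurableSet {z : Triple T d n 𝒮 | R z.2.1 z.1 = bundle z.2.2 ∧
      ∀ i, z.2.2 i (zeroTime T) = 0} := by
    refine (measurableSet_eq_fun (hRm.comp ((measurable_fst.comp measurable_snd).prodMk
      measurable_fst)) hbz).inter ?_
    have e : {z : Triple T d n 𝒮 | ∀ i, z.2.2 i (zeroTime T) = 0} =
        ⋂ i, {z | z.2.2 i (zeroTime T) = 0} := by ext; simp
    change MeasurableSet {z : Triple T d n 𝒮 | ∀ i, z.2.2 i (zeroTime T) = 0}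
    rw [e]
    exact MeasurableSet.iInter fun i => measurableSet_eq_fun
      ((measurable_eval _).comp ((measurable_pi_apply i).comp hW2)) measurable_const
  have h2 := ae_ae_condDistrib hX hS hW hp (by
    filter_upwards [hRW, hstart] with ω h1 h2 using ⟨h1, h2⟩)
  filter_upwards [h1, h2] with s hs1 hs2
  simp only [iSup_generated_sup]
  have hmono : Monotone fun t : Time T => MeasurableSpace.comap
      (fun z : Triple T d n 𝒮 => (stopAt t z.2.1, fun i => stopAt t (z.1 i))) inferInstance := by
    intro r t hrt
    simp only [← iSup_generated_sup (T := T) (d := d) (n := n) (𝒮 := 𝒮)]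
    refine sup_le_sup (iSup_mono fun i => ?_) ?_ <;>
    exact iSup_mono' fun q => ⟨⟨q.1, q.2.trans hrt⟩, le_rfl⟩
  have hkey := fun (r t : Time T) (hrt : r ≤ t) => indep_and_law_of_dense
    (P := condDistrib Z S P s) hmono hbz (TopologicalSpace.denseRange_denseSeq (Time T))
    (by
      rintro _ ⟨k, rfl⟩ _ ⟨l, rfl⟩ hkl
      exact hs1 k l hkl) hrt
  refine ⟨hW2, fun t i => ?_, hs2.mono fun z hz => hz.1.2, fun r t hrt => ?_, fun r t hrt => ?_⟩
  · refine ⟨fun z => R s z.1 t i, ?_, ?_⟩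
    · have h5 : (fun z : Triple T d n 𝒮 => R s z.1 t i) =
          (fun q : PathSpace T 𝒮 × (Fin n → PathSpace T (E d)) => R s q.2 t i) ∘
            fun z => (stopAt t z.2.1, fun i => stopAt t (z.1 i)) := by
        ext1 z
        simp only [Function.comp_apply, hR]
      have h6 : Measurable fun q : PathSpace T 𝒮 × (Fin n → PathSpace T (E d)) => R s q.2 t i :=
        (measurable_pi_apply i).comp ((WithLp.measurable_ofLp 2 _).comp ((measurable_eval t).comp
          (hRm.comp (measurable_const.prodMk measurable_snd))))
      rw [h5]
      exact (h6.comp (comap_measurable _)).stronglyMeasurable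
    · filter_upwards [hs2] with z hz
      have h7 := hz.1.1
      rw [hz.2] at h7
      rw [h7, bundle_apply]
  · have h8 := (hkey r t hrt).1
    simp only [bundle_sub_apply] at h8
    rwa [comap_toLp] at h8
  · exact (map_bundle_sub_iff hW2 hrt).1 (hkey r t hrt).2

/-- The past of the states and the noises, and the whole path of the signal. -/
@[reducible] def tripleFiltration (T : ℝ≥0) (d n : ℕ) (𝒮 : Type*) [TopologicalSpace 𝒮]
    (t : Time T) :
    MeasurableSpace (Triple T d n 𝒮) :=
  MeasurableSpace.comap
    (fun z => ((fun i => stopAt t (z.1 i)), z.2.1, fun i => stopAt t (z.2.2 i)))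
    (inferInstance : MeasurableSpace (Triple T d n 𝒮))

lemma measurable_tripleFiltration {t : Time T} : Measurable[tripleFiltration T d n 𝒮 t]
    fun z : Triple T d n 𝒮 =>
      (((fun i => stopAt t (z.1 i)), z.2.1, fun i => stopAt t (z.2.2 i)) : Triple T d n 𝒮) :=
  comap_measurable _

/-- A conditional Brownian motion given the signal is a Brownian motion for the filtration which
contains the whole path of the signal from the start. -/
theorem IsConditionallyBrownian.isBM (hX : Measurable X) (hS : Measurable S)
    (hW : Measurable W) (h : IsConditionallyBrownian P X S W) :
    IsBM (tripleFiltration T d n 𝒮) (fun z => bundle z.2.2)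
      (P.map fun ω => (X ω, S ω, W ω)) := by
  set Z : Ω → Triple T d n 𝒮 := fun ω => (X ω, S ω, W ω) with hZdef
  have hZ : Measurable Z := hX.prodMk (hS.prodMk hW)
  have : IsProbabilityMeasure (P.map S) := Measure.isProbabilityMeasure_map hS.aemeasurable
  have hW2 : Measurable fun z : Triple T d n 𝒮 => z.2.2 := measurable_snd.comp measurable_snd
  have hbz : Measurable fun z : Triple T d n 𝒮 => bundle z.2.2 := measurable_bundle.comp hW2
  have hξ : ∀ s t : Time T, Measurable fun z : Triple T d n 𝒮 => bundle z.2.2 t - bundle z.2.2 s :=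
    fun s t => ((measurable_eval t).comp hbz).sub ((measurable_eval s).comp hbz)
  have hJ : ∀ D, MeasurableSet D → P.map Z D = ∫⁻ s, condDistrib Z S P s D ∂(P.map S) := by
    intro D hD
    rw [← condDistrib_comp_map hS.aemeasurable hZ.aemeasurable,
      Measure.bind_apply hD (Kernel.aemeasurable _)]
  have hws : ∀ t, Measurable[tripleFiltration T d n 𝒮 t] fun z : Triple T d n 𝒮 =>
      (fun i => stopAt t (z.2.2 i)) := fun t =>
    measurable_snd.comp (measurable_snd.comp measurable_tripleFiltration)
  have hxs : ∀ t, Measurable[tripleFiltration T d n 𝒮 t] fun z : Triple T d n 𝒮 =>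
      (fun i => stopAt t (z.1 i)) := fun t => measurable_fst.comp measurable_tripleFiltration
  have hss : ∀ t, Measurable[tripleFiltration T d n 𝒮 t] fun z : Triple T d n 𝒮 => z.2.1 :=
    fun t => by
      have h := (measurable_fst.comp measurable_snd :
        Measurable fun z : Triple T d n 𝒮 => z.2.1).comp (measurable_tripleFiltration (t := t))
      exact h
  have hle : ∀ t, tripleFiltration T d n 𝒮 t ≤
      (inferInstance : MeasurableSpace (Triple T d n 𝒮)) := by
    intro t
    refine measurable_iff_comap_le.1 (Measurable.prodMk ?_ (Measurable.prodMk ?_ ?_))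
    · exact measurable_of_forall_apply fun i => (measurable_stopAt t).comp
        ((measurable_pi_apply i).comp measurable_fst)
    · exact measurable_fst.comp measurable_snd
    · exact measurable_of_forall_apply fun i => (measurable_stopAt t).comp
        ((measurable_pi_apply i).comp hW2)
  have h0 := ae_ae_condDistrib (P := P) hX hS hW (p := fun _ => True) MeasurableSet.univ
    (ae_of_all _ fun _ => trivial)
  have hlaw : ∀ s t : Time T, s ≤ t → (P.map Z).map (fun z => bundle z.2.2 t - bundle z.2.2 s) =
      gaussianIncr (Noise d n) (t - s) := by
    intro r t hrt
    ext D hD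
    rw [Measure.map_apply (hξ r t) hD, hJ _ (hξ r t hD)]
    have h1 : ∀ᵐ s ∂(P.map S), condDistrib Z S P s
        ((fun z => bundle z.2.2 t - bundle z.2.2 r) ⁻¹' D) =
        gaussianIncr (Noise d n) (t - r) D := by
      filter_upwards [h] with s hs
      rw [← Measure.map_apply (hξ r t) hD, (map_bundle_sub_iff hW2 hrt).2 (hs.law r t hrt)]
    rw [lintegral_congr_ae h1, lintegral_const, measure_univ, mul_one]
  refine ⟨fun r t hrt => ?_, hle, fun t => ?_, ?_, fun r t hrt => ?_, hlaw⟩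
  · refine measurable_iff_comap_le.1 (Measurable.prodMk ?_ (Measurable.prodMk ?_ ?_))
    · exact measurable_of_forall_apply fun i => measurable_stopAt_iff.2 fun q hq =>
        measurable_stopAt_iff.1 ((measurable_pi_apply i).comp (hxs t)) q (hq.trans hrt)
    · exact hss t
    · exact measurable_of_forall_apply fun i => measurable_stopAt_iff.2 fun q hq =>
        measurable_stopAt_iff.1 ((measurable_pi_apply i).comp (hws t)) q (hq.trans hrt)
  · exact measurable_bundle_apply.2 fun i =>
      measurable_stopAt_iff.1 ((measurable_pi_apply i).comp (hws t)) t le_rfl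
  · have hm : MeasurableSet {z : Triple T d n 𝒮 | bundle z.2.2 (zeroTime T) = 0} :=
      measurableSet_eq_fun ((measurable_eval _).comp hbz) measurable_const
    rw [ae_iff]
    have hc : MeasurableSet {z : Triple T d n 𝒮 | ¬ bundle z.2.2 (zeroTime T) = 0} := hm.compl
    rw [hJ _ hc, lintegral_eq_zero_iff (Kernel.measurable_coe _ hc)]
    filter_upwards [h] with s hs
    have h1 : ∀ᵐ z ∂(condDistrib Z S P s), bundle z.2.2 (zeroTime T) = 0 := by
      filter_upwards [hs.start] with z hz
      ext i : 1
      exact hz i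
    exact ae_iff.1 h1
  · -- The independence given `S = s` is integrated over `s`. Under the conditional law the signal
    -- is almost surely the constant `s`, so that its whole path adds nothing to the filtration.
    rw [Indep_iff]
    rintro _ D ⟨C, hC, rfl⟩ hD
    have hDm : MeasurableSet D := hle r _ hD
    rw [hJ _ ((hξ r t hC).inter hDm), hJ _ hDm]
    rw [← Measure.map_apply (hξ r t) hC, hlaw r t hrt,
      ← lintegral_const_mul _ (Kernel.measurable_coe _ hDm)]
    refine lintegral_congr_ae ?_
    filter_upwards [h, h0] with s hs hs0
    rw [← (map_bundle_sub_iff hW2 hrt).2 (hs.law r t hrt), Measure.map_apply (hξ r t) hC]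
    have h1 := hs.indep r t hrt
    rw [← comap_toLp] at h1
    refine (Indep_iff _ _ _).1 (indep_eventually h1) _ _ ⟨C, hC, rfl⟩ ?_
    obtain ⟨D', hD', rfl⟩ := hD
    refine Measurable.prodMk ?_ (Measurable.prodMk ?_ ?_) hD'
    · refine measurable_of_forall_apply fun i => measurable_stopAt_iff.2 fun q hq => ?_
      have h2 : Measurable[generated (fun z : Triple T d n 𝒮 => z.1 i) r]
          fun z : Triple T d n 𝒮 => z.1 i q :=
        measurable_stopAt_iff.1 (measurable_iff_comap_le.2 (comap_stopAt _ r).le) q hq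
      refine h2.mono ?_ le_rfl
      refine le_trans ?_ le_eventuallyMeasurableSpace
      exact le_sup_of_le_left (le_iSup (fun i => generated (fun z : Triple T d n 𝒮 => z.1 i) r) i)
    · exact Measurable.eventuallyMeasurable_of_eventuallyEq (measurable_const (a := s))
        (hs0.mono fun z hz => hz.2)
    · refine measurable_of_forall_apply fun i => measurable_stopAt_iff.2 fun q hq => ?_
      refine measurable_eventually_of_aestronglyMeasurable ((hs.adapted q i).mono ?_)
      refine sup_le_sup (iSup_mono fun i => ?_) ?_ <;>
      exact iSup_mono' fun u => ⟨⟨u.1, u.2.trans hq⟩, le_rfl⟩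

end Conditional


/-! ### Uniqueness in law of weak solutions -/

section Solutions

variable {T : ℝ≥0} {d n : ℕ} [NeZero n] {p : ℝ≥0}
variable {A : Type*} [MetricSpace A] [CompactSpace A] [MeasurableSpace A] [BorelSpace A]
  {b : Time T → E d → PSpace p d → A → E d}
  {𝒮 : Type*} [TopologicalSpace 𝒮] [PolishSpace 𝒮] [MeasurableSpace 𝒮] [BorelSpace 𝒮] [Nonempty 𝒮]
  {α : Fin n → Time T → (Fin n → PathSpace T (E d)) → PathSpace T 𝒮 → A}
  {σ γ : Matrix (Fin d) (Fin d) ℝ} {L : E d ≃L[ℝ] E d} {Γ : E d →L[ℝ] E d}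
variable {Ω : Type*} {mΩ : MeasurableSpace Ω} {P : Measure Ω} [IsProbabilityMeasure P]
  {𝔽 : Filtration (Time T) mΩ} {B : Ω → PathSpace T (E d)}
  {W : Ω → Fin n → PathSpace T (E d)} {X₀ : Ω → Fin n → E d} {S : Ω → PathSpace T 𝒮}
  {β : PathSpace T 𝒮 → PathSpace T (E d)}

/-- The parameter read off from the states and the signal, when the common noise is the function
`β` of the signal. -/
def paramOf (β : PathSpace T 𝒮 → PathSpace T (E d)) (s : PathSpace T 𝒮)
    (x : Fin n → PathSpace T (E d)) : Param T d n 𝒮 :=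
  (fun i => x i (zeroTime T), s, β s)

lemma measurable_paramOf (hβ : Measurable β) : Measurable fun q : PathSpace T 𝒮 ×
    (Fin n → PathSpace T (E d)) => paramOf β q.1 q.2 := by
  refine Measurable.prodMk (measurable_pi_iff.2 fun i => ?_)
    (measurable_fst.prodMk (hβ.comp measurable_fst))
  exact (measurable_eval (zeroTime T)).comp ((measurable_pi_apply i).comp measurable_snd)

lemma measurable_costate : Measurable fun q : Param T d n 𝒮 × (Fin n → PathSpace T (E d)) =>
    costate L Γ q.1 q.2 :=
  measurable_path_iff.2 fun t => measurable_costate_apply (measurable_fst.comp measurable_fst)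
    ((measurable_eval t).comp (measurable_snd.comp (measurable_snd.comp measurable_fst)))
    fun i => (measurable_eval t).comp ((measurable_pi_apply i).comp measurable_snd)

lemma costate_state (y : Param T d n 𝒮) (v : PathSpace T (Noise d n)) :
    costate L Γ y (state L Γ y v) = v := by
  ext t i : 2
  have h : y.1 i + L (v t i) + Γ (y.2.2 t) - y.1 i - Γ (y.2.2 t) = L (v t i) := by abel
  rw [costate_apply, state_apply, h, ContinuousLinearEquiv.symm_apply_apply]

/-- The noise of a solution, as a functional of the states and the signal. -/
def recoverNoise (L : E d ≃L[ℝ] E d) (Γ : E d →L[ℝ] E d) (hb : IsDrift b)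
    (hα : ∀ i, IsControl (α i)) (β : PathSpace T 𝒮 → PathSpace T (E d)) (s : PathSpace T 𝒮)
    (x : Fin n → PathSpace T (E d)) : PathSpace T (Noise d n) :=
  (playerFunctional L Γ hb hα).residual (paramOf β s x) (costate L Γ (paramOf β s x) x)

lemma measurable_recoverNoise (hb : IsDrift b) (hα : ∀ i, IsControl (α i)) (hβ : Measurable β) :
    Measurable fun q : PathSpace T 𝒮 × (Fin n → PathSpace T (E d)) =>
      recoverNoise L Γ hb hα β q.1 q.2 := by
  have h1 := (measurable_paramOf (n := n) hβ).prodMk measurable_snd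
  have h2 := (measurable_costate (L := L) (Γ := Γ)).comp h1
  have h3 := (playerFunctional L Γ hb hα).measurable_residual.comp
    ((measurable_paramOf hβ).prodMk h2)
  exact h3

lemma recoverNoise_stopAt (hb : IsDrift b) (hα : ∀ i, IsControl (α i)) (s : PathSpace T 𝒮)
    (x : Fin n → PathSpace T (E d)) (t : Time T) :
    recoverNoise L Γ hb hα β s (fun i => stopAt t (x i)) t = recoverNoise L Γ hb hα β s x t := by
  have h1 : paramOf β s (fun i => stopAt t (x i)) = paramOf β s x := by
    simp [paramOf, min_eq_left (zeroTime_le t)]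
  have h2 : ∀ r ≤ t, costate L Γ (paramOf β s x) (fun i => stopAt t (x i)) r =
      costate L Γ (paramOf β s x) x r := by
    intro r hr
    ext i : 1
    simp only [costate_apply, stopAt_apply, min_eq_left hr]
  simp only [recoverNoise, h1, CausalFunctional.residual, ContinuousMap.sub_apply, h2 t le_rfl]
  rw [← CausalFunctional.primitive_stopAt, stopAt_eq_iff.2 h2, CausalFunctional.primitive_stopAt]

/-- If the states start from `x₀` and the common noise is `β(s)`, the system of equations says
that the noise of the players is the one recovered from the states and the signal. -/
lemma recoverNoise_eq_bundle_iff (hb : IsDrift b) (hα : ∀ i, IsControl (α i)) {s : PathSpace T 𝒮}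
    {x w : Fin n → PathSpace T (E d)} {x₀ : Fin n → E d} (hx : ∀ i, x i (zeroTime T) = x₀ i) :
    recoverNoise L Γ hb hα β s x = bundle w ↔
      ∀ i (t : Time T), x i t = x₀ i +
        (∫ r in (0 : ℝ)..t, playerDrift b α i x s (projIcc 0 (T : ℝ) T.2 r)) +
        L (w i t) + Γ (β s t) := by
  refine (residual_costate_eq_bundle_iff L Γ hb hα (paramOf β s x) x w).trans ?_
  simp only [paramOf, hx]

/-- The driving path read off from the states and the signal, when the common noise is the function
`β` of the signal. -/
def drivingOf (L : E d ≃L[ℝ] E d) (Γ : E d →L[ℝ] E d) (β : PathSpace T 𝒮 → PathSpace T (E d))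
    (z : Triple T d n 𝒮) : PathSpace T (Noise d n) :=
  costate L Γ (paramOf β z.2.1 z.1) z.1

lemma measurable_paramOf_triple (hβ : Measurable β) :
    Measurable fun z : Triple T d n 𝒮 => paramOf β z.2.1 z.1 :=
  (measurable_paramOf hβ).comp ((measurable_fst.comp measurable_snd).prodMk measurable_fst)

lemma measurable_bundle_triple : Measurable fun z : Triple T d n 𝒮 => bundle z.2.2 :=
  measurable_bundle.comp (measurable_snd.comp measurable_snd)

lemma measurable_state_tripleFiltration {t r : Time T} (hr : r ≤ t) (i : Fin n) :
    Measurable[tripleFiltration T d n 𝒮 t] fun z : Triple T d n 𝒮 => z.1 i r := by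
  have h1 : Measurable[tripleFiltration T d n 𝒮 t] fun z : Triple T d n 𝒮 => stopAt t (z.1 i) :=
    (measurable_pi_apply i).comp (measurable_fst.comp measurable_tripleFiltration)
  exact measurable_stopAt_iff.1 h1 r hr

lemma measurable_signal_tripleFiltration (t : Time T) :
    Measurable[tripleFiltration T d n 𝒮 t] fun z : Triple T d n 𝒮 => z.2.1 := by
  have h1 := (measurable_fst.comp measurable_snd :
    Measurable fun z : Triple T d n 𝒮 => z.2.1).comp (measurable_tripleFiltration (t := t))
  exact h1

lemma measurable_paramOf_tripleFiltration (hβ : Measurable β) (t : Time T) :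
    Measurable[tripleFiltration T d n 𝒮 t] fun z : Triple T d n 𝒮 => paramOf β z.2.1 z.1 :=
  (measurable_of_forall_apply fun i => measurable_state_tripleFiltration (zeroTime_le t) i).prodMk
    ((measurable_signal_tripleFiltration t).prodMk (hβ.comp (measurable_signal_tripleFiltration t)))

lemma measurable_drivingOf_tripleFiltration (hβ : Measurable β) (t : Time T) :
    Measurable[tripleFiltration T d n 𝒮 t] fun z : Triple T d n 𝒮 => drivingOf L Γ β z t :=
  measurable_costate_apply (measurable_fst.comp (measurable_paramOf_tripleFiltration hβ t))
    ((measurable_eval t).comp (hβ.comp (measurable_signal_tripleFiltration t)))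
    fun i => measurable_state_tripleFiltration le_rfl i

/-- The states and the signal of the solution of the delayed equation with the given data. -/
def delayedPair (L : E d ≃L[ℝ] E d) (Γ : E d →L[ℝ] E d) (hb : IsDrift b)
    (hα : ∀ i, IsControl (α i)) (h : ℝ≥0) (y : Param T d n 𝒮) (w : PathSpace T (Noise d n)) :
    (Fin n → PathSpace T (E d)) × PathSpace T 𝒮 :=
  (state L Γ y ((playerFunctional L Γ hb hα).delaySol h y w), y.2.1)

lemma measurable_delayedPair (hb : IsDrift b) (hα : ∀ i, IsControl (α i)) (h : ℝ≥0) :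
    Measurable fun q : Param T d n 𝒮 × PathSpace T (Noise d n) =>
      delayedPair L Γ hb hα h q.1 q.2 := by
  have h1 := measurable_fst.prodMk ((playerFunctional L Γ hb hα).measurable_delaySol h)
  have h2 := (measurable_state (L := L) (Γ := Γ)).comp h1
  exact h2.prodMk (measurable_fst.comp (measurable_snd.comp measurable_fst))

/-- On the path space of the states, the signal and the noise, the law of the solution of the
delayed equation converges to the law of the solution. -/
lemma tendsto_measure_delayedPair (hT : 0 < T) (hb : IsDrift b) (hα : ∀ i, IsControl (α i))
    (hβ : Measurable β) {J : Measure (Triple T d n 𝒮)} [IsProbabilityMeasure J]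
    (hBM : IsBM (tripleFiltration T d n 𝒮) (fun z => bundle z.2.2) J)
    (hres : ∀ᵐ z ∂J, recoverNoise L Γ hb hα β z.2.1 z.1 = bundle z.2.2)
    {δ : ℕ → ℝ≥0} (hpos : ∀ k, 0 < δ k) (hδ : Tendsto δ atTop (𝓝 0))
    {D : Set ((Fin n → PathSpace T (E d)) × PathSpace T 𝒮)} (hD : MeasurableSet D) :
    Tendsto (fun k => J {z | delayedPair L Γ hb hα (δ k) (paramOf β z.2.1 z.1) (bundle z.2.2) ∈ D})
      atTop (𝓝 (J {z | (z.1, z.2.1) ∈ D})) := by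
  obtain ⟨C, hC⟩ := exists_isGrowth_playerFunctional L Γ hb hα
  have hA : MeasurableSet {q : Param T d n 𝒮 × PathSpace T (Noise d n) |
      (state L Γ q.1 q.2, q.1.2.1) ∈ D} :=
    (measurable_state.prodMk (measurable_fst.comp (measurable_snd.comp measurable_fst))) hD
  have hmain := hBM.tendsto_measure_delaySol hT (measurable_paramOf_tripleFiltration hβ _) hC
    (measurable_drivingOf_tripleFiltration (L := L) (Γ := Γ) hβ) hres hpos hδ hA
  simp only [mem_ofPred_eq, drivingOf, state_costate] at hmain
  exact hmain

/-- The laws of the states and the signal are determined by the law of the data: they are the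
limits of the laws of the solutions of the delayed equations on the given space. -/
theorem IsWeakSolution.tendsto_measure (hT : 0 < T) (hb : IsDrift b) (hα : ∀ i, IsControl (α i))
    (hL : ∀ x, L x = σ.toEuclideanLin x) (hΓ : ∀ x, Γ x = γ.toEuclideanLin x)
    (hβ : Measurable β) (hβS : ∀ᵐ ω ∂P, B ω = β (S ω)) (hX₀ : Measurable X₀) (hS : Measurable S)
    (hW : Measurable W) {Ω' : Type*} {mΩ' : MeasurableSpace Ω'} {P' : Measure Ω'}
    [IsProbabilityMeasure P'] {𝔽' : Filtration (Time T) mΩ'} {π : Ω' → Ω}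
    {X : Ω' → Fin n → PathSpace T (E d)}
    (h : IsWeakSolution b σ γ α 𝔽 P B W X₀ S 𝔽' P' π X) {δ : ℕ → ℝ≥0} (hpos : ∀ k, 0 < δ k)
    (hδ : Tendsto δ atTop (𝓝 0)) {D : Set ((Fin n → PathSpace T (E d)) × PathSpace T 𝒮)}
    (hD : MeasurableSet D) :
    Tendsto (fun k => P {ω |
        delayedPair L Γ hb hα (δ k) (X₀ ω, S ω, β (S ω)) (bundle (W ω)) ∈ D})
      atTop (𝓝 (P' {ω | (X ω, S (π ω)) ∈ D})) := by
  have hπ := h.extension.measurePreserving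
  have hXm : Measurable X := measurable_pi_iff.2 fun i => measurable_path_iff.2 fun t =>
    (h.adapted i t).mono (𝔽'.le t) le_rfl
  have hSπ : Measurable (S ∘ π) := hS.comp hπ.measurable
  have hWπ : Measurable (W ∘ π) := hW.comp hπ.measurable
  have hBM := h.conditionally_brownian.isBM hXm hSπ hWπ
  set Z : Ω' → Triple T d n 𝒮 := fun ω => (X ω, (S ∘ π) ω, (W ∘ π) ω) with hZdef
  have hZ : Measurable Z := hXm.prodMk (hSπ.prodMk hWπ)
  have hJ : IsProbabilityMeasure (P'.map Z) := Measure.isProbabilityMeasure_map hZ.aemeasurable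
  have hstart : ∀ᵐ ω ∂P', (∀ i, X ω i (zeroTime T) = X₀ (π ω) i) ∧ B (π ω) = β (S (π ω)) := by
    filter_upwards [h.sde, h.brownian.start, hπ.quasiMeasurePreserving.ae hβS] with ω h1 h2 h3
    refine ⟨fun i => ?_, h3⟩
    have h4 : W (π ω) i (zeroTime T) = 0 := h2 (some i)
    have h5 : B (π ω) (zeroTime T) = 0 := h2 none
    rw [h1 i (zeroTime T), h4, h5]
    simp [zeroTime]
  have hYZ : ∀ᵐ ω ∂P', paramOf β (S (π ω)) (X ω) = (X₀ (π ω), S (π ω), β (S (π ω))) := by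
    filter_upwards [hstart] with ω h1
    simp only [paramOf, h1.1]
  have hset : MeasurableSet {z : Triple T d n 𝒮 |
      recoverNoise L Γ hb hα β z.2.1 z.1 = bundle z.2.2} := by
    have h1 := (measurable_recoverNoise (L := L) (Γ := Γ) hb hα hβ).comp
      (((measurable_fst.comp measurable_snd).prodMk measurable_fst :
        Measurable fun z : Triple T d n 𝒮 => (z.2.1, z.1)))
    exact measurableSet_eq_fun h1 measurable_bundle_triple
  have hres : ∀ᵐ z ∂(P'.map Z), recoverNoise L Γ hb hα β z.2.1 z.1 = bundle z.2.2 := by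
    refine (ae_map_iff hZ.aemeasurable hset).2 ?_
    filter_upwards [h.sde, hstart] with ω h1 h2
    refine (recoverNoise_eq_bundle_iff hb hα h2.1).2 fun i t => ?_
    have h3 := h1 i t
    rw [h2.2, ← hL, ← hΓ] at h3
    exact h3
  have hmain := tendsto_measure_delayedPair hT hb hα hβ hBM hres hpos hδ hD
  have e1 : P'.map Z {z | (z.1, z.2.1) ∈ D} = P' {ω | (X ω, S (π ω)) ∈ D} :=
    Measure.map_apply hZ ((measurable_fst.prodMk (measurable_fst.comp measurable_snd) :
      Measurable fun z : Triple T d n 𝒮 => (z.1, z.2.1)) hD)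
  rw [e1] at hmain
  refine hmain.congr fun k => ?_
  have hm : Measurable fun z : Triple T d n 𝒮 =>
      delayedPair L Γ hb hα (δ k) (paramOf β z.2.1 z.1) (bundle z.2.2) := by
    have h1 := (measurable_delayedPair (L := L) (Γ := Γ) hb hα (δ k)).comp
      ((measurable_paramOf_triple hβ).prodMk measurable_bundle_triple)
    exact h1
  have hm' : Measurable fun ω =>
      delayedPair L Γ hb hα (δ k) (X₀ ω, S ω, β (S ω)) (bundle (W ω)) := by
    have h1 := (measurable_delayedPair (L := L) (Γ := Γ) hb hα (δ k)).comp
      ((hX₀.prodMk (hS.prodMk (hβ.comp hS))).prodMk (measurable_bundle.comp hW))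
    exact h1
  refine (Measure.map_apply hZ (hm hD)).trans ?_
  refine Eq.trans ?_ (hπ.measure_preimage (hm' hD).nullMeasurableSet)
  refine measure_congr ?_
  filter_upwards [hYZ] with ω hω
  refine propext ?_
  change delayedPair L Γ hb hα (δ k) (paramOf β (S (π ω)) (X ω)) (bundle (W (π ω))) ∈ D ↔ _
  rw [hω]
  rfl

lemma IsWeakSolution.measurable_state (hS : Measurable S) {Ω' : Type*} {mΩ' : MeasurableSpace Ω'}
    {P' : Measure Ω'} [IsProbabilityMeasure P'] {𝔽' : Filtration (Time T) mΩ'} {π : Ω' → Ω}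
    {X : Ω' → Fin n → PathSpace T (E d)}
    (h : IsWeakSolution b σ γ α 𝔽 P B W X₀ S 𝔽' P' π X) :
    Measurable fun ω => (X ω, S (π ω)) :=
  (measurable_pi_iff.2 fun i => measurable_path_iff.2 fun t =>
    (h.adapted i t).mono (𝔽'.le t) le_rfl).prodMk (hS.comp h.extension.measurePreserving.measurable)

theorem IsWeakSolution.map_eq_map (hT : 0 < T) (hb : IsDrift b) (hα : ∀ i, IsControl (α i))
    (hL : ∀ x, L x = σ.toEuclideanLin x) (hΓ : ∀ x, Γ x = γ.toEuclideanLin x)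
    (hβ : Measurable β) (hβS : ∀ᵐ ω ∂P, B ω = β (S ω)) (hX₀ : Measurable X₀) (hS : Measurable S)
    (hW : Measurable W) {Ω₁ Ω₂ : Type*} {m₁ : MeasurableSpace Ω₁} {m₂ : MeasurableSpace Ω₂}
    {P₁ : Measure Ω₁} {P₂ : Measure Ω₂} [IsProbabilityMeasure P₁] [IsProbabilityMeasure P₂]
    {𝔽₁ : Filtration (Time T) m₁} {𝔽₂ : Filtration (Time T) m₂} {π₁ : Ω₁ → Ω} {π₂ : Ω₂ → Ω}
    {X₁ : Ω₁ → Fin n → PathSpace T (E d)} {X₂ : Ω₂ → Fin n → PathSpace T (E d)}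
    (h₁ : IsWeakSolution b σ γ α 𝔽 P B W X₀ S 𝔽₁ P₁ π₁ X₁)
    (h₂ : IsWeakSolution b σ γ α 𝔽 P B W X₀ S 𝔽₂ P₂ π₂ X₂) :
    P₁.map (fun ω => (X₁ ω, S (π₁ ω))) = P₂.map (fun ω => (X₂ ω, S (π₂ ω))) := by
  have hδ : Tendsto (fun k : ℕ => 1 / ((k : ℝ≥0) + 1)) atTop (𝓝 0) :=
    tendsto_one_div_add_atTop_nhds_zero_nat
  have hpos : ∀ k : ℕ, 0 < 1 / ((k : ℝ≥0) + 1) := fun k => by positivity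
  ext D hD
  rw [Measure.map_apply (h₁.measurable_state hS) hD, Measure.map_apply (h₂.measurable_state hS) hD]
  exact tendsto_nhds_unique
    (h₁.tendsto_measure hT hb hα hL hΓ hβ hβS hX₀ hS hW hpos hδ hD)
    (h₂.tendsto_measure hT hb hα hL hΓ hβ hβS hX₀ hS hW hpos hδ hD)

end Solutions



/-! ### Existence of weak solutions -/

section Existence

variable {T : ℝ≥0} {d n : ℕ} [NeZero n] {p : ℝ≥0}
variable {A : Type*} [MetricSpace A] [CompactSpace A] [MeasurableSpace A] [BorelSpace A]
  {b : Time T → E d → PSpace p d → A → E d}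
  {𝒮 : Type*} [TopologicalSpace 𝒮] [PolishSpace 𝒮] [MeasurableSpace 𝒮] [BorelSpace 𝒮] [Nonempty 𝒮]
  {α : Fin n → Time T → (Fin n → PathSpace T (E d)) → PathSpace T 𝒮 → A}
  {σ γ : Matrix (Fin d) (Fin d) ℝ} {L : E d ≃L[ℝ] E d} {Γ : E d →L[ℝ] E d}
variable {Ω : Type*} {mΩ : MeasurableSpace Ω} {P : Measure Ω} [IsProbabilityMeasure P]
  {𝔽 : Filtration (Time T) mΩ} {B : Ω → PathSpace T (E d)}
  {W : Ω → Fin n → PathSpace T (E d)} {X₀ : Ω → Fin n → E d} {S : Ω → PathSpace T 𝒮}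
  {β : PathSpace T 𝒮 → PathSpace T (E d)}
  {η : Kernel Ω (PathSpace T (Noise d n))} [IsMarkovKernel η]

/-- The parameter given by the initial states and the signal. -/
def dataParam (β : PathSpace T 𝒮 → PathSpace T (E d)) (X₀ : Ω → Fin n → E d)
    (S : Ω → PathSpace T 𝒮) (ω : Ω) : Param T d n 𝒮 :=
  (X₀ ω, S ω, β (S ω))

lemma measurable_apply_generated {Ω F : Type*} [TopologicalSpace F] [MeasurableSpace F]
    (Z : Ω → PathSpace T F) {r t : Time T} (hr : r ≤ t) :
    Measurable[generated Z t] fun ω => Z ω r :=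
  measurable_iff_comap_le.2 (le_iSup (fun r : Iic t =>
    MeasurableSpace.comap (fun ω => Z ω r) inferInstance) ⟨r, hr⟩)

lemma measurable_fst_sup {Ω F G : Type*} [TopologicalSpace F] [MeasurableSpace F]
    [MeasurableSpace G] {m : MeasurableSpace Ω} {t : Time T} {u : Ω → G} (hu : Measurable[m] u) :
    Measurable[MeasurableSpace.comap Prod.fst m ⊔ generated Prod.snd t]
      fun q : Ω × PathSpace T F => u q.1 :=
  Measurable.mono (hu.comp (comap_measurable (Prod.fst : Ω × PathSpace T F → Ω)))
    le_sup_left le_rfl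

lemma measurable_snd_sup {Ω F : Type*} [TopologicalSpace F] [MeasurableSpace F]
    {m : MeasurableSpace Ω} {r t : Time T} (hr : r ≤ t) :
    Measurable[MeasurableSpace.comap Prod.fst m ⊔ generated Prod.snd t]
      fun q : Ω × PathSpace T F => q.2 r :=
  (measurable_apply_generated Prod.snd hr).mono le_sup_right le_rfl

lemma measurable_dataParam {m : MeasurableSpace Ω} (hβ : Measurable β) (hX₀ : Measurable X₀)
    (hS : Measurable S) : Measurable (dataParam β X₀ S) :=
  hX₀.prodMk (hS.prodMk (hβ.comp hS))

lemma measurable_dataParam_signalFiltration (hβ : Measurable β) (t : Time T) :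
    Measurable[signalFiltration X₀ S W t] (dataParam β X₀ S) :=
  measurable_dataParam hβ (measurable_fst.comp (measurable_snd.comp measurable_signalFiltration))
    (measurable_fst.comp measurable_signalFiltration)

/-- There is a kernel which gives a solution of the equation driven by the given noises, and which
is a stable limit of the solutions of the delayed equations. -/
lemma IsSignal.exists_kernel (hT : 0 < T) (hS : IsSignal 𝔽 P B W X₀ S)
    (hBW : IsBrownian (fun t => 𝔽 t) (noises B W) P) (hX₀ : Measurable[𝔽 (zeroTime T)] X₀)
    (hβ : Measurable β) (L : E d ≃L[ℝ] E d) (Γ : E d →L[ℝ] E d) (hb : IsDrift b)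
    (hα : ∀ i, IsControl (α i)) {δ : ℕ → ℝ≥0} (hpos : ∀ k, 0 < δ k)
    (hδ : Tendsto δ atTop (𝓝 0)) :
    ∃ η : Kernel Ω (PathSpace T (Noise d n)), IsMarkovKernel η ∧
      (∀ᵐ q ∂(P ⊗ₘ η), (playerFunctional L Γ hb hα).residual (dataParam β X₀ S q.1) q.2 =
        bundle (W q.1)) ∧
      ∀ D, MeasurableSet D → ∀ G, MeasurableSet G →
        Tendsto (fun k => P (D ∩ (fun ω => (playerFunctional L Γ hb hα).delaySol (δ k)
          (dataParam β X₀ S ω) (bundle (W ω))) ⁻¹' G)) atTop (𝓝 ((P ⊗ₘ η) (D ×ˢ G))) := by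
  obtain ⟨C, hC⟩ := exists_isGrowth_playerFunctional L Γ hb hα
  have hbW : Measurable fun ω => bundle (W ω) := measurable_bundle.comp hBW.measurable_player
  have hYm : Measurable (dataParam β X₀ S) :=
    measurable_dataParam hβ (hX₀.mono (𝔽.le _) le_rfl) hS.measurable
  obtain ⟨κ, hκ, hres, hlim⟩ := (hS.isBM hBW hX₀).exists_kernel hT
    (measurable_dataParam_signalFiltration hβ _) hC hpos hδ
  have hYW : Measurable fun ω => (dataParam β X₀ S ω, bundle (W ω)) := hYm.prodMk hbW
  refine ⟨κ.comap _ hYW, Kernel.IsMarkovKernel.comap κ hYW, ?_, fun D hD G hG => ?_⟩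
  · refine Measure.ae_compProd_of_ae_ae ?_ hres
    have h1 := (playerFunctional L Γ hb hα).measurable_residual.comp
      ((hYm.comp measurable_fst).prodMk measurable_snd)
    exact measurableSet_eq_fun h1 (hbW.comp measurable_fst)
  · rw [Measure.compProd_apply_prod hD hG]
    exact hlim D hD G hG

/-- The states of the solution given by the kernel. -/
def limitState (L : E d ≃L[ℝ] E d) (Γ : E d →L[ℝ] E d)
    (β : PathSpace T 𝒮 → PathSpace T (E d)) (X₀ : Ω → Fin n → E d) (S : Ω → PathSpace T 𝒮)
    (q : Ω × PathSpace T (Noise d n)) : Fin n → PathSpace T (E d) :=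
  state L Γ (dataParam β X₀ S q.1) q.2

lemma measurable_limitState (hβ : Measurable β) (hX₀ : Measurable X₀) (hS : Measurable S) :
    Measurable (limitState L Γ β X₀ S) := by
  have h1 := (measurable_state (L := L) (Γ := Γ)).comp
    (((measurable_dataParam hβ hX₀ hS).comp measurable_fst).prodMk measurable_snd)
  exact h1

/-- The filtration of the extension, generated by the given filtration and by the states. -/
def limitFiltration (𝔽 : Filtration (Time T) mΩ) {X : Ω × PathSpace T (Noise d n) →
    Fin n → PathSpace T (E d)} (hX : Measurable X) :
    Filtration (Time T) (Prod.instMeasurableSpace : MeasurableSpace (Ω × PathSpace T (Noise d n)))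
    where
  seq t := MeasurableSpace.comap Prod.fst (𝔽 t) ⊔ ⨆ i, generated (fun q => X q i) t
  mono' s t hst := by
    refine sup_le_sup (MeasurableSpace.comap_mono (𝔽.mono hst)) (iSup_mono fun i => ?_)
    exact iSup_le fun r => measurable_iff_comap_le.1
      (measurable_apply_generated _ (r.2.trans hst))
  le' t := by
    refine sup_le ((MeasurableSpace.comap_mono (𝔽.le t)).trans measurable_fst.comap_le)
      (iSup_le fun i => iSup_le fun r => Measurable.comap_le ?_)
    exact (measurable_eval r.1).comp ((measurable_pi_apply i).comp hX)

lemma measurable_limitFiltration {X : Ω × PathSpace T (Noise d n) → Fin n → PathSpace T (E d)}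
    (hX : Measurable X) (i : Fin n) (t : Time T) :
    Measurable[limitFiltration 𝔽 hX t] fun q => X q i t :=
  (measurable_apply_generated (fun q => X q i) le_rfl).mono
    (le_sup_of_le_right (le_iSup (fun i => generated (fun q => X q i) t) i)) le_rfl

lemma measurePreserving_fst_compProd : MeasurePreserving Prod.fst (P ⊗ₘ η) P :=
  ⟨measurable_fst, Measure.fst_compProd P η⟩

lemma aestronglyMeasurable_fst_compProd {m mΩ : MeasurableSpace Ω} {P : Measure Ω}
    [IsProbabilityMeasure P] {η : Kernel Ω (PathSpace T (Noise d n))} [IsMarkovKernel η]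
    {u : Ω → E d} (hu : AEStronglyMeasurable[m] u P) :
    AEStronglyMeasurable[MeasurableSpace.comap Prod.fst m]
      (fun q : Ω × PathSpace T (Noise d n) => u q.1) (P ⊗ₘ η) := by
  obtain ⟨g, hg, h⟩ := hu
  refine ⟨fun q => g q.1, hg.comp_measurable (comap_measurable _), ?_⟩
  exact (measurePreserving_fst_compProd (P := P) (η := η)).quasiMeasurePreserving.ae_eq_comp h

lemma IsBrownian.aestronglyMeasurable_common (hBW : IsBrownian (fun t => 𝔽 t) (noises B W) P)
    (hβS : ∀ᵐ ω ∂P, B ω = β (S ω)) {r t : Time T} (hr : r ≤ t) :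
    AEStronglyMeasurable[𝔽 t] (fun ω => β (S ω) r) P := by
  refine ((hBW.adapted r none).mono (𝔽.mono hr)).congr ?_
  filter_upwards [hβS] with ω hω
  exact congrArg (fun w : PathSpace T (E d) => w r) hω

/-- The states of the limit are adapted to the completion of the filtration generated by the given
filtration and the driving path. -/
lemma measurable_limitState_eventually (hBW : IsBrownian (fun t => 𝔽 t) (noises B W) P)
    (hX₀ : Measurable[𝔽 (zeroTime T)] X₀) (hβS : ∀ᵐ ω ∂P, B ω = β (S ω)) {r t : Time T}
    (hr : r ≤ t) (i : Fin n) :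
    Measurable[eventuallyMeasurableSpace (MeasurableSpace.comap Prod.fst (𝔽 t) ⊔
      generated Prod.snd t) (ae (P ⊗ₘ η))] fun q => limitState L Γ β X₀ S q i r := by
  refine measurable_state_apply (Y := fun q : Ω × PathSpace T (Noise d n) =>
    dataParam β X₀ S q.1) (V := Prod.snd) (t := r) ?_ ?_ ?_ i
  · exact (measurable_fst_sup (hX₀.mono (𝔽.mono (zeroTime_le t)) le_rfl)).mono
      le_eventuallyMeasurableSpace le_rfl
  · exact measurable_eventually_of_aestronglyMeasurable ((aestronglyMeasurable_fst_compProd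
      (hBW.aestronglyMeasurable_common hβS hr)).mono le_sup_left)
  · exact (measurable_snd_sup hr).mono le_eventuallyMeasurableSpace le_rfl

/-- The solutions of the delayed equations are adapted to the completion of the given
filtration. -/
lemma measurable_delaySol_eventually (hS : IsSignal 𝔽 P B W X₀ S)
    (hBW : IsBrownian (fun t => 𝔽 t) (noises B W) P) (hX₀ : Measurable[𝔽 (zeroTime T)] X₀)
    (hβS : ∀ᵐ ω ∂P, B ω = β (S ω)) (hb : IsDrift b) (hα : ∀ i, IsControl (α i)) {h : ℝ≥0}
    (hh : 0 < h) {r t : Time T} (hr : r ≤ t) :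
    Measurable[eventuallyMeasurableSpace (𝔽 t) (ae P)] fun ω =>
      (playerFunctional L Γ hb hα).delaySol h (dataParam β X₀ S ω) (bundle (W ω)) r := by
  -- Before time `t`, only the signal and the common noise stopped at time `t` matter.
  refine (playerFunctional L Γ hb hα).measurable_delaySol_apply hh (t := t)
    (τ := fun y => (y.1, stopAt t y.2.1, stopAt t y.2.2)) (fun r hr y u => ?_) ?_
    (fun r hr => hBW.measurable_bundle_eventually hr) r hr
  · refine playerField_congr L Γ hα rfl (fun s hs => ?_) (fun s hs => ?_) fun _ _ => rfl
    · exact congrArg y.2.1 (min_eq_left (hs.trans hr))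
    · exact congrArg y.2.2 (min_eq_left (hs.trans hr))
  · refine Measurable.prodMk ?_ (Measurable.prodMk ?_ ?_)
    · exact (hX₀.mono (𝔽.mono (zeroTime_le t)) le_rfl).mono le_eventuallyMeasurableSpace le_rfl
    · exact measurable_stopAt_iff.2 fun s hs => ((hS.adapted s).mono (𝔽.mono hs) le_rfl).mono
        le_eventuallyMeasurableSpace le_rfl
    · exact measurable_stopAt_iff.2 fun s hs => measurable_eventually_of_aestronglyMeasurable
        (hBW.aestronglyMeasurable_common hβS hs)

/-- The solutions of the delayed equations are adapted to the filtration generated by the data and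
the noises of the players. -/
lemma measurable_delaySol_signalFiltration (hβ : Measurable β) (hb : IsDrift b)
    (hα : ∀ i, IsControl (α i)) {h : ℝ≥0} (hh : 0 < h) {r t : Time T} (hr : r ≤ t) :
    Measurable[signalFiltration X₀ S W t] fun ω =>
      (playerFunctional L Γ hb hα).delaySol h (dataParam β X₀ S ω) (bundle (W ω)) r :=
  (playerFunctional L Γ hb hα).measurable_delaySol_apply hh (t := t) (τ := id)
    (fun _ _ _ _ => rfl) (measurable_dataParam_signalFiltration hβ t)
    (measurable_stopAt_iff.1 (measurable_snd.comp (measurable_snd.comp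
      measurable_signalFiltration))) r hr

/-- The given noises are Brownian motions on the extension: the increments are independent of the
past of the solutions of the delayed equations, hence of the past of the limit. -/
lemma isBrownian_limitFiltration (hS : IsSignal 𝔽 P B W X₀ S)
    (hBW : IsBrownian (fun t => 𝔽 t) (noises B W) P) (hX₀ : Measurable[𝔽 (zeroTime T)] X₀)
    (hβS : ∀ᵐ ω ∂P, B ω = β (S ω)) (hb : IsDrift b) (hα : ∀ i, IsControl (α i))
    {δ : ℕ → ℝ≥0} (hpos : ∀ k, 0 < δ k)
    (hlim : ∀ D, MeasurableSet D → ∀ G, MeasurableSet G →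
        Tendsto (fun k => P (D ∩ (fun ω => (playerFunctional L Γ hb hα).delaySol (δ k)
          (dataParam β X₀ S ω) (bundle (W ω))) ⁻¹' G)) atTop (𝓝 ((P ⊗ₘ η) (D ×ˢ G))))
    (hX : Measurable (limitState (n := n) L Γ β X₀ S)) :
    IsBrownian (fun t => limitFiltration 𝔽 hX t)
      (noises (B ∘ Prod.fst) (W ∘ Prod.fst)) (P ⊗ₘ η) := by
  have hπ := measurePreserving_fst_compProd (P := P) (η := η)
  have e : noises (B ∘ Prod.fst) (W ∘ Prod.fst) =
      fun q : Ω × PathSpace T (Noise d n) => noises B W q.1 := rfl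
  rw [e]
  refine ⟨hBW.measurable.comp measurable_fst, fun t i => ?_, ?_, fun s t hst => ?_,
    fun s t hst => ?_⟩
  · exact (aestronglyMeasurable_fst_compProd (hBW.adapted t i)).mono le_sup_left
  · exact hπ.quasiMeasurePreserving.ae hBW.start
  · have hξ : Measurable fun ω i => noises B W ω i t - noises B W ω i s :=
      measurable_of_forall_apply fun i =>
        ((measurable_eval t).comp ((measurable_pi_apply i).comp hBW.measurable)).sub
          ((measurable_eval s).comp ((measurable_pi_apply i).comp hBW.measurable))
    refine indep_of_indep_of_le_right (indep_eventually (indep_of_tendsto hlim (𝔽.le s) hξ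
      (hBW.indep s t hst) fun k r hr =>
        measurable_delaySol_eventually hS hBW hX₀ hβS hb hα (hpos k) hr)) ?_
    refine sup_le (le_sup_left.trans le_eventuallyMeasurableSpace)
      (iSup_le fun i => iSup_le fun r => measurable_iff_comap_le.1 ?_)
    exact measurable_limitState_eventually hBW hX₀ hβS r.2 i
  · exact (hBW.law s t hst).comp hπ.hasLaw

lemma sde_limitState (hL : ∀ x, L x = σ.toEuclideanLin x) (hΓ : ∀ x, Γ x = γ.toEuclideanLin x)
    (hβS : ∀ᵐ ω ∂P, B ω = β (S ω)) (hb : IsDrift b) (hα : ∀ i, IsControl (α i))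
    (hres : ∀ᵐ q ∂(P ⊗ₘ η), (playerFunctional L Γ hb hα).residual (dataParam β X₀ S q.1) q.2 =
        bundle (W q.1)) :
    ∀ᵐ q ∂(P ⊗ₘ η), ∀ i (t : Time T), limitState L Γ β X₀ S q i t = X₀ q.1 i +
      (∫ r in (0 : ℝ)..t, playerDrift b α i (limitState L Γ β X₀ S q) (S q.1)
        (projIcc 0 (T : ℝ) T.2 r)) +
      σ.toEuclideanLin (W q.1 i t) + γ.toEuclideanLin (B q.1 t) := by
  have hπ := measurePreserving_fst_compProd (P := P) (η := η)
  filter_upwards [hres, hπ.quasiMeasurePreserving.ae hβS] with q h1 h2 i t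
  have h3 := (residual_costate_eq_bundle_iff L Γ hb hα (dataParam β X₀ S q.1)
    (limitState L Γ β X₀ S q) (W q.1)).1 (by rw [limitState, costate_state, h1]) i t
  rw [hL, hΓ] at h3
  rw [h2]
  exact h3

/-- The noises of the players are Brownian motions given the signal: their increments are
independent of the whole signal and of the past of the limit. -/
lemma isConditionallyBrownian_limitState (hS : IsSignal 𝔽 P B W X₀ S)
    (hBW : IsBrownian (fun t => 𝔽 t) (noises B W) P) (hX₀ : Measurable[𝔽 (zeroTime T)] X₀)
    (hβ : Measurable β) (hb : IsDrift b) (hα : ∀ i, IsControl (α i))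
    {δ : ℕ → ℝ≥0} (hpos : ∀ k, 0 < δ k)
    (hlim : ∀ D, MeasurableSet D → ∀ G, MeasurableSet G →
        Tendsto (fun k => P (D ∩ (fun ω => (playerFunctional L Γ hb hα).delaySol (δ k)
          (dataParam β X₀ S ω) (bundle (W ω))) ⁻¹' G)) atTop (𝓝 ((P ⊗ₘ η) (D ×ˢ G))))
    (hsde : ∀ᵐ q ∂(P ⊗ₘ η), ∀ i (t : Time T), limitState L Γ β X₀ S q i t = X₀ q.1 i +
      (∫ r in (0 : ℝ)..t, playerDrift b α i (limitState L Γ β X₀ S q) (S q.1)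
        (projIcc 0 (T : ℝ) T.2 r)) + L (W q.1 i t) + Γ (β (S q.1) t))
    (hstart : ∀ᵐ q ∂(P ⊗ₘ η), ∀ i, limitState L Γ β X₀ S q i (zeroTime T) = X₀ q.1 i) :
    IsConditionallyBrownian (P ⊗ₘ η) (limitState L Γ β X₀ S) (S ∘ Prod.fst)
      (W ∘ Prod.fst) := by
  have hπ := measurePreserving_fst_compProd (P := P) (η := η)
  have hBM := hS.isBM hBW hX₀
  have hX : Measurable (limitState (n := n) L Γ β X₀ S) :=
    measurable_limitState hβ (hX₀.mono (𝔽.le _) le_rfl) hS.measurable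
  have hbW : Measurable fun ω => bundle (W ω) := measurable_bundle.comp hBW.measurable_player
  have hξ : ∀ s t : Time T, Measurable fun ω => bundle (W ω) t - bundle (W ω) s := fun s t =>
    ((measurable_eval t).comp hbW).sub ((measurable_eval s).comp hbW)
  refine isConditionallyBrownian_of_indep hX (hS.measurable.comp measurable_fst)
    (hBW.measurable_player.comp measurable_fst) (fun s t hst => ?_) (fun s t hst => ?_) ?_
    (measurable_recoverNoise (L := L) (Γ := Γ) hb hα hβ)
    (fun s x t => recoverNoise_stopAt hb hα s x t) ?_
  · refine indep_of_indep_of_le_right (indep_of_tendsto hlim (hBM.le s) (hξ s t)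
      (hBM.indep s t hst) fun k r hr => (measurable_delaySol_signalFiltration hβ hb hα
        (hpos k) hr).mono le_eventuallyMeasurableSpace le_rfl) ?_
    have hYs := measurable_dataParam_signalFiltration (X₀ := X₀) (S := S) (W := W) hβ s
    refine measurable_iff_comap_le.1 (Measurable.prodMk ?_
      (measurable_of_forall_apply fun i => measurable_stopAt_iff.2 fun r hr => ?_))
    · exact measurable_fst_sup (measurable_fst.comp measurable_signalFiltration)
    · have h1 := measurable_fst_sup (F := Noise d n) (t := s) hYs
      exact measurable_state_apply (Y := fun q : Ω × PathSpace T (Noise d n) =>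
        dataParam β X₀ S q.1) (V := Prod.snd) (t := r) (measurable_fst.comp h1)
        ((measurable_eval r).comp (measurable_snd.comp (measurable_snd.comp h1)))
        (measurable_snd_sup hr) i
  · have h1 := Measure.map_map (μ := P ⊗ₘ η) (hξ s t) measurable_fst
    rw [hπ.map_eq] at h1
    exact h1.symm.trans (hBM.law s t hst)
  · filter_upwards [hπ.quasiMeasurePreserving.ae hBW.start] with q hq i using hq (some i)
  · filter_upwards [hsde, hstart] with q h1 h2
    exact (recoverNoise_eq_bundle_iff hb hα h2).2 h1

theorem IsSignal.exists_isWeakSolution (hT : 0 < T) (hS : IsSignal 𝔽 P B W X₀ S)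
    (hBW : IsBrownian (fun t => 𝔽 t) (noises B W) P) (hX₀ : Measurable[𝔽 (zeroTime T)] X₀)
    (hL : ∀ x, L x = σ.toEuclideanLin x) (hΓ : ∀ x, Γ x = γ.toEuclideanLin x)
    (hβ : Measurable β) (hβS : ∀ᵐ ω ∂P, B ω = β (S ω)) (hb : IsDrift b)
    (hα : ∀ i, IsControl (α i)) :
    ∃ (η : Kernel Ω (PathSpace T (Noise d n))) (_ : IsMarkovKernel η)
      (𝔽' : Filtration (Time T) (Prod.instMeasurableSpace :
        MeasurableSpace (Ω × PathSpace T (Noise d n))))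
      (X : Ω × PathSpace T (Noise d n) → Fin n → PathSpace T (E d)),
      IsWeakSolution b σ γ α 𝔽 P B W X₀ S 𝔽' (P ⊗ₘ η) Prod.fst X := by
  have hδ : Tendsto (fun k : ℕ => 1 / ((k : ℝ≥0) + 1)) atTop (𝓝 0) :=
    tendsto_one_div_add_atTop_nhds_zero_nat
  have hpos : ∀ k : ℕ, 0 < 1 / ((k : ℝ≥0) + 1) := fun k => by positivity
  obtain ⟨η, hη, hres, hlim⟩ := hS.exists_kernel hT hBW hX₀ hβ L Γ hb hα hpos hδ
  have hX : Measurable (limitState (n := n) L Γ β X₀ S) :=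
    measurable_limitState hβ (hX₀.mono (𝔽.le _) le_rfl) hS.measurable
  have hπ := measurePreserving_fst_compProd (P := P) (η := η)
  have hsde := sde_limitState hL hΓ hβS hb hα hres
  refine ⟨η, hη, limitFiltration 𝔽 hX, limitState L Γ β X₀ S, ⟨hπ, fun t => le_sup_left⟩,
    isBrownian_limitFiltration hS hBW hX₀ hβS hb hα hpos hlim hX,
    measurable_limitFiltration hX,
    ae_of_all _ fun q i => intervalIntegrable_playerDrift hb hα _ _ i, hsde, ?_⟩
  refine isConditionallyBrownian_limitState hS hBW hX₀ hβ hb hα hpos hlim ?_ ?_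
  · filter_upwards [hsde, hπ.quasiMeasurePreserving.ae hβS] with q h1 h2 i t
    rw [hL, hΓ, ← h2]
    exact h1 i t
  · filter_upwards [hsde, hπ.quasiMeasurePreserving.ae hBW.start] with q h1 h2 i
    have h4 : W q.1 i (zeroTime T) = 0 := h2 (some i)
    have h5 : B q.1 (zeroTime T) = 0 := h2 none
    rw [h1 i (zeroTime T), h4, h5]
    simp [zeroTime]

end Existence

end

end NPlayer

theorem mainTheorem6 {T : ℝ≥0} (hT : 0 < T) {d n : ℕ} [NeZero n] {p : ℝ≥0}
    {A : Type w} [MetricSpace A] [CompactSpace A] [MeasurableSpace A] [BorelSpace A]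
    (b : NPlayer.Time T → NPlayer.E d → NPlayer.PSpace p d → A → NPlayer.E d)
    (hb : NPlayer.IsDrift b)
    (σ γ : Matrix (Fin d) (Fin d) ℝ) (hσ : IsUnit σ)
    {Ω : Type u} {mΩ : MeasurableSpace Ω} (P : Measure Ω) [IsProbabilityMeasure P]
    (𝔽 : Filtration (NPlayer.Time T) mΩ)
    (B : Ω → NPlayer.PathSpace T (NPlayer.E d))
    (W : Ω → Fin n → NPlayer.PathSpace T (NPlayer.E d))
    (hBW : NPlayer.IsBrownian (fun t => 𝔽 t) (NPlayer.noises B W) P)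
    (X₀ : Ω → Fin n → NPlayer.E d) (hX₀ : Measurable[𝔽 (NPlayer.zeroTime T)] X₀)
    {𝒮 : Type v} [TopologicalSpace 𝒮] [PolishSpace 𝒮] [MeasurableSpace 𝒮] [BorelSpace 𝒮]
    [Nonempty 𝒮]
    (S : Ω → NPlayer.PathSpace T 𝒮) (hS : NPlayer.IsSignal 𝔽 P B W X₀ S)
    (α : Fin n → NPlayer.Time T → (Fin n → NPlayer.PathSpace T (NPlayer.E d)) →
      NPlayer.PathSpace T 𝒮 → A)
    (hα : ∀ i, NPlayer.IsControl (α i)) :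
    (∃ (Ω' : Type u) (mΩ' : MeasurableSpace Ω') (P' : Measure Ω') (_ : IsProbabilityMeasure P')
      (𝔽' : Filtration (NPlayer.Time T) mΩ') (π : Ω' → Ω)
      (X : Ω' → Fin n → NPlayer.PathSpace T (NPlayer.E d)),
      NPlayer.IsWeakSolution b σ γ α 𝔽 P B W X₀ S 𝔽' P' π X) ∧
    (∀ (Ω₁ : Type u₁) (m₁ : MeasurableSpace Ω₁) (P₁ : Measure Ω₁) (_ : IsProbabilityMeasure P₁)
      (𝔽₁ : Filtration (NPlayer.Time T) m₁) (π₁ : Ω₁ → Ω)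
      (X₁ : Ω₁ → Fin n → NPlayer.PathSpace T (NPlayer.E d))
      (Ω₂ : Type u₂) (m₂ : MeasurableSpace Ω₂) (P₂ : Measure Ω₂) (_ : IsProbabilityMeasure P₂)
      (𝔽₂ : Filtration (NPlayer.Time T) m₂) (π₂ : Ω₂ → Ω)
      (X₂ : Ω₂ → Fin n → NPlayer.PathSpace T (NPlayer.E d)),
      NPlayer.IsWeakSolution b σ γ α 𝔽 P B W X₀ S 𝔽₁ P₁ π₁ X₁ →
      NPlayer.IsWeakSolution b σ γ α 𝔽 P B W X₀ S 𝔽₂ P₂ π₂ X₂ →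
      P₁.map (fun ω => (X₁ ω, S (π₁ ω))) = P₂.map (fun ω => (X₂ ω, S (π₂ ω)))) := by
  obtain ⟨L, hL⟩ : ∃ L : NPlayer.E d ≃L[ℝ] NPlayer.E d, ∀ x, L x = σ.toEuclideanLin x := by
    have h1 : IsUnit (Matrix.toEuclideanCLM (𝕜 := ℝ) σ) := hσ.map _
    exact ⟨ContinuousLinearEquiv.ofUnit h1.unit, fun x => rfl⟩
  obtain ⟨β, hβ, hβS⟩ := hS.exists_eq_comp
  have hΓ : ∀ x, (Matrix.toEuclideanLin γ).toContinuousLinearMap x = γ.toEuclideanLin x :=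
    fun x => rfl
  refine ⟨?_, fun Ω₁ m₁ P₁ _ 𝔽₁ π₁ X₁ Ω₂ m₂ P₂ _ 𝔽₂ π₂ X₂ h₁ h₂ => ?_⟩
  · obtain ⟨η, hη, 𝔽', X, h⟩ := hS.exists_isWeakSolution hT hBW hX₀ hL hΓ hβ hβS hb hα
    exact ⟨_, _, P ⊗ₘ η, inferInstance, 𝔽', Prod.fst, X, h⟩
  · exact h₁.map_eq_map hT hb hα hL hΓ hβ hβS (hX₀.mono (𝔽.le _) le_rfl) hS.measurable
      hBW.measurable_player h₂
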